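/- Let $n$ be a positive integer, $1<p<n$, $p^*=\frac{np}{n-p}$, and $$\mathcal D^{1,p}(\mathbb R^n)=\{u\in L^{p^*}(\mathbb R^n)\,:\,\nabla u\in L^p(\mathbb R^n)\},$$ where $\nabla u$ is the weak gradient. Let $C_0\ge 1$ and $K\in\mathbb R$. Then there is a constant $c_0>0$, depending only on $n$, $p$, $C_0$ and $K$, with the following property. Let $\kappa\in L^\infty(\mathbb R^n)$ be positive a.e. with $\|\kappa\|_{L^\infty(\mathbb R^n)}\le K$, and let $u\in\mathcal D^{1,p}(\mathbb R^n)$ be a non-negative, non-trivial (not a.e. zero) weak solution of $$\Delta_p u+\kappa(x)\,u^{p^*-1}=0\quad\text{in }\mathbb R^n,$$ that is, $\int_{\mathbb R^n}|\nabla u|^{p-2}\langle\nabla u,\nabla\varphi\rangle\,dx=\int_{\mathbb R^n}\kappa\,u^{p^*-1}\varphi\,dx$ for all $\varphi\in C_c^\infty(\mathbb R^n)$, such that $$u(x)\le\frac{C_0}{1+|x|^{\frac{n-p}{p-1}}}\quad\text{for a.e. }x\in\mathbb R^n.$$ Then $$u(x)\ge\frac{c_0}{1+|x|^{\frac{n-p}{p-1}}}$$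 for a.e. $x\in\mathbb R^n$; moreover, for every function $v$ that agrees with $u$ almost everywhere, $v(x)\ge c_0/\bigl(1+|x|^{\frac{n-p}{p-1}}\bigr)$ at every point $x$ at which $v$ is continuous (in particular, at every $x\in\mathbb R^n$ for the continuous representative of $u$). -/

import Mathlib

open MeasureTheory

namespace CritPLaplace

/-- The Sobolev critical exponent `p* = n p / (n - p)`. -/
noncomputable def critExp (n : ℕ) (p : ℝ) : ℝ := (n : ℝ) * p / ((n : ℝ) - p)

/-- `φ ∈ C_c^∞(ℝⁿ)`. -/
def IsTestFunction {n : ℕ} (φ : EuclideanSpace ℝ (Fin n) → ℝ) : Prop :=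
  ContDiff ℝ ((⊤ : ℕ∞) : WithTop ℕ∞) φ ∧ HasCompactSupport φ

/-- `G` is the weak (distributional) gradient of `u` on `ℝⁿ`:
`∫ u ∇φ = - ∫ φ G` for all test functions `φ`. -/
def HasWeakGradient {n : ℕ} (u : EuclideanSpace ℝ (Fin n) → ℝ)
    (G : EuclideanSpace ℝ (Fin n) → EuclideanSpace ℝ (Fin n)) : Prop :=
  LocallyIntegrable u ∧ LocallyIntegrable G ∧
    ∀ φ : EuclideanSpace ℝ (Fin n) → ℝ, IsTestFunction φ →
      ∫ x, u x • gradient φ x = - ∫ x, φ x • G x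

/-- `u ∈ D^{1,p}(ℝⁿ)`, that is `u ∈ L^{p*}` with weak gradient in `L^p`. -/
def MemD1p {n : ℕ} (p : ℝ) (u : EuclideanSpace ℝ (Fin n) → ℝ) : Prop :=
  MemLp u (ENNReal.ofReal (critExp n p)) ∧
    ∃ G : EuclideanSpace ℝ (Fin n) → EuclideanSpace ℝ (Fin n),
      HasWeakGradient u G ∧ MemLp G (ENNReal.ofReal p)

/-- For nonnegative `u ∈ D^{1,p}(ℝⁿ)` and bounded `κ`: `u` is a weak solution of
`Δ_p u + κ(x) u^{p*-1} = 0` in `ℝⁿ`, tested against `C_c^∞`.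
(The weak gradient `G` is unique up to null sets.) -/
def IsWeakSolution {n : ℕ} (p : ℝ) (κ u : EuclideanSpace ℝ (Fin n) → ℝ) : Prop :=
  ∃ G : EuclideanSpace ℝ (Fin n) → EuclideanSpace ℝ (Fin n),
    HasWeakGradient u G ∧
      ∀ φ : EuclideanSpace ℝ (Fin n) → ℝ, IsTestFunction φ →
        ∫ x, ‖G x‖ ^ (p - 2) * inner ℝ (G x) (gradient φ x)
          = ∫ x, κ x * u x ^ (critExp n p - 1) * φ x

end CritPLaplace

namespace CritPLaplace

open Filter Topology Metric
open scoped ENNReal NNReal Convolution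

variable {n : ℕ} {p : ℝ}

/-! Write a = (n-p)/(p-1) and q = p*. Since κ and u are nonnegative, u is a weak supersolution of
the p-Laplace equation. The bound combines three facts, each with constants depending only on n, p,
C₀ and K.

Mass. Testing the equation with u gives ∫|∇u|^p = ∫κu^q ≤ K∫u^q. The Sobolev inequality then gives N
≤ (A N)^(q/p) for N = ∫u^q. As q/p > 1 and N > 0, N is bounded below (`le_of_le_mul_rpow`). The
assumed decay makes the tail of this integral uniformly small, so a fixed ball carries at least half
of the lower bound.

Interior positivity. Let v = 1 + log((C+1)/(u+δ)). Testing with powers of v times (u+δ)^(1-p) bounds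
∇v in L^p locally, uniformly in δ (`energy_estimate`). A two-point Poincaré inequality, weighted by
u(y)^q, turns the mass bound into an L^p bound for v (`exists_integral_logTrans_le`). Moser
iteration turns that into an L^∞ bound (`moser_step`, `exists_logTrans_le`). A bound on v from above
is a bound on u from below (`exists_interior_lower_bound`). No Harnack inequality or John–Nirenberg
lemma is needed.

Exterior comparison. A multiple of |x|^(-a) is p-harmonic away from the origin and lies below u on
the ball. Monotonicity of |ξ|^(p-2)ξ keeps it below u outside (`BoundedWeak.exterior_lower_bound`).

All test functions are pairs (w, W) in the closure of (φ, ∇φ), φ ∈ C_c^∞, in L^q × L^p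
(`SobolevPair`). The Sobolev inequality and the weak equation pass to this closure, and
`BoundedWeak.sobolevPair_comp` with `SobolevPair.of_cutoff` shows that the nonlinear test functions
belong to it. -/

abbrev Sp (n : ℕ) := EuclideanSpace ℝ (Fin n)

/-! ### Translations and mollification in L^q -/

theorem tendsto_eLpNorm_translate_sub {F : Type*} [NormedAddCommGroup F] {q : ℝ≥0∞}
    (hq : 1 ≤ q) (hq' : q ≠ ∞) {g : Sp n → F} (hg : MemLp g q) :
    Tendsto (fun y => eLpNorm (fun x => g (x - y) - g x) q) (𝓝 0) (𝓝 0) := by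
  have : Fact (1 ≤ q) := ⟨hq⟩
  have : Fact (q ≠ ∞) := ⟨hq'⟩
  have hc : Continuous (fun y : Sp n => DomAddAct.mk (-y) +ᵥ hg.toLp g) := by
    refine Continuous.vadd (f := fun y : Sp n => DomAddAct.mk (-y)) ?_ continuous_const
    exact DomAddAct.continuous_mk.comp continuous_neg
  have h0 := (hc.edist (continuous_const (y := hg.toLp g))).tendsto 0
  have e0 : edist (DomAddAct.mk (-(0 : Sp n)) +ᵥ hg.toLp g) (hg.toLp g) = 0 := by
    rw [neg_zero]
    have : DomAddAct.mk (0 : Sp n) +ᵥ hg.toLp g = hg.toLp g := by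
      exact zero_vadd _ _
    rw [this, edist_self]
  rw [e0] at h0
  refine h0.congr fun y => ?_
  rw [DomAddAct.mk_vadd_toLp, Lp.edist_toLp_toLp]
  congr 1
  ext x
  simp [sub_eq_neg_add]

/-- The measure ρ dy is a probability measure, so ρ ⋆ g - g is an average of the differences g(· -
y) - g. Jensen's inequality followed by Tonelli bounds its norm by the largest norm of a difference
with y in the support of ρ. -/
theorem eLpNorm_convolution_sub_le {F : Type*} [NormedAddCommGroup F] [NormedSpace ℝ F]
    [CompleteSpace F] {q : ℝ} (hq : 1 ≤ q) {g : Sp n → F} (hg : MemLp g (ENNReal.ofReal q))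
    {ρ : Sp n → ℝ} (hρc : Continuous ρ) (hρ0 : ∀ x, 0 ≤ ρ x) (hρs : HasCompactSupport ρ)
    (hρ1 : ∫ x, ρ x = 1) {ε : ℝ≥0∞}
    (h : ∀ y, ρ y ≠ 0 → eLpNorm (fun x => g (x - y) - g x) (ENNReal.ofReal q) ≤ ε) :
    eLpNorm (fun x => (ρ ⋆[ContinuousLinearMap.lsmul ℝ ℝ] g) x - g x) (ENNReal.ofReal q) ≤ ε := by
  have hq0 : 0 < q := by linarith
  have hqE : (ENNReal.ofReal q) ≠ 0 := by simpa using hq0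
  have h1E : 1 ≤ ENNReal.ofReal q := by simpa using ENNReal.ofReal_le_ofReal hq
  have hgl : LocallyIntegrable g := hg.locallyIntegrable h1E
  have hρi : Integrable ρ := hρc.integrable_of_hasCompactSupport hρs
  set ν : Measure (Sp n) := volume.withDensity (fun x => ENNReal.ofReal (ρ x)) with hν
  have hνac : ν ≪ volume := withDensity_absolutelyContinuous _ _
  have : IsProbabilityMeasure ν := by
    constructor
    rw [hν, withDensity_apply _ MeasurableSet.univ, Measure.restrict_univ,
      ← ofReal_integral_eq_lintegral_ofReal hρi (ae_of_all _ hρ0), hρ1]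
    simp
  have hjm : AEStronglyMeasurable (fun z : Sp n × Sp n => g (z.1 - z.2) - g z.1)
      ((volume : Measure (Sp n)).prod ν) := by
    have h1 : AEStronglyMeasurable (fun z : Sp n × Sp n => g (z.1 - z.2))
      ((volume : Measure (Sp n)).prod volume) :=
      hg.1.comp_quasiMeasurePreserving (quasiMeasurePreserving_sub_of_right_invariant volume volume)
    exact (h1.sub hg.1.comp_fst).mono_ac (Measure.AbsolutelyContinuous.rfl.prod hνac)
  have key : ∀ x, (ρ ⋆[ContinuousLinearMap.lsmul ℝ ℝ] g) x - g x = ∫ y, (g (x - y) - g x) ∂ν := by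
    intro x
    have hex : Integrable (fun y => ρ y • g (x - y)) :=
      hρs.convolutionExists_left (ContinuousLinearMap.lsmul ℝ ℝ) hρc hgl x
    rw [hν, integral_withDensity_eq_integral_toReal_smul (by fun_prop) (by simp)]
    simp only [ENNReal.toReal_ofReal (hρ0 _), smul_sub]
    rw [integral_sub hex (hρi.smul_const _), integral_smul_const, hρ1, one_smul]
    rfl
  have jen : ∀ᵐ x, ‖(ρ ⋆[ContinuousLinearMap.lsmul ℝ ℝ] g) x - g x‖ₑ ^ q
      ≤ ∫⁻ y, ‖g (x - y) - g x‖ₑ ^ q ∂ν := by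
    filter_upwards [hjm.prodMk_left] with x hx
    rw [key]
    have h1 : ‖∫ y, (g (x - y) - g x) ∂ν‖ₑ ≤ eLpNorm (fun y => g (x - y) - g x) (ENNReal.ofReal q) ν := by
      refine (enorm_integral_le_lintegral_enorm _).trans ?_
      rw [← eLpNorm_one_eq_lintegral_enorm]
      exact eLpNorm_le_eLpNorm_of_exponent_le h1E hx
    refine (ENNReal.rpow_le_rpow h1 hq0.le).trans ?_
    rw [eLpNorm_eq_lintegral_rpow_enorm_toReal hqE ENNReal.ofReal_ne_top,
      ENNReal.toReal_ofReal hq0.le, ← ENNReal.rpow_mul, one_div, inv_mul_cancel₀ hq0.ne',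
      ENNReal.rpow_one]
  have conv : ∀ (f : Sp n → F), eLpNorm f (ENNReal.ofReal q) ≤ ε ↔ ∫⁻ x, ‖f x‖ₑ ^ q ≤ ε ^ q := by
    intro f
    rw [eLpNorm_eq_lintegral_rpow_enorm_toReal hqE ENNReal.ofReal_ne_top,
      ENNReal.toReal_ofReal hq0.le, one_div, ENNReal.rpow_inv_le_iff hq0]
  rw [conv]
  calc ∫⁻ x, ‖(ρ ⋆[ContinuousLinearMap.lsmul ℝ ℝ] g) x - g x‖ₑ ^ q
      ≤ ∫⁻ x, ∫⁻ y, ‖g (x - y) - g x‖ₑ ^ q ∂ν := lintegral_mono_ae jen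
    _ = ∫⁻ y, (∫⁻ x, ‖g (x - y) - g x‖ₑ ^ q) ∂ν := by
        rw [lintegral_lintegral_swap]
        exact (hjm.enorm.pow_const q)
    _ ≤ ∫⁻ y, ε ^ q ∂ν := by
        refine lintegral_mono_ae ?_
        rw [hν, ae_withDensity_iff (by fun_prop)]
        refine ae_of_all _ fun y hy => (conv _).1 (h y ?_)
        intro h0
        simp [h0] at hy
    _ = ε ^ q := by simp

theorem inner_gradient {f : Sp n → ℝ} (x v : Sp n) : inner ℝ (gradient f x) v = fderiv ℝ f x v := by
  simp [gradient]

theorem norm_gradient {f : Sp n → ℝ} (x : Sp n) : ‖gradient f x‖ = ‖fderiv ℝ f x‖ := by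
  simp [gradient]

theorem continuous_gradient {f : Sp n → ℝ} (hf : ContDiff ℝ 1 f) : Continuous (gradient f) := by
  unfold gradient
  exact (LinearIsometryEquiv.continuous _).comp (hf.continuous_fderiv one_ne_zero)

theorem hasCompactSupport_gradient {f : Sp n → ℝ} (hf : HasCompactSupport f) :
    HasCompactSupport (gradient f) :=
  (hf.fderiv ℝ).comp_left (g := (InnerProductSpace.toDual ℝ (Sp n)).symm) (map_zero _)

theorem hasGradientAt_of_contDiff {f : Sp n → ℝ} (hf : ContDiff ℝ 1 f) (x : Sp n) :
    HasFDerivAt f (fderiv ℝ f x) x :=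
  (hf.differentiable one_ne_zero x).hasFDerivAt

noncomputable def mollBump (n j : ℕ) : ContDiffBump (0 : Sp n) where
  rIn := 1 / ((j : ℝ) + 1)
  rOut := 2 / ((j : ℝ) + 1)
  rIn_pos := by positivity
  rIn_lt_rOut := by gcongr; norm_num

noncomputable def mollKernel (n j : ℕ) : Sp n → ℝ := (mollBump n j).normed volume

noncomputable def moll {F : Type*} [NormedAddCommGroup F] [NormedSpace ℝ F] (j : ℕ)
    (g : Sp n → F) : Sp n → F := mollKernel n j ⋆[ContinuousLinearMap.lsmul ℝ ℝ] g

theorem tendsto_mollBump_rOut (n : ℕ) : Tendsto (fun j => (mollBump n j).rOut) atTop (𝓝 0) := by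
  have := tendsto_one_div_add_atTop_nhds_zero_nat.const_mul (2 : ℝ)
  rw [mul_zero] at this
  exact this.congr fun j => by simp [mollBump, div_eq_mul_inv]

theorem mollKernel_contDiff (j : ℕ) {m : ℕ∞} : ContDiff ℝ m (mollKernel n j) :=
  ContDiffBump.contDiff_normed _

theorem mollKernel_hasCompactSupport (j : ℕ) : HasCompactSupport (mollKernel n j) :=
  ContDiffBump.hasCompactSupport_normed _

theorem mollKernel_nonneg (j : ℕ) (x : Sp n) : 0 ≤ mollKernel n j x :=
  ContDiffBump.nonneg_normed _ _

theorem integral_mollKernel (j : ℕ) : ∫ x, mollKernel n j x = 1 :=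
  ContDiffBump.integral_normed _

section
variable {F : Type*} [NormedAddCommGroup F] [NormedSpace ℝ F]

theorem tendsto_eLpNorm_moll_sub [CompleteSpace F] {q : ℝ} (hq : 1 ≤ q) {g : Sp n → F}
    (hg : MemLp g (ENNReal.ofReal q)) :
    Tendsto (fun j => eLpNorm (moll j g - g) (ENNReal.ofReal q)) atTop (𝓝 0) := by
  have h1E : 1 ≤ ENNReal.ofReal q := by simpa using ENNReal.ofReal_le_ofReal hq
  rw [ENNReal.tendsto_atTop_zero]
  intro ε hε
  have h1 := tendsto_eLpNorm_translate_sub h1E ENNReal.ofReal_ne_top hg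
  have h2 := (ENNReal.tendsto_nhds_zero.1 h1) ε hε
  obtain ⟨r, hr, hb⟩ := Metric.eventually_nhds_iff_ball.1 h2
  obtain ⟨N, hN⟩ := eventually_atTop.1 ((tendsto_mollBump_rOut n).eventually_lt_const hr)
  refine ⟨N, fun j hj => ?_⟩
  refine eLpNorm_convolution_sub_le hq hg (mollKernel_contDiff j (m := 0)).continuous
    (mollKernel_nonneg j) (mollKernel_hasCompactSupport j) (integral_mollKernel j) fun y hy => ?_
  apply hb
  have : y ∈ Function.support (mollKernel n j) := hy
  rw [mollKernel, ContDiffBump.support_normed_eq] at this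
  exact ball_subset_ball (hN j hj).le this

theorem ae_tendsto_moll [CompleteSpace F] {g : Sp n → F} (hg : LocallyIntegrable g) :
    ∀ᵐ x, Tendsto (fun j => moll j g x) atTop (𝓝 (g x)) := by
  refine ContDiffBump.ae_convolution_tendsto_right_of_locallyIntegrable (K := 2)
    (φ := fun j => mollBump n j) (tendsto_mollBump_rOut n) (Eventually.of_forall fun j => ?_) hg
  simp [mollBump, div_eq_mul_inv]

theorem contDiff_moll {g : Sp n → F} (hg : LocallyIntegrable g) (j : ℕ) {m : ℕ∞} :
    ContDiff ℝ m (moll j g) :=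
  (mollKernel_hasCompactSupport j).contDiff_convolution_left _ (mollKernel_contDiff j) hg

theorem hasCompactSupport_moll {g : Sp n → F} (hg : HasCompactSupport g) (j : ℕ) :
    HasCompactSupport (moll j g) :=
  (mollKernel_hasCompactSupport j).convolution _ hg

end

theorem moll_eq_integral {g : Sp n → ℝ} (j : ℕ) (x : Sp n) :
    moll j g x = ∫ y, mollKernel n j y * g (x - y) := rfl

theorem integrable_moll {g : Sp n → ℝ} (hg : LocallyIntegrable g) (j : ℕ) (x : Sp n) :
    Integrable (fun y => mollKernel n j y * g (x - y)) :=
  (mollKernel_hasCompactSupport j).convolutionExists_left (ContinuousLinearMap.lsmul ℝ ℝ)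
    (mollKernel_contDiff j (m := 0)).continuous hg x

theorem moll_nonneg {g : Sp n → ℝ} (h0 : ∀ᵐ x, 0 ≤ g x) (j : ℕ) (x : Sp n) : 0 ≤ moll j g x := by
  rw [moll_eq_integral]
  have h0' : ∀ᵐ y : Sp n, 0 ≤ g (x - y) :=
    (quasiMeasurePreserving_sub_left_of_right_invariant volume x).ae h0
  refine integral_nonneg_of_ae ?_
  filter_upwards [h0'] with y hy
  exact mul_nonneg (mollKernel_nonneg j y) hy

theorem moll_le {g : Sp n → ℝ} (hg : LocallyIntegrable g) {C : ℝ} (h1 : ∀ᵐ x, g x ≤ C)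
    (j : ℕ) (x : Sp n) : moll j g x ≤ C := by
  rw [moll_eq_integral]
  have h1' : ∀ᵐ y : Sp n, g (x - y) ≤ C :=
    (quasiMeasurePreserving_sub_left_of_right_invariant volume x).ae h1
  have hρ : Integrable (mollKernel n j) := (mollKernel_contDiff j (m := 0)).continuous.integrable_of_hasCompactSupport
      (mollKernel_hasCompactSupport j)
  calc _ ≤ ∫ y, mollKernel n j y * C := by
        refine integral_mono_ae (integrable_moll hg j x) (hρ.mul_const C) ?_
        filter_upwards [h1'] with y hy
        exact mul_le_mul_of_nonneg_left hy (mollKernel_nonneg j y)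
    _ = C := by rw [integral_mul_const, integral_mollKernel, one_mul]

/-- The derivative of the convolution falls on the kernel, and y ↦ ρ(x - y) is itself a test
function; the definition of the weak gradient moves the derivative over to w. -/
theorem gradient_moll {w : Sp n → ℝ} {W : Sp n → Sp n} (h : HasWeakGradient w W) (j : ℕ)
    (x : Sp n) : gradient (moll j w) x = moll j W x := by
  obtain ⟨hw, hW, hφ⟩ := h
  refine ext_inner_right ℝ fun v => ?_
  rw [inner_gradient]
  have hρ1 : ContDiff ℝ 1 (mollKernel n j) := mollKernel_contDiff j (m := 1)
  have hd := (mollKernel_hasCompactSupport j).hasFDerivAt_convolution_left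
    (ContinuousLinearMap.lsmul ℝ ℝ) (μ := volume) hρ1 hw x
  have hd' : fderiv ℝ (moll j w) x = _ := hd.fderiv
  rw [hd']
  set φ : Sp n → ℝ := fun y => mollKernel n j (x - y) with hφd
  have hφt : IsTestFunction φ := by
    refine ⟨(mollKernel_contDiff j).comp (contDiff_const.sub contDiff_id), ?_⟩
    exact (mollKernel_hasCompactSupport j).comp_homeomorph (Homeomorph.subLeft x)
  have hφ1 : ContDiff ℝ 1 φ := hφt.1.of_le (by exact_mod_cast le_top)
  have hg : ∀ y, gradient φ y = - gradient (mollKernel n j) (x - y) := by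
    intro y
    refine ext_inner_right ℝ fun v => ?_
    rw [inner_gradient, inner_neg_left, inner_gradient]
    have h1 : HasFDerivAt φ ((fderiv ℝ (mollKernel n j) (x - y)).comp (-ContinuousLinearMap.id ℝ (Sp n))) y := by
      refine (hasGradientAt_of_contDiff hρ1 (x - y)).comp y ?_
      simpa using (hasFDerivAt_id y).const_sub x
    rw [h1.fderiv]; simp
  have hI1 : Integrable (fun y => w y • gradient φ y) :=
    hw.integrable_smul_right_of_hasCompactSupport (continuous_gradient hφ1) (hasCompactSupport_gradient hφt.2)
  have hI2 : Integrable (fun y => φ y • W y) :=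
    hW.integrable_smul_left_of_hasCompactSupport hφ1.continuous hφt.2
  have main := congrArg (fun z => inner ℝ z v) (hφ φ hφt)
  simp only [inner_neg_left] at main
  rw [real_inner_comm, ← integral_inner hI1, real_inner_comm, ← integral_inner hI2] at main
  have hR : inner ℝ (moll j W x) v = ∫ y, inner ℝ v (φ y • W y) := by
    rw [moll, convolution_eq_swap, real_inner_comm, ← integral_inner]
    · rfl
    · exact hI2
  rw [hR, ← neg_eq_iff_eq_neg.2 main, convolution_eq_swap, ContinuousLinearMap.integral_apply]
  · rw [← integral_neg]
    congr 1
    ext y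
    rw [hg, inner_smul_right, inner_neg_right, real_inner_comm, inner_gradient]
    simp
    ring
  · have := ((mollKernel_hasCompactSupport j).fderiv ℝ).convolutionExists_left
      (ContinuousLinearMap.precompL (Sp n) (ContinuousLinearMap.lsmul ℝ ℝ : ℝ →L[ℝ] ℝ →L[ℝ] ℝ)) (hρ1.continuous_fderiv one_ne_zero) hw x
    exact (convolutionExistsAt_iff_integrable_swap).1 this

theorem hasWeakGradient_of_contDiff {φ : Sp n → ℝ} (hφ : ContDiff ℝ 1 φ) :
    HasWeakGradient φ (gradient φ) := by
  refine ⟨hφ.continuous.locallyIntegrable, (continuous_gradient hφ).locallyIntegrable, ?_⟩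
  intro ψ hψ
  have hψ1 : ContDiff ℝ 1 ψ := hψ.1.of_le (by exact_mod_cast le_top)
  have cψ := continuous_gradient hψ1
  have cφ := continuous_gradient hφ
  have sψ := hasCompactSupport_gradient hψ.2
  refine ext_inner_right ℝ fun v => ?_
  have hI1 : Integrable (fun y => φ y • gradient ψ y) :=
    (hφ.continuous.smul cψ).integrable_of_hasCompactSupport sψ.smul_left
  have hI2 : Integrable (fun y => ψ y • gradient φ y) :=
    (hψ1.continuous.smul cφ).integrable_of_hasCompactSupport hψ.2.smul_right
  rw [inner_neg_left, real_inner_comm, ← integral_inner hI1, real_inner_comm, ← integral_inner hI2]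
  simp only [real_inner_comm _ v, real_inner_smul_left, inner_gradient]
  have cf := (hφ.continuous_fderiv one_ne_zero).clm_apply (continuous_const (y := v))
  have cg := (hψ1.continuous_fderiv one_ne_zero).clm_apply (continuous_const (y := v))
  have sg : HasCompactSupport (fun x => fderiv ℝ ψ x v) := hψ.2.fderiv_apply ℝ v
  rw [integral_mul_fderiv_eq_neg_fderiv_mul_of_integrable]
  · congr 2; ext x; ring
  · exact (cf.mul hψ1.continuous).integrable_of_hasCompactSupport hψ.2.mul_left
  · exact (hφ.continuous.mul cg).integrable_of_hasCompactSupport sg.mul_left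
  · exact (hφ.continuous.mul hψ1.continuous).integrable_of_hasCompactSupport hψ.2.mul_left
  · exact fun x _ => hφ.differentiable one_ne_zero x
  · exact fun x _ => hψ1.differentiable one_ne_zero x

/-! ### The Sobolev closure of test functions -/

theorem critExp_pos_facts (hp1 : 1 < p) (hpn : p < (n : ℝ)) :
    p < critExp n p ∧ (critExp n p)⁻¹ = p⁻¹ - (n : ℝ)⁻¹ := by
  have hn : 0 < (n : ℝ) := by linarith
  have h1 : 0 < (n : ℝ) - p := by linarith
  constructor
  · rw [critExp, lt_div_iff₀ h1]; nlinarith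
  · rw [critExp]; field_simp

theorem one_lt_critExp (hp1 : 1 < p) (hpn : p < (n : ℝ)) : 1 < critExp n p :=
  hp1.trans (critExp_pos_facts hp1 hpn).1

theorem one_le_ofReal_of_one_lt {q : ℝ} (hq : 1 < q) : 1 ≤ ENNReal.ofReal q := by
  simpa using ENNReal.ofReal_le_ofReal hq.le

/-- The pair `(w, W)` lies in the closure of the pairs `(φ, ∇φ)`, `φ ∈ C_c^∞`, with respect to the
`L^{p*} × L^p` norm. -/
def SobolevPair (p : ℝ) (w : Sp n → ℝ) (W : Sp n → Sp n) : Prop :=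
  MemLp w (ENNReal.ofReal (critExp n p)) ∧ MemLp W (ENNReal.ofReal p) ∧
    ∀ ε : ℝ≥0∞, 0 < ε → ∃ φ : Sp n → ℝ, IsTestFunction φ ∧
      eLpNorm (φ - w) (ENNReal.ofReal (critExp n p)) ≤ ε ∧
      eLpNorm (gradient φ - W) (ENNReal.ofReal p) ≤ ε

theorem IsTestFunction.contDiff_one {φ : Sp n → ℝ} (h : IsTestFunction φ) : ContDiff ℝ 1 φ :=
  h.1.of_le (by exact_mod_cast le_top)

theorem memLp_of_contDiff {φ : Sp n → ℝ} (h1 : ContDiff ℝ 1 φ) (h2 : HasCompactSupport φ)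
    (q : ℝ≥0∞) : MemLp φ q :=
  h1.continuous.memLp_of_hasCompactSupport h2

theorem memLp_gradient_of_contDiff {φ : Sp n → ℝ} (h1 : ContDiff ℝ 1 φ)
    (h2 : HasCompactSupport φ) (q : ℝ≥0∞) : MemLp (gradient φ) q :=
  (continuous_gradient h1).memLp_of_hasCompactSupport (hasCompactSupport_gradient h2)

/-- Mollification preserves compact support and commutes with the gradient, so it supplies the
approximating test functions in both norms at once. -/
theorem sobolevPair_of_contDiff (hp1 : 1 < p) (hpn : p < (n : ℝ)) {φ : Sp n → ℝ}
    (h1 : ContDiff ℝ 1 φ) (h2 : HasCompactSupport φ) : SobolevPair p φ (gradient φ) := by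
  have hm := memLp_of_contDiff h1 h2
  have hg := memLp_gradient_of_contDiff h1 h2
  refine ⟨hm _, hg _, fun ε hε => ?_⟩
  have t1 := tendsto_eLpNorm_moll_sub (one_lt_critExp hp1 hpn).le (hm _)
  have t2 := tendsto_eLpNorm_moll_sub hp1.le (hg _)
  have e1 := ENNReal.tendsto_nhds_zero.1 t1 ε hε
  have e2 := ENNReal.tendsto_nhds_zero.1 t2 ε hε
  obtain ⟨j, hj1, hj2⟩ := (e1.and e2).exists
  refine ⟨moll j φ, ⟨contDiff_moll h1.continuous.locallyIntegrable j, hasCompactSupport_moll h2 j⟩,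
    hj1, ?_⟩
  have : gradient (moll j φ) = moll j (gradient φ) := by
    ext1 x
    exact gradient_moll (hasWeakGradient_of_contDiff h1) j x
  rw [this]
  exact hj2

theorem SobolevPair.of_limit (hp1 : 1 < p) (hpn : p < (n : ℝ)) {w : Sp n → ℝ} {W : Sp n → Sp n}
    (hw : MemLp w (ENNReal.ofReal (critExp n p))) (hW : MemLp W (ENNReal.ofReal p))
    {w' : ℕ → Sp n → ℝ} {W' : ℕ → Sp n → Sp n} (h : ∀ j, SobolevPair p (w' j) (W' j))
    (h1 : Tendsto (fun j => eLpNorm (w' j - w) (ENNReal.ofReal (critExp n p))) atTop (𝓝 0))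
    (h2 : Tendsto (fun j => eLpNorm (W' j - W) (ENNReal.ofReal p)) atTop (𝓝 0)) :
    SobolevPair p w W := by
  refine ⟨hw, hW, fun ε hε => ?_⟩
  have hε2 : 0 < ε / 2 := ENNReal.half_pos hε.ne'
  obtain ⟨j, hj1, hj2⟩ := ((ENNReal.tendsto_nhds_zero.1 h1 _ hε2).and
    (ENNReal.tendsto_nhds_zero.1 h2 _ hε2)).exists
  obtain ⟨φ, hφ, hφ1, hφ2⟩ := (h j).2.2 _ hε2
  have hm := memLp_of_contDiff hφ.contDiff_one hφ.2 (ENNReal.ofReal (critExp n p))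
  have hg := memLp_gradient_of_contDiff hφ.contDiff_one hφ.2 (ENNReal.ofReal p)
  refine ⟨φ, hφ, ?_, ?_⟩
  · rw [show φ - w = (φ - w' j) + (w' j - w) by ring, ← ENNReal.add_halves ε]
    exact (eLpNorm_add_le (hm.sub (h j).1).1 ((h j).1.sub hw).1
      (one_le_ofReal_of_one_lt (one_lt_critExp hp1 hpn))).trans (add_le_add hφ1 hj1)
  · rw [show gradient φ - W = (gradient φ - W' j) + (W' j - W) by abel, ← ENNReal.add_halves ε]
    exact (eLpNorm_add_le (hg.sub (h j).2.1).1 ((h j).2.1.sub hW).1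
      (one_le_ofReal_of_one_lt hp1)).trans (add_le_add hφ2 hj2)

theorem SobolevPair.exists_seq {w : Sp n → ℝ} {W : Sp n → Sp n} (h : SobolevPair p w W) :
    ∃ φ : ℕ → Sp n → ℝ, (∀ j, IsTestFunction (φ j)) ∧
      Tendsto (fun j => eLpNorm (φ j - w) (ENNReal.ofReal (critExp n p))) atTop (𝓝 0) ∧
      Tendsto (fun j => eLpNorm (gradient (φ j) - W) (ENNReal.ofReal p)) atTop (𝓝 0) := by
  have hpos : ∀ j : ℕ, (0 : ℝ≥0∞) < ((j : ℝ≥0∞))⁻¹ := fun j =>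
    ENNReal.inv_pos.2 (ENNReal.natCast_ne_top j)
  choose φ hφ h1 h2 using fun j : ℕ => h.2.2 _ (hpos j)
  exact ⟨φ, hφ, tendsto_of_tendsto_of_tendsto_of_le_of_le tendsto_const_nhds
    ENNReal.tendsto_inv_nat_nhds_zero (fun _ => zero_le) h1,
    tendsto_of_tendsto_of_tendsto_of_le_of_le tendsto_const_nhds
    ENNReal.tendsto_inv_nat_nhds_zero (fun _ => zero_le) h2⟩

/-- The constant in the Sobolev inequality. -/
noncomputable def sobolevConst (n : ℕ) (p : ℝ) : ℝ≥0 :=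
  SNormLESNormFDerivOfEqConst ℝ (volume : Measure (Sp n)) p

/-- The Gagliardo–Nirenberg–Sobolev inequality for C¹ functions of compact support passes to the
closure, both sides being continuous there. -/
theorem SobolevPair.eLpNorm_le (hp1 : 1 < p) (hpn : p < (n : ℝ)) {w : Sp n → ℝ} {W : Sp n → Sp n}
    (h : SobolevPair p w W) :
    eLpNorm w (ENNReal.ofReal (critExp n p)) ≤ sobolevConst n p * eLpNorm W (ENNReal.ofReal p) := by
  obtain ⟨φ, hφ, h1, h2⟩ := h.exists_seq
  have hle : ∀ j, eLpNorm w (ENNReal.ofReal (critExp n p)) ≤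
      eLpNorm (φ j - w) (ENNReal.ofReal (critExp n p)) + sobolevConst n p *
        (eLpNorm W (ENNReal.ofReal p) + eLpNorm (gradient (φ j) - W) (ENNReal.ofReal p)) := by
    intro j
    have c1 := (hφ j).contDiff_one
    have hm := memLp_of_contDiff c1 (hφ j).2 (ENNReal.ofReal (critExp n p))
    have hg := memLp_gradient_of_contDiff c1 (hφ j).2 (ENNReal.ofReal p)
    have a1 : eLpNorm w (ENNReal.ofReal (critExp n p)) ≤
      eLpNorm (φ j - w) (ENNReal.ofReal (critExp n p)) + eLpNorm (φ j) (ENNReal.ofReal (critExp n p)) := by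
      rw [← eLpNorm_sub_comm]
      conv_lhs => rw [show w = (w - φ j) + φ j by ring]
      exact eLpNorm_add_le (h.1.sub hm).1 hm.1 (one_le_ofReal_of_one_lt (one_lt_critExp hp1 hpn))
    have a2 : eLpNorm (gradient (φ j)) (ENNReal.ofReal p) ≤
        eLpNorm W (ENNReal.ofReal p) + eLpNorm (gradient (φ j) - W) (ENNReal.ofReal p) := by
      conv_lhs => rw [show gradient (φ j) = W + (gradient (φ j) - W) by abel]
      exact eLpNorm_add_le h.2.1.1 (hg.sub h.2.1).1 (one_le_ofReal_of_one_lt hp1)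
    have a3 : eLpNorm (φ j) (ENNReal.ofReal (critExp n p)) ≤
        sobolevConst n p * eLpNorm (gradient (φ j)) (ENNReal.ofReal p) := by
      have hf := (critExp_pos_facts hp1 hpn)
      have hn : 0 < Module.finrank ℝ (Sp n) := by
        rw [finrank_euclideanSpace_fin]
        exact_mod_cast (by linarith : (0 : ℝ) < n)
      have := eLpNorm_le_eLpNorm_fderiv_of_eq (μ := (volume : Measure (Sp n))) (F := ℝ) c1 (hφ j).2
        (p := p.toNNReal) (p' := (critExp n p).toNNReal) (Real.one_le_toNNReal.2 hp1.le) hn (by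
          rw [NNReal.coe_inv, Real.coe_toNNReal p (by linarith),
            Real.coe_toNNReal (critExp n p) (by linarith), hf.2,
            finrank_euclideanSpace_fin])
      rw [Real.coe_toNNReal _ (by linarith : 0 ≤ p)] at this
      refine this.trans_eq ?_
      rw [sobolevConst]
      congr 1
      exact eLpNorm_congr_norm_ae (ae_of_all _ fun x => (norm_gradient x).symm)
    exact a1.trans (add_le_add le_rfl (a3.trans (by gcongr)))
  have hlim : Tendsto (fun j => eLpNorm (φ j - w) (ENNReal.ofReal (critExp n p)) + sobolevConst n p *
        (eLpNorm W (ENNReal.ofReal p) + eLpNorm (gradient (φ j) - W) (ENNReal.ofReal p))) atTop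
      (𝓝 (0 + sobolevConst n p * (eLpNorm W (ENNReal.ofReal p) + 0))) :=
    h1.add (ENNReal.Tendsto.const_mul (tendsto_const_nhds.add h2) (Or.inr ENNReal.coe_ne_top))
  simpa using ge_of_tendsto' hlim hle

section
variable {F : Type*} [NormedAddCommGroup F] [InnerProductSpace ℝ F]

theorem integrable_inner_of_memLp {q q' : ℝ} (hq : q.HolderConjugate q') {Y Z : Sp n → F}
    (hY : MemLp Y (ENNReal.ofReal q')) (hZ : MemLp Z (ENNReal.ofReal q)) :
    Integrable (fun x => (inner ℝ (Y x) (Z x) : ℝ)) := by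
  have := hq.symm.ennrealOfReal
  rw [← memLp_one_iff_integrable]
  exact MemLp.of_bilin (inner ℝ) 1 hY hZ (hY.1.inner hZ.1)
    (ae_of_all _ fun x => by simpa using! nnnorm_inner_le_nnnorm (𝕜 := ℝ) (Y x) (Z x))

theorem tendsto_integral_inner {q q' : ℝ} (hq : q.HolderConjugate q') {Y Z : Sp n → F}
    (hY : MemLp Y (ENNReal.ofReal q')) (hZ : MemLp Z (ENNReal.ofReal q)) {Z' : ℕ → Sp n → F}
    (hZ' : ∀ j, MemLp (Z' j) (ENNReal.ofReal q))
    (h : Tendsto (fun j => eLpNorm (Z' j - Z) (ENNReal.ofReal q)) atTop (𝓝 0)) :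
    Tendsto (fun j => ∫ x, (inner ℝ (Y x) (Z' j x) : ℝ)) atTop
      (𝓝 (∫ x, (inner ℝ (Y x) (Z x) : ℝ))) := by
  have := hq.symm.ennrealOfReal
  refine tendsto_integral_of_L1' _ (integrable_inner_of_memLp hq hY hZ).1
    (Eventually.of_forall fun j => integrable_inner_of_memLp hq hY (hZ' j)) ?_
  have hle : ∀ j, eLpNorm ((fun x => (inner ℝ (Y x) (Z' j x) : ℝ)) - fun x => (inner ℝ (Y x) (Z x) : ℝ)) 1
      volume ≤ eLpNorm Y (ENNReal.ofReal q') * eLpNorm (Z' j - Z) (ENNReal.ofReal q) := by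
    intro j
    have e : ((fun x => (inner ℝ (Y x) (Z' j x) : ℝ)) - fun x => (inner ℝ (Y x) (Z x) : ℝ))
        = fun x => (inner ℝ (Y x) ((Z' j - Z) x) : ℝ) := by
      ext x; simp [inner_sub_right]
    rw [e]
    have := eLpNorm_le_eLpNorm_mul_eLpNorm'_of_norm (p := ENNReal.ofReal q')
      (q := ENNReal.ofReal q) (r := 1) hY.1 ((hZ' j).sub hZ).1 (inner ℝ) 1
      (ae_of_all _ fun x => by simpa using! norm_inner_le_norm (𝕜 := ℝ) (Y x) ((Z' j - Z) x))
    simpa using this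
  refine tendsto_of_tendsto_of_tendsto_of_le_of_le tendsto_const_nhds ?_ (fun _ => zero_le) hle
  have := ENNReal.Tendsto.const_mul h (Or.inr hY.2.ne)
  simpa using this

end

/-- By Hölder both sides are continuous in the L^{p*} × L^p norm, so a divergence identity tested on
C_c^∞ extends to the closure. It serves twice: for the equation of u and for the divergence of the
field |x|^(-n) x. -/
theorem SobolevPair.integral_eq {p' q' : ℝ} (hp : p.HolderConjugate p')
    (hq : (critExp n p).HolderConjugate q') {Y : Sp n → Sp n} {b : Sp n → ℝ}
    (hY : MemLp Y (ENNReal.ofReal p')) (hb : MemLp b (ENNReal.ofReal q'))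
    (heq : ∀ φ : Sp n → ℝ, IsTestFunction φ →
      ∫ x, inner ℝ (Y x) (gradient φ x) = ∫ x, b x * φ x)
    {w : Sp n → ℝ} {W : Sp n → Sp n} (h : SobolevPair p w W) :
    ∫ x, inner ℝ (Y x) (W x) = ∫ x, b x * w x := by
  obtain ⟨φ, hφ, h1, h2⟩ := h.exists_seq
  have t1 := tendsto_integral_inner hp hY h.2.1
    (fun j => memLp_gradient_of_contDiff (hφ j).contDiff_one (hφ j).2 _) h2
  have t2 := tendsto_integral_inner hq hb h.1
    (fun j => memLp_of_contDiff (hφ j).contDiff_one (hφ j).2 _) h1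
  have e : ∀ f : Sp n → ℝ, ∫ x, (inner ℝ (b x) (f x) : ℝ) = ∫ x, b x * f x := by
    intro f; congr 1; ext x; simp [mul_comm]
  simp only [e] at t2
  simp only [fun j => heq (φ j) (hφ j)] at t1
  exact tendsto_nhds_unique t1 t2

/-! ### The chain rule for bounded functions with weak gradient in L^p -/

theorem tendsto_eLpNorm_zero_of_dominated {α F : Type*} [MeasurableSpace α] {μ : Measure α}
    [NormedAddCommGroup F] {q : ℝ} (hq : 0 < q) {f : ℕ → α → F}
    (hm : ∀ j, AEStronglyMeasurable (f j) μ) {g : α → ℝ} (hg : MemLp g (ENNReal.ofReal q) μ)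
    (hb : ∀ j, ∀ᵐ x ∂μ, ‖f j x‖ ≤ g x) (hl : ∀ᵐ x ∂μ, Tendsto (fun j => f j x) atTop (𝓝 0)) :
    Tendsto (fun j => eLpNorm (f j) (ENNReal.ofReal q) μ) atTop (𝓝 0) := by
  have hqE : (ENNReal.ofReal q) ≠ 0 := by simpa using hq
  have e : ∀ j, eLpNorm (f j) (ENNReal.ofReal q) μ = (∫⁻ x, ‖f j x‖ₑ ^ q ∂μ) ^ q⁻¹ := by
    intro j
    rw [eLpNorm_eq_lintegral_rpow_enorm_toReal hqE ENNReal.ofReal_ne_top,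
      ENNReal.toReal_ofReal hq.le, one_div]
  have hfin : ∫⁻ x, ‖g x‖ₑ ^ q ∂μ ≠ ∞ := by
    have := lintegral_rpow_enorm_lt_top_of_eLpNorm_lt_top hqE ENNReal.ofReal_ne_top hg.2
    rw [ENNReal.toReal_ofReal hq.le] at this
    exact this.ne
  have h1 : Tendsto (fun j => ∫⁻ x, ‖f j x‖ₑ ^ q ∂μ) atTop (𝓝 (∫⁻ _, 0 ∂μ)) := by
    refine tendsto_lintegral_of_dominated_convergence' (fun x => ‖g x‖ₑ ^ q)
      (fun j => (hm j).enorm.pow_const q) (fun j => ?_) hfin ?_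
    · filter_upwards [hb j] with x hx
      refine ENNReal.rpow_le_rpow ?_ hq.le
      rw [enorm_le_iff_norm_le]
      exact hx.trans (le_abs_self _)
    · filter_upwards [hl] with x hx
      have := (ENNReal.continuous_rpow_const (y := q)).tendsto _ |>.comp hx.enorm
      simpa [Function.comp_def, hq] using this
  simp only [e]
  have := (ENNReal.continuous_rpow_const (y := q⁻¹)).tendsto _ |>.comp h1
  simpa [Function.comp_def, hq] using this

/-- `u` is a bounded nonnegative function with weak gradient `G ∈ L^p`. -/
structure BoundedWeak (p C : ℝ) (u : Sp n → ℝ) (G : Sp n → Sp n) : Prop where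
  weak : HasWeakGradient u G
  memLp : MemLp G (ENNReal.ofReal p)
  nonneg : ∀ᵐ x, 0 ≤ u x
  le : ∀ᵐ x, u x ≤ C

theorem memLp_of_norm_le_of_compact {F : Type*} [NormedAddCommGroup F] {q : ℝ≥0∞} {k : Set (Sp n)}
    (hk : IsCompact k) {B : ℝ} {f : Sp n → F} (hf : AEStronglyMeasurable f)
    (hb : ∀ᵐ x, ‖f x‖ ≤ k.indicator (fun _ => B) x) : MemLp f q := by
  have : MemLp (k.indicator (fun _ => B)) q (volume : Measure (Sp n)) :=
    memLp_indicator_const _ hk.measurableSet _ (Or.inr hk.measure_lt_top.ne)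
  exact this.mono hf (hb.mono fun x hx => hx.trans (le_abs_self _))

/-- Replace u by its mollifications φ_j. They take values in [0, C], so only the behaviour of H over
that interval matters, and H(x, φ_j(x)) is C¹ with compact support. The error in the gradient splits
into the increment of Hx, the increment of Hs times G, and Hs times the mollification error of G.
The first two vanish by dominated convergence, the third because Hs is bounded and mollification
converges in L^p. -/
theorem BoundedWeak.sobolevPair_comp (hp1 : 1 < p) (hpn : p < (n : ℝ)) {C : ℝ} {u : Sp n → ℝ}
    {G : Sp n → Sp n} (hu : BoundedWeak p C u G)
    {H : Sp n × ℝ → ℝ} {Hx : Sp n × ℝ → Sp n} {Hs : Sp n × ℝ → ℝ}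
    (hd : ∀ z ∈ Set.univ ×ˢ Set.Icc 0 C, HasFDerivAt H
      ((innerSL ℝ (Hx z)).comp (ContinuousLinearMap.fst ℝ (Sp n) ℝ)
        + Hs z • ContinuousLinearMap.snd ℝ (Sp n) ℝ) z)
    (hHx : ContinuousOn Hx (Set.univ ×ˢ Set.Icc 0 C))
    (hHs : ContinuousOn Hs (Set.univ ×ˢ Set.Icc 0 C))
    {k : Set (Sp n)} (hk : IsCompact k)
    (h0 : ∀ x ∉ k, ∀ s, H (x, s) = 0 ∧ Hx (x, s) = 0 ∧ Hs (x, s) = 0) :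
    SobolevPair p (fun x => H (x, u x)) (fun x => Hx (x, u x) + Hs (x, u x) • G x) := by
  set S : Set (Sp n × ℝ) := Set.univ ×ˢ Set.Icc 0 C with hS
  have hH : ContinuousOn H S := fun z hz => (hd z hz).continuousAt.continuousWithinAt
  have hul : LocallyIntegrable u := hu.weak.1
  set φ : ℕ → Sp n → ℝ := fun j => moll j u with hφ
  have hφ1 : ∀ j, ContDiff ℝ 1 (φ j) := fun j => contDiff_moll (m := 1) hul j
  have hφS : ∀ j x, (x, φ j x) ∈ S := fun j x =>
    ⟨Set.mem_univ _, moll_nonneg hu.nonneg j x, moll_le hul hu.le j x⟩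
  have huS : ∀ᵐ x, (x, u x) ∈ S := by
    filter_upwards [hu.nonneg, hu.le] with x h1 h2 using ⟨Set.mem_univ _, h1, h2⟩
  have hφa : ∀ᵐ x, Tendsto (fun j => φ j x) atTop (𝓝 (u x)) := ae_tendsto_moll hul
  have hlim : ∀ {F : Type} [NormedAddCommGroup F] {T : Sp n × ℝ → F}, ContinuousOn T S →
      ∀ᵐ x, Tendsto (fun j => T (x, φ j x)) atTop (𝓝 (T (x, u x))) := by
    intro F _ T hT
    filter_upwards [huS, hφa] with x hx1 hx2
    refine (hT _ hx1).tendsto.comp (tendsto_nhdsWithin_iff.2 ⟨?_, Eventually.of_forall fun j => hφS j x⟩)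
    exact tendsto_const_nhds.prodMk_nhds hx2
  have hcont : ∀ {F : Type} [NormedAddCommGroup F] {T : Sp n × ℝ → F}, ContinuousOn T S →
      ∀ j, Continuous (fun x => T (x, φ j x)) := fun hT j =>
    hT.comp_continuous (continuous_id.prodMk (hφ1 j).continuous) (hφS j)
  have hmeas : ∀ {F : Type} [NormedAddCommGroup F] {T : Sp n × ℝ → F}, ContinuousOn T S →
      AEStronglyMeasurable (fun x => T (x, u x)) := fun hT =>
    aestronglyMeasurable_of_tendsto_ae atTop (fun j => (hcont hT j).aestronglyMeasurable) (hlim hT)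
  have hbdd : ∀ {F : Type} [NormedAddCommGroup F] {T : Sp n × ℝ → F}, ContinuousOn T S →
      (∀ x ∉ k, ∀ s, T (x, s) = 0) →
      ∃ B : ℝ, 0 ≤ B ∧ ∀ z ∈ S, ‖T z‖ ≤ k.indicator (fun _ => B) z.1 := by
    intro F _ T hT hT0
    obtain ⟨B, hB⟩ := (hk.prod (isCompact_Icc (a := (0 : ℝ)) (b := C))).exists_bound_of_continuousOn
      (hT.mono (Set.prod_mono (Set.subset_univ _) subset_rfl))
    refine ⟨max B 0, le_max_right _ _, fun z hz => ?_⟩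
    by_cases hzk : z.1 ∈ k
    · rw [Set.indicator_of_mem hzk]
      exact (hB z ⟨hzk, hz.2⟩).trans (le_max_left _ _)
    · rw [Set.indicator_of_notMem hzk, hT0 z.1 hzk z.2, norm_zero]
  obtain ⟨B0, hB0, hb0⟩ := hbdd hH (fun x hx s => (h0 x hx s).1)
  obtain ⟨B1, hB1, hb1⟩ := hbdd hHx (fun x hx s => (h0 x hx s).2.1)
  obtain ⟨B2, hB2, hb2⟩ := hbdd hHs (fun x hx s => (h0 x hx s).2.2)
  have hb2' : ∀ z ∈ S, ‖Hs z‖ ≤ B2 := fun z hz =>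
    (hb2 z hz).trans (Set.indicator_le_self' (fun _ _ => hB2) z.1)
  have hder : ∀ j x, HasFDerivAt (fun x => H (x, φ j x))
      (innerSL ℝ (Hx (x, φ j x)) + Hs (x, φ j x) • fderiv ℝ (φ j) x) x := by
    intro j x
    have h1 := (hd _ (hφS j x)).comp x
      ((hasFDerivAt_id x).prodMk (hasGradientAt_of_contDiff (hφ1 j) x))
    refine h1.congr_fderiv ?_
    ext v
    simp
  have hc1 : ∀ j, ContDiff ℝ 1 (fun x => H (x, φ j x)) := by
    intro j
    rw [contDiff_one_iff_hasFDerivAt]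
    refine ⟨_, ?_, hder j⟩
    exact ((innerSL ℝ).continuous.comp (hcont hHx j)).add
      ((hcont hHs j).smul ((hφ1 j).continuous_fderiv one_ne_zero))
  have hsupp : ∀ j, HasCompactSupport (fun x => H (x, φ j x)) := fun j =>
    HasCompactSupport.intro hk fun x hx => (h0 x hx _).1
  have hgrad : ∀ j, gradient (fun x => H (x, φ j x)) =
      fun x => Hx (x, φ j x) + Hs (x, φ j x) • moll j G x := by
    intro j
    ext1 x
    refine ext_inner_right ℝ fun v => ?_
    rw [inner_gradient, (hder j x).fderiv, ← gradient_moll hu.weak, inner_add_left,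
      real_inner_smul_left, inner_gradient]
    simp [hφ]
  have hqpos : 0 < critExp n p := by linarith [one_lt_critExp hp1 hpn]
  have hp0 : 0 < p := by linarith
  have ind : ∀ (B : ℝ) (q : ℝ≥0∞), MemLp (k.indicator (fun _ => B)) q (volume : Measure (Sp n)) :=
    fun B q => memLp_indicator_const _ hk.measurableSet _ (Or.inr hk.measure_lt_top.ne)
  have hGsm : MemLp (fun x => Hs (x, u x) • G x) (ENNReal.ofReal p) := by
    refine (hu.memLp.norm.const_mul B2).mono ((hmeas hHs).smul hu.memLp.1) ?_
    filter_upwards [huS] with x hx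
    rw [norm_smul]
    exact (mul_le_mul_of_nonneg_right (hb2' _ hx) (norm_nonneg _)).trans (le_abs_self _)
  have hHxu : MemLp (fun x => Hx (x, u x)) (ENNReal.ofReal p) :=
    memLp_of_norm_le_of_compact hk (hmeas hHx) (huS.mono fun x hx => hb1 _ hx)
  refine SobolevPair.of_limit hp1 hpn
    (memLp_of_norm_le_of_compact hk (hmeas hH) (huS.mono fun x hx => hb0 _ hx))
    (hHxu.add hGsm)
    (fun j => sobolevPair_of_contDiff hp1 hpn (hc1 j) (hsupp j)) ?_ ?_
  · refine tendsto_eLpNorm_zero_of_dominated hqpos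
      (fun j => ((hc1 j).continuous.aestronglyMeasurable.sub (hmeas hH))) ((ind B0 _).add (ind B0 _)) ?_ ?_
    · intro j
      filter_upwards [huS] with x hx
      exact (norm_sub_le _ _).trans (add_le_add (hb0 _ (hφS j x)) (hb0 _ hx))
    · filter_upwards [hlim hH] with x hx
      exact tendsto_sub_nhds_zero_iff.2 hx
  · have t1 : Tendsto (fun j => eLpNorm (fun x => Hx (x, φ j x) - Hx (x, u x)) (ENNReal.ofReal p))
        atTop (𝓝 0) := by
      refine tendsto_eLpNorm_zero_of_dominated hp0
        (fun j => ((hcont hHx j).aestronglyMeasurable.sub (hmeas hHx))) ((ind B1 _).add (ind B1 _)) ?_ ?_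
      · intro j
        filter_upwards [huS] with x hx
        exact (norm_sub_le _ _).trans (add_le_add (hb1 _ (hφS j x)) (hb1 _ hx))
      · filter_upwards [hlim hHx] with x hx
        exact tendsto_sub_nhds_zero_iff.2 hx
    have t2 : Tendsto (fun j => eLpNorm (fun x => (Hs (x, φ j x) - Hs (x, u x)) • G x)
        (ENNReal.ofReal p)) atTop (𝓝 0) := by
      refine tendsto_eLpNorm_zero_of_dominated hp0
        (fun j => ((hcont hHs j).aestronglyMeasurable.sub (hmeas hHs)).smul hu.memLp.1)
        (hu.memLp.norm.const_mul (B2 + B2)) ?_ ?_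
      · intro j
        filter_upwards [huS] with x hx
        rw [norm_smul]
        exact mul_le_mul_of_nonneg_right
          ((norm_sub_le _ _).trans (add_le_add (hb2' _ (hφS j x)) (hb2' _ hx))) (norm_nonneg _)
      · filter_upwards [hlim hHs] with x hx
        have := (tendsto_sub_nhds_zero_iff.2 hx).smul_const (G x)
        simpa using this
    have mG : ∀ j, AEStronglyMeasurable (moll j G) := fun j =>
      (contDiff_moll (m := 0) hu.weak.2.1 j).continuous.aestronglyMeasurable
    have t3 : Tendsto (fun j => eLpNorm (fun x => Hs (x, φ j x) • (moll j G - G) x)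
        (ENNReal.ofReal p)) atTop (𝓝 0) := by
      have h1 := tendsto_eLpNorm_moll_sub hp1.le hu.memLp
      have h2 := ENNReal.Tendsto.const_mul (a := ENNReal.ofReal B2) h1 (Or.inr ENNReal.ofReal_ne_top)
      rw [mul_zero] at h2
      refine tendsto_of_tendsto_of_tendsto_of_le_of_le tendsto_const_nhds h2 (fun _ => zero_le) ?_
      intro j
      refine eLpNorm_le_mul_eLpNorm_of_ae_le_mul (ae_of_all _ fun x => ?_) _
      rw [norm_smul]
      exact mul_le_mul_of_nonneg_right (hb2' _ (hφS j x)) (norm_nonneg _)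
    have t := (t1.add t2).add t3
    simp only [add_zero] at t
    refine tendsto_of_tendsto_of_tendsto_of_le_of_le tendsto_const_nhds t (fun _ => zero_le) ?_
    intro j
    have h1p := one_le_ofReal_of_one_lt hp1
    have m1 : AEStronglyMeasurable (fun x => Hx (x, φ j x) - Hx (x, u x)) :=
      ((hcont hHx j).aestronglyMeasurable.sub (hmeas hHx))
    have m2 : AEStronglyMeasurable (fun x => (Hs (x, φ j x) - Hs (x, u x)) • G x) :=
      ((hcont hHs j).aestronglyMeasurable.sub (hmeas hHs)).smul hu.memLp.1
    have m3 : AEStronglyMeasurable (fun x => Hs (x, φ j x) • (moll j G - G) x) :=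
      (hcont hHs j).aestronglyMeasurable.smul ((mG j).sub hu.memLp.1)
    have e : gradient (fun x => H (x, φ j x)) - (fun x => Hx (x, u x) + Hs (x, u x) • G x)
        = ((fun x => Hx (x, φ j x) - Hx (x, u x)) + fun x => (Hs (x, φ j x) - Hs (x, u x)) • G x)
          + fun x => Hs (x, φ j x) • (moll j G - G) x := by
      rw [hgrad j]
      ext1 x
      simp only [Pi.sub_apply, Pi.add_apply, smul_sub, sub_smul]
      abel
    have goal := (eLpNorm_add_le (m1.add m2) m3 h1p).trans
      (add_le_add (eLpNorm_add_le m1 m2 h1p) le_rfl)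
    rw [← e] at goal
    exact goal

theorem BoundedWeak.sobolevPair_mul_sub (hp1 : 1 < p) (hpn : p < (n : ℝ)) {C : ℝ} {u : Sp n → ℝ}
    {G : Sp n → Sp n} (hu : BoundedWeak p C u G) {η g : Sp n → ℝ} (hη : ContDiff ℝ 1 η)
    (hηs : HasCompactSupport η) (hg : ContDiff ℝ 1 g) {V : Set ℝ}
    (hV : ∀ x, ∀ s ∈ Set.Icc 0 C, g x - s ∈ V) {F F' : ℝ → ℝ}
    (hF : ∀ t ∈ V, HasDerivAt F (F' t) t) (hF' : ContinuousOn F' V) :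
    SobolevPair p (fun x => η x * F (g x - u x))
      (fun x => F (g x - u x) • gradient η x + (η x * F' (g x - u x)) • (gradient g x - G x)) := by
  have hFc : ContinuousOn F V := fun t ht => (hF t ht).continuousAt.continuousWithinAt
  have hsub : ContinuousOn (fun z : Sp n × ℝ => g z.1 - z.2) (Set.univ ×ˢ Set.Icc 0 C) :=
    ((hg.continuous.comp continuous_fst).sub continuous_snd).continuousOn
  have hmaps : Set.MapsTo (fun z : Sp n × ℝ => g z.1 - z.2) (Set.univ ×ˢ Set.Icc 0 C) V :=
    fun z hz => hV z.1 z.2 hz.2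
  have c1 := hFc.comp hsub hmaps
  have c2 := hF'.comp hsub hmaps
  have cη : Continuous (fun z : Sp n × ℝ => η z.1) := hη.continuous.comp continuous_fst
  have cη' : Continuous (fun z : Sp n × ℝ => gradient η z.1) :=
    (continuous_gradient hη).comp continuous_fst
  have cg' : Continuous (fun z : Sp n × ℝ => gradient g z.1) :=
    (continuous_gradient hg).comp continuous_fst
  have main := hu.sobolevPair_comp hp1 hpn (H := fun z => η z.1 * F (g z.1 - z.2))
    (Hx := fun z => F (g z.1 - z.2) • gradient η z.1
      + (η z.1 * F' (g z.1 - z.2)) • gradient g z.1)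
    (Hs := fun z => - (η z.1 * F' (g z.1 - z.2))) ?_ ?_ ?_ hηs ?_
  · refine (congrArg (SobolevPair p _) ?_).mp main
    ext1 x
    simp only [smul_sub, neg_smul]
    abel
  · intro z hz
    have d1 : HasFDerivAt (fun z : Sp n × ℝ => η z.1)
        ((fderiv ℝ η z.1).comp (ContinuousLinearMap.fst ℝ (Sp n) ℝ)) z :=
      (hasGradientAt_of_contDiff hη z.1).comp z hasFDerivAt_fst
    have d2 : HasFDerivAt (fun z : Sp n × ℝ => g z.1 - z.2)
        ((fderiv ℝ g z.1).comp (ContinuousLinearMap.fst ℝ (Sp n) ℝ)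
          - ContinuousLinearMap.snd ℝ (Sp n) ℝ) z :=
      ((hasGradientAt_of_contDiff hg z.1).comp z hasFDerivAt_fst).sub hasFDerivAt_snd
    have d3 := (hF _ (hmaps hz)).comp_hasFDerivAt z d2
    refine (d1.mul d3).congr_fderiv ?_
    ext v
    · simp
      ring
    · simp
  · exact (c1.smul cη'.continuousOn).add ((cη.continuousOn.mul c2).smul cg'.continuousOn)
  · exact (cη.continuousOn.mul c2).neg
  · intro x hx s
    have e1 : η x = 0 := image_eq_zero_of_notMem_tsupport hx
    have e2 : gradient η x = 0 := by
      have : fderiv ℝ η x = 0 := by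
        by_contra h
        exact hx (support_fderiv_subset ℝ h)
      simp [gradient, this]
    simp [e1, e2]

/-- The case g = 0 of the previous result, with F reflected to absorb the sign of g - u. -/
theorem BoundedWeak.sobolevPair_mul (hp1 : 1 < p) (hpn : p < (n : ℝ)) {C : ℝ} {u : Sp n → ℝ}
    {G : Sp n → Sp n} (hu : BoundedWeak p C u G) {η : Sp n → ℝ} (hη : ContDiff ℝ 1 η)
    (hηs : HasCompactSupport η) {F F' : ℝ → ℝ}
    (hF : ∀ t ∈ Set.Icc 0 C, HasDerivAt F (F' t) t) (hF' : ContinuousOn F' (Set.Icc 0 C)) :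
    SobolevPair p (fun x => η x * F (u x))
      (fun x => F (u x) • gradient η x + (η x * F' (u x)) • G x) := by
  have main := hu.sobolevPair_mul_sub hp1 hpn hη hηs (g := fun _ => 0) contDiff_const
    (V := {t | -t ∈ Set.Icc 0 C}) (F := fun t => F (-t)) (F' := fun t => -F' (-t)) ?_ ?_ ?_
  · have e : gradient (fun _ : Sp n => (0 : ℝ)) = fun _ => 0 := by
      ext1 x; simp [gradient]
    simpa [e] using main
  · intro x s hs
    simpa using hs
  · intro t ht
    have := (hF (-t) ht).comp t (hasDerivAt_neg t)
    simpa [Function.comp_def] using this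
  · exact (hF'.comp continuous_neg.continuousOn (fun t ht => ht)).neg

/-! ### Cutoffs and decay at infinity -/

noncomputable def unitBump (n : ℕ) : ContDiffBump (0 : Sp n) where
  rIn := 1
  rOut := 2
  rIn_pos := one_pos
  rIn_lt_rOut := one_lt_two

/-- A smooth cutoff function which is `1` on the ball of radius `R` and vanishes outside the ball
of radius `2 R`. -/
noncomputable def cutoff (n : ℕ) (R : ℝ) (x : Sp n) : ℝ := unitBump n (R⁻¹ • x)

theorem cutoff_contDiff (R : ℝ) : ContDiff ℝ 1 (cutoff n R) :=
  (unitBump n).contDiff.comp (contDiff_const_smul _)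

theorem cutoff_nonneg (R : ℝ) (x : Sp n) : 0 ≤ cutoff n R x := (unitBump n).nonneg

theorem cutoff_le_one (R : ℝ) (x : Sp n) : cutoff n R x ≤ 1 := (unitBump n).le_one

theorem cutoff_eq_one {R : ℝ} (hR : 0 < R) {x : Sp n} (hx : ‖x‖ ≤ R) : cutoff n R x = 1 := by
  refine (unitBump n).one_of_mem_closedBall ?_
  rw [mem_closedBall_zero_iff, norm_smul, norm_inv, Real.norm_of_nonneg hR.le]
  change R⁻¹ * ‖x‖ ≤ 1
  rw [inv_mul_le_iff₀ hR]
  linarith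

theorem cutoff_eq_zero {R : ℝ} (hR : 0 < R) {x : Sp n} (hx : 2 * R ≤ ‖x‖) : cutoff n R x = 0 := by
  refine (unitBump n).zero_of_le_dist ?_
  rw [dist_zero_right, norm_smul, norm_inv, Real.norm_of_nonneg hR.le]
  change 2 ≤ R⁻¹ * ‖x‖
  rw [le_inv_mul_iff₀ hR]
  linarith

theorem cutoff_hasCompactSupport {R : ℝ} (hR : 0 < R) : HasCompactSupport (cutoff n R) := by
  refine HasCompactSupport.intro (isCompact_closedBall (0 : Sp n) (2 * R)) fun x hx => ?_
  rw [mem_closedBall_zero_iff, not_le] at hx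
  exact cutoff_eq_zero hR hx.le

theorem gradient_eq_zero_of_eventuallyEq_const {f : Sp n → ℝ} {x : Sp n} {c : ℝ}
    (h : f =ᶠ[𝓝 x] fun _ => c) : gradient f x = 0 := by
  have : fderiv ℝ f x = 0 := by rw [h.fderiv_eq]; simp
  simp [gradient, this]

theorem gradient_cutoff_eq_zero {R : ℝ} (hR : 0 < R) {x : Sp n} (hx : ‖x‖ < R ∨ 2 * R < ‖x‖) :
    gradient (cutoff n R) x = 0 := by
  rcases hx with hx | hx
  · refine gradient_eq_zero_of_eventuallyEq_const (c := 1) ?_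
    filter_upwards [(isOpen_lt continuous_norm continuous_const).mem_nhds hx] with y hy
    exact cutoff_eq_one hR (le_of_lt hy)
  · refine gradient_eq_zero_of_eventuallyEq_const (c := 0) ?_
    filter_upwards [(isOpen_lt continuous_const continuous_norm).mem_nhds hx] with y hy
    exact cutoff_eq_zero hR (le_of_lt hy)

theorem exists_gradient_cutoff_le (n : ℕ) :
    ∃ L : ℝ, 0 < L ∧ ∀ R : ℝ, 0 < R → ∀ x : Sp n, ‖gradient (cutoff n R) x‖ ≤ L / R := by
  have hb : ContDiff ℝ 1 (unitBump n) := (unitBump n).contDiff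
  obtain ⟨L, hL⟩ := (hasCompactSupport_gradient (unitBump n).hasCompactSupport).exists_bound_of_continuous
    (continuous_gradient hb)
  refine ⟨max L 1, by positivity, fun R hR x => ?_⟩
  have h1 : HasFDerivAt (cutoff n R) ((fderiv ℝ (unitBump n) (R⁻¹ • x)).comp
      (R⁻¹ • ContinuousLinearMap.id ℝ (Sp n))) x :=
    (hasGradientAt_of_contDiff hb (R⁻¹ • x)).comp x ((hasFDerivAt_id x).const_smul R⁻¹)
  rw [norm_gradient, h1.fderiv, ContinuousLinearMap.comp_smul, ContinuousLinearMap.comp_id,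
    norm_smul, ← norm_gradient, norm_inv, Real.norm_of_nonneg hR.le, div_eq_inv_mul]
  gcongr
  exact (hL _).trans (le_max_left _ _)

theorem memLp_one_add_norm_rpow {s q : ℝ} (hq : 0 < q) (h : (n : ℝ) < s * q) :
    MemLp (fun x : Sp n => (1 + ‖x‖) ^ (-s)) (ENNReal.ofReal q) := by
  have hc : Continuous (fun x : Sp n => (1 + ‖x‖) ^ (-s)) :=
    (continuous_const.add continuous_norm).rpow_const fun x => Or.inl (add_pos_of_pos_of_nonneg one_pos (norm_nonneg x)).ne'
  rw [← integrable_norm_rpow_iff hc.aestronglyMeasurable (by simpa using hq) ENNReal.ofReal_ne_top]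
  have := integrable_one_add_norm (E := Sp n) (μ := volume) (r := s * q)
    (by rwa [finrank_euclideanSpace_fin])
  refine this.congr (ae_of_all _ fun x => ?_)
  have h1 : 0 ≤ 1 + ‖x‖ := by positivity
  dsimp only
  rw [ENNReal.toReal_ofReal hq.le, Real.norm_of_nonneg (Real.rpow_nonneg h1 _), ← Real.rpow_mul h1]
  congr 1; ring

theorem norm_rpow_neg_le {s : ℝ} (hs : 0 ≤ s) {x : Sp n} (hx : 1 ≤ ‖x‖) :
    ‖x‖ ^ (-s) ≤ 2 ^ s * (1 + ‖x‖) ^ (-s) := by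
  have h0 : 0 < ‖x‖ := by linarith
  rw [Real.rpow_neg h0.le, Real.rpow_neg (by positivity), ← div_eq_mul_inv, inv_eq_one_div,
    div_le_div_iff₀ (by positivity) (by positivity), one_mul, ← Real.mul_rpow (by norm_num) h0.le]
  exact Real.rpow_le_rpow (by positivity) (by linarith) hs

/-- The decay exponent `(n - p) / (p - 1)` of the fundamental solution. -/
noncomputable def decayExp (n : ℕ) (p : ℝ) : ℝ := ((n : ℝ) - p) / (p - 1)

theorem decayExp_pos (hp1 : 1 < p) (hpn : p < (n : ℝ)) : 0 < decayExp n p :=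
  div_pos (by linarith) (by linarith)

theorem decayExp_add_one (hp1 : 1 < p) : (decayExp n p + 1) * (p - 1) = n - 1 := by
  have : p - 1 ≠ 0 := by linarith
  rw [decayExp]; field_simp; ring

/-- This is the condition for |x|^(-a-1), the size of the gradient of the fundamental solution, to
be in L^p at infinity. -/
theorem lt_decayExp_add_one_mul (hp1 : 1 < p) (hpn : p < (n : ℝ)) :
    (n : ℝ) < (decayExp n p + 1) * p := by
  have h1 : 0 < p - 1 := by linarith
  have e : (decayExp n p + 1) * p = (n - 1) * p / (p - 1) := by
    rw [eq_div_iff h1.ne', ← decayExp_add_one hp1]; ring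
  rw [e, lt_div_iff₀ h1]; nlinarith

/-- This is the condition for |x|^(-a) to be in L^{p*} at infinity. -/
theorem lt_decayExp_mul_critExp (hp1 : 1 < p) (hpn : p < (n : ℝ)) :
    (n : ℝ) < decayExp n p * critExp n p := by
  have h1 : 0 < p - 1 := by linarith
  have h2 : 0 < (n : ℝ) - p := by linarith
  have e : decayExp n p * critExp n p = n * p / (p - 1) := by
    rw [decayExp, critExp]; field_simp
  rw [e, lt_div_iff₀ h1]; nlinarith

/-- Only the term w ∇η_R needs an argument. On R ≤ |x| ≤ 2R the gradient of the cutoff is O(1/|x|),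
so the decay of w dominates this term by a multiple of |x|^(-a-1), uniformly in R. That majorant is
in L^p, and dominated convergence removes the cutoff. -/
theorem SobolevPair.of_cutoff (hp1 : 1 < p) (hpn : p < (n : ℝ)) {w : Sp n → ℝ} {W : Sp n → Sp n}
    (hw : MemLp w (ENNReal.ofReal (critExp n p))) (hW : MemLp W (ENNReal.ofReal p)) {M : ℝ}
    (hM : 0 ≤ M) (hb : ∀ᵐ x, 1 ≤ ‖x‖ → |w x| ≤ M * ‖x‖ ^ (-decayExp n p))
    (h : ∀ R : ℝ, 1 ≤ R → SobolevPair p (fun x => cutoff n R x * w x)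
      (fun x => w x • gradient (cutoff n R) x + cutoff n R x • W x)) :
    SobolevPair p w W := by
  obtain ⟨L, hL0, hL⟩ := exists_gradient_cutoff_le n
  have hp0 : 0 < p := by linarith
  have ha := decayExp_pos hp1 hpn
  set r : ℕ → ℝ := fun j => (j : ℝ) + 1 with hr
  have hr1 : ∀ j, 1 ≤ r j := fun j => by simp [hr]
  have hr0 : ∀ j, 0 < r j := fun j => zero_lt_one.trans_le (hr1 j)
  have hev : ∀ x : Sp n, ∀ᶠ j in atTop, ‖x‖ < r j := fun x =>
    (tendsto_natCast_atTop_atTop.atTop_add tendsto_const_nhds).eventually_gt_atTop _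
  refine SobolevPair.of_limit hp1 hpn hw hW (fun j => h (r j) (hr1 j)) ?_ ?_
  · refine tendsto_eLpNorm_zero_of_dominated (by linarith [one_lt_critExp hp1 hpn])
      (fun j => ((h (r j) (hr1 j)).1.sub hw).1) hw.norm ?_ ?_
    · refine fun j => ae_of_all _ fun x => ?_
      have e : (cutoff n (r j) x * w x - w x) = (cutoff n (r j) x - 1) * w x := by ring
      simp only [Pi.sub_apply, e, norm_mul]
      refine mul_le_of_le_one_left (norm_nonneg _) ?_
      rw [Real.norm_eq_abs, abs_le]
      constructor <;> linarith [cutoff_nonneg (r j) x, cutoff_le_one (r j) x]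
    · refine ae_of_all _ fun x => ?_
      refine tendsto_const_nhds.congr' ?_
      filter_upwards [hev x] with j hj
      simp [cutoff_eq_one (hr0 j) hj.le]
  · have hD : MemLp (fun x : Sp n => 2 * L * M * (2 ^ (decayExp n p + 1) *
        (1 + ‖x‖) ^ (-(decayExp n p + 1)))) (ENNReal.ofReal p) :=
      ((memLp_one_add_norm_rpow hp0 (lt_decayExp_add_one_mul hp1 hpn)).const_mul _).const_mul _
    refine tendsto_eLpNorm_zero_of_dominated hp0
      (fun j => ((h (r j) (hr1 j)).2.1.sub hW).1) (hD.add hW.norm) ?_ ?_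
    · intro j
      filter_upwards [hb] with x hx
      have e : (w x • gradient (cutoff n (r j)) x + cutoff n (r j) x • W x - W x)
        = w x • gradient (cutoff n (r j)) x + (cutoff n (r j) x - 1) • W x := by
        rw [sub_smul, one_smul]; abel
      simp only [Pi.sub_apply, e, Pi.add_apply]
      refine (norm_add_le _ _).trans (add_le_add ?_ ?_)
      · rw [norm_smul, Real.norm_eq_abs]
        by_cases hx1 : ‖x‖ < r j
        · rw [gradient_cutoff_eq_zero (hr0 j) (Or.inl hx1), norm_zero, mul_zero]
          positivity
        · by_cases hx2 : 2 * r j < ‖x‖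
          · rw [gradient_cutoff_eq_zero (hr0 j) (Or.inr hx2), norm_zero, mul_zero]
            positivity
          · push Not at hx1 hx2
            have h1x : 1 ≤ ‖x‖ := (hr1 j).trans hx1
            have h0x : 0 < ‖x‖ := by linarith
            have g1 : ‖gradient (cutoff n (r j)) x‖ ≤ 2 * L * ‖x‖⁻¹ := by
              refine (hL _ (hr0 j) x).trans ?_
              rw [← div_eq_mul_inv, div_le_div_iff₀ (hr0 j) h0x]
              nlinarith
            calc _ ≤ (M * ‖x‖ ^ (-decayExp n p)) * (2 * L * ‖x‖⁻¹) := by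
                  gcongr
                  exact hx h1x
              _ = 2 * L * M * ‖x‖ ^ (-(decayExp n p + 1)) := by
                  rw [neg_add, Real.rpow_add h0x, Real.rpow_neg_one]; ring
              _ ≤ _ := by
                  gcongr
                  exact norm_rpow_neg_le (by linarith) h1x
      · rw [norm_smul]
        refine mul_le_of_le_one_left (norm_nonneg _) ?_
        rw [Real.norm_eq_abs, abs_le]
        constructor <;> linarith [cutoff_nonneg (r j) x, cutoff_le_one (r j) x]
    · refine ae_of_all _ fun x => ?_
      refine tendsto_const_nhds.congr' ?_
      filter_upwards [hev x] with j hj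
      simp [cutoff_eq_one (hr0 j) hj.le, gradient_cutoff_eq_zero (hr0 j) (Or.inl hj)]

theorem BoundedWeak.sobolevPair (hp1 : 1 < p) (hpn : p < (n : ℝ)) {C : ℝ} {u : Sp n → ℝ}
    {G : Sp n → Sp n} (hu : BoundedWeak p C u G) (hum : MemLp u (ENNReal.ofReal (critExp n p)))
    {M : ℝ} (hM : 0 ≤ M) (hb : ∀ᵐ x, 1 ≤ ‖x‖ → |u x| ≤ M * ‖x‖ ^ (-decayExp n p)) :
    SobolevPair p u G := by
  refine SobolevPair.of_cutoff hp1 hpn hum hu.memLp hM hb fun R hR => ?_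
  have hR0 : 0 < R := by linarith
  have := hu.sobolevPair_mul hp1 hpn (cutoff_contDiff R) (cutoff_hasCompactSupport hR0)
    (F := fun t => t) (F' := fun _ => 1) (fun t _ => hasDerivAt_id t) continuousOn_const
  simpa using this

/-! ### Monotonicity of the p-Laplacian flux -/

/-- The vector field `|ξ|^{p-2} ξ`. -/
noncomputable def pflux (p : ℝ) (ξ : Sp n) : Sp n := ‖ξ‖ ^ (p - 2) • ξ

theorem norm_rpow_sub_two_mul (hp1 : 1 < p) (ξ : Sp n) : ‖ξ‖ ^ (p - 2) * ‖ξ‖ = ‖ξ‖ ^ (p - 1) := by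
  rcases (norm_nonneg ξ).eq_or_lt with h | h
  · rw [← h, mul_zero, Real.zero_rpow (by linarith)]
  · rw [← Real.rpow_add_one h.ne']; congr 1; ring

theorem norm_rpow_sub_one_mul (hp1 : 1 < p) (ξ : Sp n) : ‖ξ‖ ^ (p - 1) * ‖ξ‖ = ‖ξ‖ ^ p := by
  rcases (norm_nonneg ξ).eq_or_lt with h | h
  · rw [← h, mul_zero, Real.zero_rpow (by linarith)]
  · rw [← Real.rpow_add_one h.ne']; congr 1; ring

theorem norm_pflux (hp1 : 1 < p) (ξ : Sp n) : ‖pflux p ξ‖ = ‖ξ‖ ^ (p - 1) := by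
  rw [pflux, norm_smul, Real.norm_of_nonneg (Real.rpow_nonneg (norm_nonneg _) _),
    norm_rpow_sub_two_mul hp1]

theorem inner_pflux_self (hp1 : 1 < p) (ξ : Sp n) : inner ℝ (pflux p ξ) ξ = ‖ξ‖ ^ p := by
  rw [pflux, real_inner_smul_left, real_inner_self_eq_norm_sq, sq, ← mul_assoc,
    norm_rpow_sub_two_mul hp1, norm_rpow_sub_one_mul hp1]

theorem inner_pflux_le (hp1 : 1 < p) (ξ ζ : Sp n) :
    inner ℝ (pflux p ξ) ζ ≤ ‖ξ‖ ^ (p - 1) * ‖ζ‖ := by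
  rw [← norm_pflux hp1]; exact real_inner_le_norm _ _

/-- Expand the inner product and estimate the two mixed terms by Cauchy–Schwarz; what remains
factors as the left side. -/
theorem pflux_monotone (hp1 : 1 < p) (ξ ζ : Sp n) :
    (‖ξ‖ ^ (p - 1) - ‖ζ‖ ^ (p - 1)) * (‖ξ‖ - ‖ζ‖) ≤ inner ℝ (pflux p ξ - pflux p ζ) (ξ - ζ) := by
  rw [inner_sub_left, inner_sub_right, inner_sub_right, inner_pflux_self hp1, inner_pflux_self hp1]
  have h1 := inner_pflux_le hp1 ξ ζ
  have h2 := inner_pflux_le hp1 ζ ξ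
  have h3 := norm_rpow_sub_one_mul hp1 ξ
  have h4 := norm_rpow_sub_one_mul hp1 ζ
  nlinarith

theorem pflux_monotone_nonneg (hp1 : 1 < p) (ξ ζ : Sp n) :
    0 ≤ inner ℝ (pflux p ξ - pflux p ζ) (ξ - ζ) := by
  refine le_trans ?_ (pflux_monotone hp1 ξ ζ)
  rcases le_total ‖ξ‖ ‖ζ‖ with h | h
  · exact mul_nonneg_of_nonpos_of_nonpos
      (sub_nonpos.2 (Real.rpow_le_rpow (norm_nonneg _) h (by linarith))) (sub_nonpos.2 h)
  · exact mul_nonneg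
      (sub_nonneg.2 (Real.rpow_le_rpow (norm_nonneg _) h (by linarith))) (sub_nonneg.2 h)

/-- Equality forces equal norms, as t ↦ t^(p-1) is strictly increasing. The flux difference is then
a common factor times ξ - ζ. -/
theorem eq_of_pflux_inner_eq_zero (hp1 : 1 < p) {ξ ζ : Sp n}
    (h : inner ℝ (pflux p ξ - pflux p ζ) (ξ - ζ) = 0) : ξ = ζ := by
  have h1 := pflux_monotone hp1 ξ ζ
  rw [h] at h1
  have hn : ‖ξ‖ = ‖ζ‖ := by
    rcases lt_trichotomy ‖ξ‖ ‖ζ‖ with h2 | h2 | h2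
    · have := Real.rpow_lt_rpow (norm_nonneg _) h2 (by linarith : 0 < p - 1)
      nlinarith
    · exact h2
    · have := Real.rpow_lt_rpow (norm_nonneg _) h2 (by linarith : 0 < p - 1)
      nlinarith
  rcases (norm_nonneg ζ).eq_or_lt with h0 | h0
  · rw [norm_eq_zero.1 (hn.trans h0.symm), norm_eq_zero.1 h0.symm]
  · rw [pflux, pflux, hn, ← smul_sub, real_inner_smul_left, real_inner_self_eq_norm_sq] at h
    have := (mul_eq_zero.1 h).resolve_left (Real.rpow_pos_of_pos h0 _).ne'
    exact sub_eq_zero.1 (norm_eq_zero.1 (pow_eq_zero_iff two_ne_zero |>.1 this))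

theorem continuous_pflux (hp1 : 1 < p) : Continuous (pflux (n := n) p) := by
  rw [continuous_iff_continuousAt]
  intro ξ
  by_cases h : ξ = 0
  · subst h
    have h0 : pflux p (0 : Sp n) = 0 := by simp [pflux]
    rw [ContinuousAt, h0, tendsto_zero_iff_norm_tendsto_zero]
    simp only [norm_pflux hp1]
    have := (continuous_norm (E := Sp n)).rpow_const (p := p - 1) (fun x => Or.inr (by linarith))
    simpa [Real.zero_rpow (by linarith : p - 1 ≠ 0)] using this.tendsto 0
  · exact (continuous_norm.continuousAt.rpow_const (Or.inl (norm_ne_zero_iff.2 h))).smul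
      continuousAt_id

/-- The flux has size |G|^(p-1), and (p-1)p' = p for the conjugate exponent p'. -/
theorem memLp_pflux (hp1 : 1 < p) {p' : ℝ} (hp : p.HolderConjugate p') {G : Sp n → Sp n}
    (hG : MemLp G (ENNReal.ofReal p)) : MemLp (fun x => pflux p (G x)) (ENNReal.ofReal p') := by
  have hp'0 : 0 < p' := hp.symm.pos
  have hm : AEStronglyMeasurable (fun x => pflux p (G x)) :=
    (continuous_pflux hp1).comp_aestronglyMeasurable hG.1
  rw [← integrable_norm_rpow_iff hm (by simpa using hp'0) ENNReal.ofReal_ne_top]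
  have := hG.integrable_norm_rpow (by simpa using (by linarith : 0 < p)) ENNReal.ofReal_ne_top
  refine this.congr (ae_of_all _ fun x => ?_)
  dsimp only
  rw [ENNReal.toReal_ofReal (by linarith : 0 ≤ p), ENNReal.toReal_ofReal hp'0.le, norm_pflux hp1,
    ← Real.rpow_mul (norm_nonneg _), hp.sub_one_mul_conj]

/-- `G` is the gradient of a weak supersolution: `∫ ⟨|G|^{p-2} G, W⟩ ≥ 0` for all nonnegative
`w` with gradient `W`. -/
def IsSuper (p : ℝ) (G : Sp n → Sp n) : Prop :=
  ∀ w W, SobolevPair p w W → (∀ᵐ x, 0 ≤ w x) → 0 ≤ ∫ x, inner ℝ (pflux p (G x)) (W x)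

/-! ### The fundamental solution and comparison outside a ball -/

/-- `|x|^{-s}` with the singularity at the origin cut off. -/
noncomputable def cutRpow (n : ℕ) (r s : ℝ) (x : Sp n) : ℝ :=
  (1 - cutoff n r x) * (‖x‖ ^ 2) ^ (-s / 2)

theorem cutRpow_eq {r : ℝ} (hr : 0 < r) (s : ℝ) {x : Sp n} (hx : 2 * r ≤ ‖x‖) :
    cutRpow n r s x = ‖x‖ ^ (-s) := by
  rw [cutRpow, cutoff_eq_zero hr hx, sub_zero, one_mul, ← Real.rpow_natCast,
    ← Real.rpow_mul (norm_nonneg _)]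
  congr 1; push_cast; ring

theorem cutRpow_eq_zero {r : ℝ} (hr : 0 < r) (s : ℝ) {x : Sp n} (hx : ‖x‖ ≤ r) :
    cutRpow n r s x = 0 := by
  rw [cutRpow, cutoff_eq_one hr hx, sub_self, zero_mul]

theorem cutRpow_nonneg (r s : ℝ) (x : Sp n) : 0 ≤ cutRpow n r s x :=
  mul_nonneg (sub_nonneg.2 (cutoff_le_one r x)) (Real.rpow_nonneg (sq_nonneg _) _)

theorem cutRpow_le (r s : ℝ) (x : Sp n) : cutRpow n r s x ≤ ‖x‖ ^ (-s) := by
  have e : (‖x‖ ^ 2) ^ (-s / 2) = ‖x‖ ^ (-s) := by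
    rw [← Real.rpow_natCast, ← Real.rpow_mul (norm_nonneg _)]
    congr 1; push_cast; ring
  rw [cutRpow, e]
  exact mul_le_of_le_one_left (Real.rpow_nonneg (norm_nonneg _) _) (by linarith [cutoff_nonneg r x])

theorem cutRpow_le_of {r s : ℝ} (hr : 0 < r) (hs : 0 ≤ s) (x : Sp n) :
    cutRpow n r s x ≤ r ^ (-s) := by
  rcases le_total ‖x‖ r with h | h
  · rw [cutRpow_eq_zero hr s h]; positivity
  · exact (cutRpow_le r s x).trans (Real.rpow_le_rpow_of_nonpos hr h (by linarith))

/-- The function vanishes near the origin. Elsewhere the power is taken of |x|², which is smooth and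
nonzero. -/
theorem contDiff_cutRpow {r : ℝ} (hr : 0 < r) (s : ℝ) : ContDiff ℝ 1 (cutRpow n r s) := by
  rw [contDiff_iff_contDiffAt]
  intro x
  by_cases hx : x = 0
  · subst hx
    refine (contDiffAt_const (c := (0 : ℝ))).congr_of_eventuallyEq ?_
    filter_upwards [ball_mem_nhds (0 : Sp n) hr] with y hy
    exact cutRpow_eq_zero hr s (mem_ball_zero_iff.1 hy).le
  · have h1 : ContDiffAt ℝ 1 (fun y : Sp n => (‖y‖ ^ 2) ^ (-s / 2)) x :=
      (contDiff_norm_sq ℝ).contDiffAt.rpow_const_of_ne (by simpa using hx)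
    exact (contDiffAt_const.sub (cutoff_contDiff r).contDiffAt).mul h1

theorem hasFDerivAt_cutRpow {r : ℝ} (hr : 0 < r) (s : ℝ) {x : Sp n} (hx : 2 * r < ‖x‖) :
    HasFDerivAt (cutRpow n r s) ((-s * ‖x‖ ^ (-s - 2)) • innerSL ℝ x) x := by
  have hx0 : 0 < ‖x‖ := by linarith
  have h1 : HasFDerivAt (fun y : Sp n => (‖y‖ ^ 2) ^ (-s / 2))
      ((-s / 2 * (‖x‖ ^ 2) ^ (-s / 2 - 1)) • (2 • innerSL ℝ x)) x :=
    (Real.hasDerivAt_rpow_const (Or.inl (by positivity))).comp_hasFDerivAt x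
      (hasStrictFDerivAt_norm_sq x).hasFDerivAt
  have e : (‖x‖ ^ 2) ^ (-s / 2 - 1) = ‖x‖ ^ (-s - 2) := by
    rw [← Real.rpow_natCast, ← Real.rpow_mul hx0.le]
    congr 1; push_cast; ring
  refine (h1.congr_of_eventuallyEq ?_).congr_fderiv ?_
  · filter_upwards [(isOpen_lt continuous_const continuous_norm).mem_nhds hx] with y hy
    rw [cutRpow, cutoff_eq_zero hr (le_of_lt hy), sub_zero, one_mul]
  · rw [e]
    ext v
    simp
    ring

theorem gradient_cutRpow {r : ℝ} (hr : 0 < r) (s : ℝ) {x : Sp n} (hx : 2 * r < ‖x‖) :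
    gradient (cutRpow n r s) x = (-s * ‖x‖ ^ (-s - 2)) • x := by
  refine ext_inner_right ℝ fun v => ?_
  rw [inner_gradient, (hasFDerivAt_cutRpow hr s hx).fderiv, real_inner_smul_left]
  simp

/-- The vector field `|x|^{-n} x` with the singularity at the origin cut off. -/
noncomputable def cutField (n : ℕ) (r : ℝ) (x : Sp n) : Sp n := cutRpow n r n x • x

theorem contDiff_cutField {r : ℝ} (hr : 0 < r) : ContDiff ℝ 1 (cutField n r) :=
  (contDiff_cutRpow hr n).smul contDiff_id

/-- Take b = -div X. Where the cutoff is inactive, div(|x|^(-n) x) = n|x|^(-n) - n|x|^(-n-2)|x|² =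
0, so b is supported in the ball of radius 2r. -/
theorem exists_weakDiv_cutField {r : ℝ} (hr : 0 < r) :
    ∃ b : Sp n → ℝ, Continuous b ∧ (∀ x, 2 * r < ‖x‖ → b x = 0) ∧
      ∀ φ : Sp n → ℝ, IsTestFunction φ →
        ∫ x, inner ℝ (cutField n r x) (gradient φ x) = ∫ x, b x * φ x := by
  have hX := contDiff_cutField (n := n) hr
  set e : Fin n → Sp n := fun i => EuclideanSpace.single i 1 with he
  have hXi : ∀ i, ContDiff ℝ 1 (fun x => cutField n r x i) := fun i =>
    (EuclideanSpace.proj (𝕜 := ℝ) i).contDiff.comp hX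
  refine ⟨fun x => - ∑ i, fderiv ℝ (fun x => cutField n r x i) x (e i), ?_, ?_, ?_⟩
  · refine (continuous_finsetSum _ fun i _ => ?_).neg
    exact ((hXi i).continuous_fderiv one_ne_zero).clm_apply continuous_const
  · intro x hx
    have hx0 : 0 < ‖x‖ := by linarith
    have hd : ∀ i, fderiv ℝ (fun x => cutField n r x i) x (e i)
        = ‖x‖ ^ (-(n : ℝ)) + (-(n : ℝ) * ‖x‖ ^ (-(n : ℝ) - 2)) * (x i * x i) := by
      intro i
      have h1 : HasFDerivAt (fun x => cutRpow n r n x * x i) _ x :=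
        (hasFDerivAt_cutRpow hr n hx).mul (EuclideanSpace.proj (𝕜 := ℝ) i).hasFDerivAt
      have h2 : (fun x => cutField n r x i) = fun x => cutRpow n r n x * x i := by
        ext y; simp [cutField]
      have h3 : inner ℝ x (e i) = x i := by
        rw [he, EuclideanSpace.inner_single_right]; simp
      have h4 : (EuclideanSpace.proj (𝕜 := ℝ) i : Sp n →L[ℝ] ℝ) (e i) = 1 := by simp [he]
      rw [h2, h1.fderiv, cutRpow_eq hr n hx.le]
      simp only [add_apply, smul_apply, h4, innerSL_apply_apply, h3,
        smul_eq_mul]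
      ring
    simp only [hd]
    rw [Finset.sum_add_distrib, ← Finset.mul_sum]
    have hs : ∑ i, x i * x i = ‖x‖ ^ 2 := by
      rw [EuclideanSpace.real_norm_sq_eq]
      exact Finset.sum_congr rfl fun i _ => by ring
    have h3 : ‖x‖ ^ (-(n : ℝ) - 2) * ‖x‖ ^ 2 = ‖x‖ ^ (-(n : ℝ)) := by
      rw [← Real.rpow_natCast, ← Real.rpow_add hx0]
      congr 1; push_cast; ring
    rw [hs, mul_assoc, h3]
    simp
  · intro φ hφ
    have h1 := hφ.contDiff_one
    have cφ : ∀ i, Continuous fun x => fderiv ℝ φ x (e i) := fun i =>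
      (h1.continuous_fderiv one_ne_zero).clm_apply continuous_const
    have cX : ∀ i, Continuous fun x => fderiv ℝ (fun x => cutField n r x i) x (e i) := fun i =>
      ((hXi i).continuous_fderiv one_ne_zero).clm_apply continuous_const
    have sφ : ∀ i, HasCompactSupport fun x => fderiv ℝ φ x (e i) := fun i =>
      hφ.2.fderiv_apply ℝ (e i)
    have I1 : ∀ i, Integrable fun x => cutField n r x i * fderiv ℝ φ x (e i) := fun i =>
      ((hXi i).continuous.mul (cφ i)).integrable_of_hasCompactSupport (sφ i).mul_left
    have I2 : ∀ i, Integrable fun x => fderiv ℝ (fun x => cutField n r x i) x (e i) * φ x := fun i =>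
      ((cX i).mul h1.continuous).integrable_of_hasCompactSupport hφ.2.mul_left
    have I3 : ∀ i, Integrable fun x => cutField n r x i * φ x := fun i =>
      ((hXi i).continuous.mul h1.continuous).integrable_of_hasCompactSupport hφ.2.mul_left
    have e1 : ∀ x, inner ℝ (cutField n r x) (gradient φ x)
        = ∑ i, cutField n r x i * fderiv ℝ φ x (e i) := by
      intro x
      rw [PiLp.inner_apply]
      refine Finset.sum_congr rfl fun i _ => ?_
      rw [← inner_gradient, EuclideanSpace.inner_single_right]
      simp [mul_comm]
    simp only [e1, neg_mul, Finset.sum_mul]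
    rw [integral_finsetSum _ fun i _ => I1 i, integral_neg, integral_finsetSum _ fun i _ => I2 i,
      ← Finset.sum_neg_distrib]
    refine Finset.sum_congr rfl fun i _ => ?_
    exact integral_mul_fderiv_eq_neg_fderiv_mul_of_integrable (I2 i) (I1 i) (I3 i)
      (fun x _ => (hXi i).differentiable one_ne_zero x) (fun x _ => h1.differentiable one_ne_zero x)

theorem norm_cutField_le {r : ℝ} (hr : 1 ≤ r) (hn : 1 ≤ n) (x : Sp n) :
    ‖cutField n r x‖ ≤ 2 ^ ((n : ℝ) - 1) * (1 + ‖x‖) ^ (-((n : ℝ) - 1)) := by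
  have hn' : (0 : ℝ) ≤ n - 1 := by
    have : (1 : ℝ) ≤ n := by exact_mod_cast hn
    linarith
  rw [cutField, norm_smul, Real.norm_of_nonneg (cutRpow_nonneg _ _ _)]
  rcases le_total ‖x‖ r with h | h
  · rw [cutRpow_eq_zero (by linarith) _ h, zero_mul]
    have := norm_nonneg x
    positivity
  · have h0 : 0 < ‖x‖ := by linarith
    calc _ ≤ ‖x‖ ^ (-(n : ℝ)) * ‖x‖ := by
          gcongr
          exact cutRpow_le _ _ _
      _ = ‖x‖ ^ (-((n : ℝ) - 1)) := by
          rw [← Real.rpow_add_one h0.ne']; congr 1; ring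
      _ ≤ _ := norm_rpow_neg_le hn' (hr.trans h)

/-- This is why |x|^(-a) is p-harmonic: since (a+1)(p-1) = n-1, the flux of its gradient is a
constant multiple of the divergence-free field |x|^(-n) x. -/
theorem pflux_gradient_cutRpow (hp1 : 1 < p) (hpn : p < (n : ℝ)) {r c : ℝ} (hr : 0 < r)
    (hc : 0 ≤ c) {x : Sp n} (hx : 2 * r < ‖x‖) :
    pflux p (c • gradient (cutRpow n r (decayExp n p)) x)
      = (-(c * decayExp n p) ^ (p - 1)) • cutField n r x := by
  have hx0 : 0 < ‖x‖ := by linarith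
  have ha := decayExp_pos hp1 hpn
  set a := decayExp n p with had
  have hca : 0 ≤ c * a := mul_nonneg hc ha.le
  rw [gradient_cutRpow hr a hx, cutField, cutRpow_eq hr n hx.le, pflux]
  simp only [smul_smul]
  have e1 : ‖(c * (-a * ‖x‖ ^ (-a - 2))) • x‖ = (c * a) * ‖x‖ ^ (-a - 1) := by
    have e2 : c * (-a * ‖x‖ ^ (-a - 2)) = -((c * a) * ‖x‖ ^ (-a - 2)) := by ring
    rw [e2, norm_smul, norm_neg, Real.norm_of_nonneg (by positivity), mul_assoc,
      ← Real.rpow_add_one hx0.ne']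
    congr 2; ring
  rw [e1]
  congr 1
  -- The case c a = 0 is apart because (c a)^(p-1) = (c a)^(p-2) (c a) is used for a nonzero base.
  rcases hca.eq_or_lt with h0 | h0
  · have e2 : c * (-a * ‖x‖ ^ (-a - 2)) = -((c * a) * ‖x‖ ^ (-a - 2)) := by ring
    rw [e2, ← h0, Real.zero_rpow (by linarith : p - 1 ≠ 0)]
    simp
  · have e2 : c * (-a * ‖x‖ ^ (-a - 2)) = -((c * a) * ‖x‖ ^ (-a - 2)) := by ring
    rw [e2, Real.mul_rpow hca (by positivity), ← Real.rpow_mul hx0.le]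
    have e3 : (c * a) ^ (p - 1) = (c * a) ^ (p - 2) * (c * a) := by
      rw [← Real.rpow_add_one h0.ne']; congr 1; ring
    have e4 : ‖x‖ ^ (-(n : ℝ)) = ‖x‖ ^ ((-a - 1) * (p - 2)) * ‖x‖ ^ (-a - 2) := by
      rw [← Real.rpow_add hx0]
      congr 1
      have := decayExp_add_one (n := n) hp1
      rw [← had] at this
      linarith
    rw [e3, e4]; ring

theorem norm_gradient_cutRpow_le (hp1 : 1 < p) (hpn : p < (n : ℝ)) {r : ℝ} (hr : 1 ≤ r) {x : Sp n}
    (hx : 2 * r < ‖x‖) : ‖gradient (cutRpow n r (decayExp n p)) x‖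
      ≤ decayExp n p * (2 ^ (decayExp n p + 1) * (1 + ‖x‖) ^ (-(decayExp n p + 1))) := by
  have hx0 : 0 < ‖x‖ := by linarith
  have ha := decayExp_pos hp1 hpn
  rw [gradient_cutRpow (by linarith) _ hx, norm_smul, neg_mul, norm_neg,
    Real.norm_of_nonneg (by positivity), mul_assoc, ← Real.rpow_add_one hx0.ne']
  gcongr
  have := norm_rpow_neg_le (s := decayExp n p + 1) (by linarith) (by linarith : 1 ≤ ‖x‖)
  refine le_trans (le_of_eq ?_) this
  congr 1; ring

/-- The square of the positive part is C¹, unlike the positive part itself, so the comparison can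
use it with the C¹ chain rule. -/
theorem hasDerivAt_max_zero_sq (t : ℝ) : HasDerivAt (fun t : ℝ => max t 0 ^ 2) (2 * max t 0) t := by
  rcases lt_trichotomy t 0 with h | h | h
  · rw [max_eq_right h.le, mul_zero]
    refine (hasDerivAt_const t (0 : ℝ)).congr_of_eventuallyEq ?_
    filter_upwards [gt_mem_nhds h] with s hs
    rw [max_eq_right (le_of_lt hs)]; norm_num
  · subst h
    rw [max_self, mul_zero, hasDerivAt_iff_isLittleO]
    have : (fun x : ℝ => max x 0 ^ 2) =O[𝓝 0] fun x : ℝ => x ^ 2 := by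
      refine Asymptotics.isBigO_of_le _ fun x => ?_
      rw [norm_pow, norm_pow]
      gcongr
      rw [Real.norm_eq_abs, Real.norm_eq_abs, abs_of_nonneg (le_max_right _ _)]
      exact max_le (le_abs_self _) (abs_nonneg _)
    have h2 : (fun x : ℝ => x ^ 2) =o[𝓝 0] fun x : ℝ => x := by
      have := Asymptotics.isLittleO_pow_pow (𝕜 := ℝ) (m := 1) (n := 2) (by norm_num)
      simpa using this
    simpa using this.trans_isLittleO h2
  · rw [max_eq_left h.le]
    have := (hasDerivAt_pow 2 t)
    refine (this.congr_of_eventuallyEq ?_).congr_deriv (by simp)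
    filter_upwards [lt_mem_nhds h] with s hs
    rw [max_eq_left (le_of_lt hs)]

/-- A supersolution lies above the fundamental solution outside a ball if it does so in the ball. -/
theorem BoundedWeak.exterior_lower_bound (hp1 : 1 < p) (hpn : p < (n : ℝ)) {C : ℝ} {u : Sp n → ℝ}
    {G : Sp n → Sp n} (hu : BoundedWeak p C u G) (hs : IsSuper p G) {r ε : ℝ} (hr : 1 ≤ r)
    (hε : 0 ≤ ε) (hball : ∀ᵐ x, ‖x‖ ≤ 4 * r → ε ≤ u x) :
    ∀ᵐ x, 4 * r < ‖x‖ → ε * r ^ decayExp n p * ‖x‖ ^ (-decayExp n p) ≤ u x := by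
  have hr0 : 0 < r := by linarith
  have hp0 : 0 < p := by linarith
  have ha := decayExp_pos hp1 hpn
  set a := decayExp n p with had
  -- The truncated power is at most r^(-a), so with this c the barrier g is at most ε everywhere,
  -- hence below u on the ball of radius 4r.
  set c := ε * r ^ a with hc
  have hc0 : 0 ≤ c := by positivity
  set g : Sp n → ℝ := fun x => c * cutRpow n r a x with hg
  have hg1 : ContDiff ℝ 1 g := contDiff_const.mul (contDiff_cutRpow hr0 a)
  have hgrad : ∀ x, gradient g x = c • gradient (cutRpow n r a) x := by
    intro x
    refine ext_inner_right ℝ fun v => ?_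
    have := (hasGradientAt_of_contDiff (contDiff_cutRpow (n := n) hr0 a) x).const_mul c
    rw [inner_gradient, this.fderiv, real_inner_smul_left, inner_gradient]
    simp
  have hg0 : ∀ x, 0 ≤ g x := fun x => mul_nonneg hc0 (cutRpow_nonneg _ _ _)
  have hgε : ∀ x, g x ≤ ε := by
    intro x
    calc g x ≤ c * r ^ (-a) := by
          simp only [hg]
          gcongr
          exact cutRpow_le_of hr0 ha.le x
      _ = ε := by rw [hc, mul_assoc, ← Real.rpow_add hr0]; simp
  have hgd : ∀ x, g x ≤ c * (2 ^ a * (1 + ‖x‖) ^ (-a)) := by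
    intro x
    simp only [hg]
    gcongr
    rcases le_total ‖x‖ r with h | h
    · rw [cutRpow_eq_zero hr0 _ h]
      have := norm_nonneg x
      positivity
    · exact (cutRpow_le _ _ _).trans (norm_rpow_neg_le ha.le (hr.trans h))
  -- The test function measures where the barrier exceeds u. It vanishes on the ball of radius 4r,
  -- so the truncation of g near the origin is never seen.
  set w : Sp n → ℝ := fun x => max (g x - u x) 0 ^ 2 with hw
  set W : Sp n → Sp n := fun x => (2 * max (g x - u x) 0) • (gradient g x - G x) with hW
  have hum : AEStronglyMeasurable u := hu.weak.1.aestronglyMeasurable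
  have hdm : AEStronglyMeasurable (fun x => max (g x - u x) 0) :=
    (continuous_id.max continuous_const).comp_aestronglyMeasurable
      (hg1.continuous.aestronglyMeasurable.sub hum)
  have hmax : ∀ᵐ x, max (g x - u x) 0 ≤ g x := by
    filter_upwards [hu.nonneg] with x hx using max_le (by linarith) (hg0 x)
  have hin : ∀ᵐ x, ‖x‖ ≤ 4 * r → max (g x - u x) 0 = 0 := by
    filter_upwards [hball] with x hx h
    exact max_eq_right (by linarith [hx h, hgε x])
  have hwle : ∀ᵐ x, w x ≤ ε * g x := by
    filter_upwards [hmax] with x hx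
    have := le_max_right (g x - u x) 0
    calc w x = max (g x - u x) 0 * max (g x - u x) 0 := sq _
      _ ≤ ε * g x := by
          gcongr
          exact hx.trans (hgε x)
  have hw0 : ∀ x, 0 ≤ w x := fun x => sq_nonneg _
  have hwm : MemLp w (ENNReal.ofReal (critExp n p)) := by
    have hq : 0 < critExp n p := by linarith [one_lt_critExp hp1 hpn]
    refine (((memLp_one_add_norm_rpow hq (lt_decayExp_mul_critExp hp1 hpn)).const_mul
      (2 ^ a)).const_mul (ε * c)).mono (hdm.pow 2) ?_
    filter_upwards [hwle] with x hx
    rw [Real.norm_of_nonneg (hw0 x)]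
    refine le_trans ?_ (le_abs_self _)
    calc w x ≤ ε * (c * (2 ^ a * (1 + ‖x‖) ^ (-a))) := hx.trans (by gcongr; exact hgd x)
      _ = _ := by ring
  have hWm : MemLp W (ENNReal.ofReal p) := by
    have hD : MemLp (fun x : Sp n => (2 * ε) * (c * (a * (2 ^ (a + 1) * (1 + ‖x‖) ^ (-(a + 1)))) + ‖G x‖))
        (ENNReal.ofReal p) :=
      (((((memLp_one_add_norm_rpow hp0 (lt_decayExp_add_one_mul hp1 hpn)).const_mul _).const_mul
        _).const_mul _).add hu.memLp.norm).const_mul _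
    refine hD.mono ((hdm.const_mul 2).smul
      ((continuous_gradient hg1).aestronglyMeasurable.sub hu.memLp.1)) ?_
    filter_upwards [hin, hmax] with x hx1 hx2
    refine le_trans ?_ (le_abs_self _)
    have hnx := norm_nonneg x
    rcases le_or_gt ‖x‖ (4 * r) with h | h
    · simp only [hW, hx1 h, mul_zero, zero_smul, norm_zero]
      positivity
    · have h3 := le_max_right (g x - u x) 0
      simp only [hW]
      rw [norm_smul, Real.norm_of_nonneg (by positivity)]
      have h4 : ‖gradient g x - G x‖ ≤ c * (a * (2 ^ (a + 1) * (1 + ‖x‖) ^ (-(a + 1)))) + ‖G x‖ := by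
        refine (norm_sub_le _ _).trans (add_le_add ?_ le_rfl)
        rw [hgrad, norm_smul, Real.norm_of_nonneg hc0]
        gcongr
        exact norm_gradient_cutRpow_le hp1 hpn hr (by linarith)
      gcongr
      exact hx2.trans (hgε x)
  have hpair : SobolevPair p w W := by
    refine SobolevPair.of_cutoff hp1 hpn hwm hWm (M := ε * c) (by positivity) ?_ ?_
    · filter_upwards [hwle] with x hx h1
      rw [abs_of_nonneg (hw0 x)]
      refine hx.trans ?_
      rw [mul_assoc]
      refine mul_le_mul_of_nonneg_left (mul_le_mul_of_nonneg_left (cutRpow_le _ _ _) hc0) hε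
    · intro R hR
      have hR0 : 0 < R := by linarith
      have := hu.sobolevPair_mul_sub hp1 hpn (cutoff_contDiff R) (cutoff_hasCompactSupport hR0) hg1
        (V := Set.univ) (fun _ _ _ => Set.mem_univ _) (fun t _ => hasDerivAt_max_zero_sq t)
        (by fun_prop)
      refine (congrArg (SobolevPair p _) ?_).mp this
      ext1 x
      simp only [hW, smul_smul, hw]
  have i1 := hs w W hpair (ae_of_all _ hw0)
  have hpc : p.HolderConjugate (p / (p - 1)) := Real.HolderConjugate.conjExponent hp1
  have hqc := Real.HolderConjugate.conjExponent (one_lt_critExp hp1 hpn)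
  have hn1 : (1 : ℝ) < n := by linarith
  have hXm : MemLp (cutField n r) (ENNReal.ofReal (p / (p - 1))) := by
    have h1 : (n : ℝ) < (n - 1) * (p / (p - 1)) := by
      rw [← mul_div_assoc, lt_div_iff₀ (by linarith)]; nlinarith
    refine ((memLp_one_add_norm_rpow hpc.symm.pos h1).const_mul (2 ^ ((n : ℝ) - 1))).mono
      (contDiff_cutField hr0).continuous.aestronglyMeasurable (ae_of_all _ fun x => ?_)
    exact (norm_cutField_le hr (by exact_mod_cast hn1.le) x).trans (le_abs_self _)
  obtain ⟨b, hbc, hb0, hbφ⟩ := exists_weakDiv_cutField (n := n) hr0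
  have hbs : HasCompactSupport b := by
    refine HasCompactSupport.intro (isCompact_closedBall (0 : Sp n) (2 * r)) fun x hx => ?_
    rw [mem_closedBall_zero_iff, not_le] at hx
    exact hb0 x hx
  have i2 := hpair.integral_eq hpc hqc hXm (hbc.memLp_of_hasCompactSupport hbs) hbφ
  -- The divergence b lives in |x| ≤ 2r and w vanishes for |x| ≤ 4r. Hence the flux of the barrier
  -- integrates to zero against W.
  have i3 : ∫ x, b x * w x = 0 := by
    refine integral_eq_zero_of_ae ?_
    filter_upwards [hin] with x hx
    rcases le_or_gt ‖x‖ (4 * r) with h | h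
    · simp [hw, hx h]
    · simp [hb0 x (by linarith)]
  rw [i3] at i2
  set κ : ℝ := -(c * a) ^ (p - 1) with hκ
  have I1 := integrable_inner_of_memLp hpc (memLp_pflux hp1 hpc hu.memLp) hWm
  have I2 := integrable_inner_of_memLp hpc hXm hWm
  have hpt : ∀ᵐ x, κ * inner ℝ (cutField n r x) (W x) - inner ℝ (pflux p (G x)) (W x)
      = (2 * max (g x - u x) 0) *
        inner ℝ (pflux p (gradient g x) - pflux p (G x)) (gradient g x - G x) := by
    filter_upwards [hin] with x hx
    rcases le_or_gt ‖x‖ (4 * r) with h | h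
    · simp [hW, hx h]
    · rw [hgrad, pflux_gradient_cutRpow hp1 hpn hr0 hc0 (by linarith), ← hgrad]
      simp only [hW, real_inner_smul_right, inner_sub_left, real_inner_smul_left]
      ring
  have hnn : ∀ᵐ x, 0 ≤ κ * inner ℝ (cutField n r x) (W x) - inner ℝ (pflux p (G x)) (W x) := by
    filter_upwards [hpt] with x hx
    rw [hx]
    have := le_max_right (g x - u x) 0
    exact mul_nonneg (by positivity) (pflux_monotone_nonneg hp1 _ _)
  -- The integrand is nonnegative by monotonicity, while its integral is at most zero: the barrier
  -- contributes 0 and the supersolution term enters with a minus sign.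
  have hint : ∫ x, (κ * inner ℝ (cutField n r x) (W x) - inner ℝ (pflux p (G x)) (W x)) = 0 := by
    refine le_antisymm ?_ (integral_nonneg_of_ae hnn)
    rw [integral_sub (I2.const_mul κ) I1, integral_const_mul, i2]
    linarith
  have hz := (integral_eq_zero_iff_of_nonneg_ae hnn ((I2.const_mul κ).sub I1)).1 hint
  have hW0 : W =ᵐ[volume] 0 := by
    filter_upwards [hz, hpt] with x h1 h2
    rw [h2, Pi.zero_apply] at h1
    rcases mul_eq_zero.1 h1 with h3 | h3
    · simp [hW, h3]
    · simp [hW, eq_of_pflux_inner_eq_zero hp1 h3]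
  -- W = 0 almost everywhere, so the Sobolev inequality forces w = 0, that is, g ≤ u.
  have hsob := hpair.eLpNorm_le hp1 hpn
  rw [eLpNorm_congr_ae hW0, eLpNorm_zero, mul_zero, nonpos_iff_eq_zero,
    eLpNorm_eq_zero_iff hwm.1 (by simpa using (by linarith [one_lt_critExp hp1 hpn] : 0 < critExp n p))] at hsob
  filter_upwards [hsob] with x hx h
  have h1 : max (g x - u x) 0 = 0 := by simpa [hw] using hx
  have h2 := le_max_left (g x - u x) 0
  rw [h1] at h2
  simp only [hg, cutRpow_eq hr0 a (by linarith : 2 * r ≤ ‖x‖)] at h2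
  linarith

/-! ### The logarithmic energy estimate -/

theorem add_rpow_le_two_rpow_mul {x y p : ℝ} (hx : 0 ≤ x) (hy : 0 ≤ y) (hp : 0 ≤ p) :
    (x + y) ^ p ≤ 2 ^ p * (x ^ p + y ^ p) := by
  have hX := Real.rpow_nonneg hx p
  have hY := Real.rpow_nonneg hy p
  have h2 : (0 : ℝ) ≤ 2 ^ p := by positivity
  rcases le_total x y with h | h
  · calc (x + y) ^ p ≤ (2 * y) ^ p := Real.rpow_le_rpow (by positivity) (by linarith) hp
      _ = 2 ^ p * y ^ p := Real.mul_rpow (by norm_num) hy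
      _ ≤ _ := by gcongr; linarith
  · calc (x + y) ^ p ≤ (2 * x) ^ p := Real.rpow_le_rpow (by positivity) (by linarith) hp
      _ = 2 ^ p * x ^ p := Real.mul_rpow (by norm_num) hx
      _ ≤ _ := by gcongr; linarith

/-- Smooth compactly supported cutoff functions with values in `[0, 1]` and gradient bounded
by `L`. -/
structure IsCutoff (L : ℝ) (ζ : Sp n → ℝ) : Prop where
  contDiff : ContDiff ℝ 1 ζ
  compact : HasCompactSupport ζ
  nonneg : ∀ x, 0 ≤ ζ x
  le_one : ∀ x, ζ x ≤ 1
  grad : ∀ x, ‖gradient ζ x‖ ≤ L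

section
variable {L : ℝ} {ζ : Sp n → ℝ} {m : ℝ}

theorem IsCutoff.contDiff_rpow (h : IsCutoff L ζ) (hm : 1 ≤ m) :
    ContDiff ℝ 1 (fun x => ζ x ^ m) := by
  exact_mod_cast ContDiff.rpow_const_of_le (m := 1) (by exact_mod_cast h.contDiff)
    (by exact_mod_cast hm)

theorem IsCutoff.compact_rpow (h : IsCutoff L ζ) (hm : 0 < m) :
    HasCompactSupport (fun x => ζ x ^ m) :=
  h.compact.comp_left (g := fun t : ℝ => t ^ m) (Real.zero_rpow hm.ne')

theorem IsCutoff.gradient_rpow (h : IsCutoff L ζ) (hm : 1 ≤ m) (x : Sp n) :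
    gradient (fun x => ζ x ^ m) x = (m * ζ x ^ (m - 1)) • gradient ζ x := by
  refine ext_inner_right ℝ fun v => ?_
  rw [inner_gradient, real_inner_smul_left, inner_gradient,
    ((hasGradientAt_of_contDiff h.contDiff x).rpow_const (Or.inr hm)).fderiv]
  simp

theorem IsCutoff.norm_gradient_rpow_le (h : IsCutoff L ζ) (hm : 1 ≤ m) (x : Sp n) :
    ‖gradient (fun x => ζ x ^ m) x‖ ≤ m * L * ζ x ^ (m - 1) := by
  have h0 : 0 ≤ m * ζ x ^ (m - 1) := mul_nonneg (by linarith) (Real.rpow_nonneg (h.nonneg x) _)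
  rw [h.gradient_rpow hm, norm_smul, Real.norm_of_nonneg h0]
  calc _ ≤ m * ζ x ^ (m - 1) * L := by gcongr; exact h.grad x
    _ = _ := by ring

theorem IsCutoff.rpow_mem (h : IsCutoff L ζ) (hm : 0 ≤ m) (x : Sp n) :
    0 ≤ ζ x ^ m ∧ ζ x ^ m ≤ 1 :=
  ⟨Real.rpow_nonneg (h.nonneg x) _, Real.rpow_le_one (h.nonneg x) (h.le_one x) hm⟩

theorem IsCutoff.continuous_rpow (h : IsCutoff L ζ) (hm : 0 ≤ m) :
    Continuous (fun x => ζ x ^ m) :=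
  h.contDiff.continuous.rpow_const fun _ => Or.inr hm

theorem IsCutoff.bound_nonneg (h : IsCutoff L ζ) : 0 ≤ L := (norm_nonneg _).trans (h.grad 0)

end

/-- `1 + log ((C + 1) / (t + δ))`. -/
noncomputable def logTrans (C δ t : ℝ) : ℝ := 1 + Real.log ((C + 1) / (t + δ))

section
variable {C δ t : ℝ}

/-- Since t + δ ≤ C + 1, the logarithm is nonnegative. The lower bound 1 makes real powers of the
transform smooth and increasing in the exponent. -/
theorem one_le_logTrans (hδ0 : 0 < δ) (hδ1 : δ ≤ 1) (ht : t ∈ Set.Icc 0 C) :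
    1 ≤ logTrans C δ t := by
  have : 0 ≤ Real.log ((C + 1) / (t + δ)) := by
    refine Real.log_nonneg ((one_le_div (by linarith [ht.1])).2 (by linarith [ht.2]))
  unfold logTrans; linarith

theorem hasDerivAt_logTrans (hδ0 : 0 < δ) (ht : t ∈ Set.Icc 0 C) :
    HasDerivAt (logTrans C δ) (-(t + δ)⁻¹) t := by
  have h1 : 0 < t + δ := by linarith [ht.1]
  have h2 : 0 < C + 1 := by linarith [ht.1, ht.2]
  have h3 : HasDerivAt (fun s => 1 + (Real.log (C + 1) - Real.log (s + δ))) (-(t + δ)⁻¹) t := by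
    have := (((hasDerivAt_id t).add_const δ).log h1.ne').const_sub (Real.log (C + 1))
    refine (this.const_add 1).congr_deriv ?_
    simp
  refine h3.congr_of_eventuallyEq ?_
  filter_upwards [lt_mem_nhds (show -δ < t by linarith [ht.1])] with s hs
  rw [logTrans, Real.log_div h2.ne' (by linarith)]

theorem continuousOn_logTrans (hδ0 : 0 < δ) : ContinuousOn (logTrans C δ) (Set.Icc 0 C) :=
  fun _ ht => (hasDerivAt_logTrans hδ0 ht).continuousAt.continuousWithinAt

theorem hasDerivAt_logTrans_rpow (hδ0 : 0 < δ) (hδ1 : δ ≤ 1) (q : ℝ) (ht : t ∈ Set.Icc 0 C) :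
    HasDerivAt (fun s => logTrans C δ s ^ q) (-(q * logTrans C δ t ^ (q - 1) * (t + δ)⁻¹)) t := by
  have := one_le_logTrans hδ0 hδ1 ht
  refine ((hasDerivAt_logTrans hδ0 ht).rpow_const (p := q) (Or.inl (by linarith))).congr_deriv ?_
  ring

theorem continuousOn_logTrans_rpow (hδ0 : 0 < δ) (hδ1 : δ ≤ 1) (q : ℝ) :
    ContinuousOn (fun s => logTrans C δ s ^ q) (Set.Icc 0 C) :=
  fun _ ht => (hasDerivAt_logTrans_rpow hδ0 hδ1 q ht).continuousAt.continuousWithinAt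

theorem continuousOn_inv_add (hδ0 : 0 < δ) : ContinuousOn (fun s => (s + δ)⁻¹) (Set.Icc 0 C) :=
  (continuousOn_id.add continuousOn_const).inv₀ fun t ht => by
    have : 0 < t + δ := by linarith [ht.1]
    exact this.ne'

end

/-- F is only continuous on [0, C]; it may be replaced by its constant extension beyond the
endpoints. If C < 0 the bounds on u are contradictory, so every property holds almost everywhere. -/
theorem BoundedWeak.aestronglyMeasurable_comp {C : ℝ} {u : Sp n → ℝ} {G : Sp n → Sp n}
    (hu : BoundedWeak p C u G) {F : ℝ → ℝ} (hF : ContinuousOn F (Set.Icc 0 C)) :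
    AEStronglyMeasurable (fun x => F (u x)) := by
  have hum : AEStronglyMeasurable u := hu.weak.1.aestronglyMeasurable
  rcases lt_or_ge C 0 with hC | hC
  · have : ∀ᵐ x : Sp n, False := by
      filter_upwards [hu.nonneg, hu.le] with x h1 h2; linarith
    exact aestronglyMeasurable_zero.congr (this.mono fun x h => h.elim)
  · have hc : Continuous (Set.IccExtend hC ((Set.Icc 0 C).domRestrict F)) :=
      hF.domRestrict.Icc_extend'
    refine (hc.comp_aestronglyMeasurable hum).congr ?_
    filter_upwards [hu.nonneg, hu.le] with x h1 h2
    exact Set.IccExtend_of_mem hC _ ⟨h1, h2⟩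

section
variable {C δ L : ℝ} {u : Sp n → ℝ} {G : Sp n → Sp n} {ζ : Sp n → ℝ}

theorem integrable_logTrans_rpow_mul (hu : BoundedWeak p C u G) (hζ : IsCutoff L ζ) (hδ0 : 0 < δ)
    (hδ1 : δ ≤ 1) (q : ℝ) {m : ℝ} (hm : 0 < m) :
    Integrable (fun x => logTrans C δ (u x) ^ q * ζ x ^ m) := by
  have hc := continuousOn_logTrans_rpow (C := C) hδ0 hδ1 q
  obtain ⟨B, hB⟩ := isCompact_Icc.exists_bound_of_continuousOn hc
  refine Integrable.bdd_mul (c := B) ((hζ.continuous_rpow hm.le).integrable_of_hasCompactSupport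
    (hζ.compact_rpow hm)) (hu.aestronglyMeasurable_comp hc) ?_
  filter_upwards [hu.nonneg, hu.le] with x h1 h2 using hB _ ⟨h1, h2⟩

theorem integrable_logTrans_rpow_mul_grad (hp1 : 1 < p) (hu : BoundedWeak p C u G)
    (hζ : IsCutoff L ζ) (hδ0 : 0 < δ)
    (hδ1 : δ ≤ 1) (q : ℝ) {m : ℝ} (hm : 0 < m) :
    Integrable (fun x => logTrans C δ (u x) ^ q * (‖G x‖ * (u x + δ)⁻¹) ^ p * ζ x ^ m) := by
  have hp0 : 0 < p := by linarith
  have hc : ContinuousOn (fun s => logTrans C δ s ^ q * ((s + δ)⁻¹) ^ p) (Set.Icc 0 C) :=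
    (continuousOn_logTrans_rpow hδ0 hδ1 q).mul
      ((continuousOn_inv_add hδ0).rpow_const fun _ _ => Or.inr hp0.le)
  obtain ⟨B, hB⟩ := isCompact_Icc.exists_bound_of_continuousOn hc
  have hG := hu.memLp.integrable_norm_rpow (by simpa using hp0) ENNReal.ofReal_ne_top
  rw [ENNReal.toReal_ofReal hp0.le] at hG
  have h1 : Integrable (fun x => ζ x ^ m * ‖G x‖ ^ p) := by
    refine hG.bdd_mul (c := 1) (hζ.continuous_rpow hm.le).aestronglyMeasurable
      (ae_of_all _ fun x => ?_)
    rw [Real.norm_of_nonneg (hζ.rpow_mem hm.le x).1]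
    exact (hζ.rpow_mem hm.le x).2
  have h2 := h1.bdd_mul (c := B) (hu.aestronglyMeasurable_comp hc) (by
    filter_upwards [hu.nonneg, hu.le] with x h1 h2 using hB _ ⟨h1, h2⟩)
  refine h2.congr ?_
  filter_upwards [hu.nonneg] with x hx
  have : 0 ≤ (u x + δ)⁻¹ := inv_nonneg.2 (by linarith)
  rw [Real.mul_rpow (norm_nonneg _) this]
  ring

/-- Energy estimate for the logarithm of a supersolution. -/
theorem energy_estimate (hp1 : 1 < p) (hpn : p < (n : ℝ)) (hu : BoundedWeak p C u G)
    (hs : IsSuper p G) (hζ : IsCutoff L ζ) (hδ0 : 0 < δ) (hδ1 : δ ≤ 1) {q m : ℝ} (hq : 0 ≤ q)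
    (hm : p < m) :
    ∫ x, logTrans C δ (u x) ^ q * (‖G x‖ * (u x + δ)⁻¹) ^ p * ζ x ^ m
      ≤ (m * L) ^ p / (p - 1) ^ 2 * ∫ x, logTrans C δ (u x) ^ q * ζ x ^ (m - p) := by
  have hp0 : 0 < p := by linarith
  have hL := hζ.bound_nonneg
  have hm1 : 1 ≤ m := by linarith
  have hmp : 0 < m - p := by linarith
  -- The test function is ζ^m F(u). The power 1 - p makes the flux of G scale like that of ∇ log(u +
  -- δ). Both terms of F' are nonpositive; the one from differentiating v^q is discarded, which uses
  -- q ≥ 0.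
  set F : ℝ → ℝ := fun t => logTrans C δ t ^ q * (t + δ) ^ (1 - p) with hF
  set F' : ℝ → ℝ := fun t => -(q * logTrans C δ t ^ (q - 1) * (t + δ)⁻¹) * (t + δ) ^ (1 - p)
    + logTrans C δ t ^ q * ((1 - p) * (t + δ) ^ (-p)) with hF'
  have hpos : ∀ t ∈ Set.Icc 0 C, 0 < t + δ := fun t ht => by linarith [ht.1]
  have hFd : ∀ t ∈ Set.Icc 0 C, HasDerivAt F (F' t) t := by
    intro t ht
    have h1 : HasDerivAt (fun s => (s + δ) ^ (1 - p)) ((1 - p) * (t + δ) ^ (-p)) t := by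
      refine (((hasDerivAt_id t).add_const δ).rpow_const (p := 1 - p)
        (Or.inl (hpos t ht).ne')).congr_deriv ?_
      simp
    exact (hasDerivAt_logTrans_rpow hδ0 hδ1 q ht).mul h1
  have hcr : ∀ r : ℝ, ContinuousOn (fun s => (s + δ) ^ r) (Set.Icc 0 C) := fun r =>
    (continuousOn_id.add continuousOn_const).rpow_const fun t ht => Or.inl (hpos t ht).ne'
  have hF'c : ContinuousOn F' (Set.Icc 0 C) :=
    ((((continuousOn_const.mul (continuousOn_logTrans_rpow hδ0 hδ1 _)).mul
      (continuousOn_inv_add hδ0)).neg).mul (hcr _)).add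
      ((continuousOn_logTrans_rpow hδ0 hδ1 _).mul (continuousOn_const.mul (hcr _)))
  have hpair := hu.sobolevPair_mul hp1 hpn (hζ.contDiff_rpow hm1) (hζ.compact_rpow (by linarith))
    hFd hF'c
  have hpc := Real.HolderConjugate.conjExponent hp1
  have hI := integrable_inner_of_memLp hpc (memLp_pflux hp1 hpc hu.memLp) hpair.2.1
  have h0 := hs _ _ hpair (by
    filter_upwards [hu.nonneg, hu.le] with x h1 h2
    have := one_le_logTrans hδ0 hδ1 ⟨h1, h2⟩
    have h3 := (hpos _ ⟨h1, h2⟩)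
    exact mul_nonneg (hζ.rpow_mem (by linarith) x).1
      (mul_nonneg (Real.rpow_nonneg (by linarith) _) (Real.rpow_nonneg h3.le _)))
  have J1 := integrable_logTrans_rpow_mul_grad hp1 hu hζ hδ0 hδ1 q (by linarith : 0 < m)
  have J2 := integrable_logTrans_rpow_mul hu hζ hδ0 hδ1 q hmp
  have key : ∀ᵐ x, inner ℝ (pflux p (G x)) (F (u x) • gradient (fun x => ζ x ^ m) x +
        (ζ x ^ m * F' (u x)) • G x) ≤
      (m * L) ^ p / p * (logTrans C δ (u x) ^ q * ζ x ^ (m - p)) - (p - 1) ^ 2 / p *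
        (logTrans C δ (u x) ^ q * (‖G x‖ * (u x + δ)⁻¹) ^ p * ζ x ^ m) := by
    filter_upwards [hu.nonneg, hu.le] with x h1 h2
    have hmem : u x ∈ Set.Icc 0 C := ⟨h1, h2⟩
    have hv := one_le_logTrans hδ0 hδ1 hmem
    set v := logTrans C δ (u x) with hvd
    have hd := hpos _ hmem
    set d := u x + δ with hdd
    set g := ‖G x‖ * d⁻¹ with hg
    have hg0 : 0 ≤ g := by positivity
    have hz0 := hζ.nonneg x
    have hvq : 0 ≤ v ^ q := Real.rpow_nonneg (by linarith) _
    have hGg : ‖G x‖ = g * d := by rw [hg]; field_simp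
    have a1 : inner ℝ (pflux p (G x)) (gradient (fun x => ζ x ^ m) x)
        ≤ ‖G x‖ ^ (p - 1) * (m * L * ζ x ^ (m - 1)) :=
      (inner_pflux_le hp1 _ _).trans (by gcongr; exact hζ.norm_gradient_rpow_le hm1 x)
    have a2 : F (u x) * ‖G x‖ ^ (p - 1) = v ^ q * g ^ (p - 1) := by
      have hcan : d ^ (1 - p) * d ^ (p - 1) = 1 := by rw [← Real.rpow_add hd]; simp
      calc F (u x) * ‖G x‖ ^ (p - 1) = v ^ q * g ^ (p - 1) * (d ^ (1 - p) * d ^ (p - 1)) := by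
            rw [hGg, Real.mul_rpow hg0 hd.le]; simp only [hF]; ring
        _ = _ := by rw [hcan, mul_one]
    have a3 : F' (u x) * ‖G x‖ ^ p ≤ -((p - 1) * (v ^ q * g ^ p)) := by
      have hcan : d ^ (-p) * d ^ p = 1 := by rw [← Real.rpow_add hd]; simp
      have b1 : F' (u x) ≤ v ^ q * ((1 - p) * d ^ (-p)) := by
        simp only [hF']
        have : 0 ≤ q * v ^ (q - 1) * d⁻¹ * d ^ (1 - p) := by positivity
        linarith
      calc F' (u x) * ‖G x‖ ^ p ≤ v ^ q * ((1 - p) * d ^ (-p)) * ‖G x‖ ^ p := by gcongr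
        _ = -((p - 1) * (v ^ q * g ^ p)) * (d ^ (-p) * d ^ p) := by
            rw [hGg, Real.mul_rpow hg0 hd.le]; ring
        _ = _ := by rw [hcan, mul_one]
    -- Young's inequality with ζ^(m-1) split as ζ^(m(p-1)/p) ζ^((m-p)/p). The gradient term has
    -- coefficient (p-1)/p, smaller than the p-1 available on the good side; the difference is
    -- (p-1)²/p.
    have young : g ^ (p - 1) * (m * L * ζ x ^ (m - 1))
        ≤ (p - 1) / p * (g ^ p * ζ x ^ m) + (m * L) ^ p / p * ζ x ^ (m - p) := by
      have hpc' : (p / (p - 1)).HolderConjugate p := hpc.symm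
      have y := Real.young_inequality_of_nonneg (a := g ^ (p - 1) * ζ x ^ (m * (p - 1) / p))
        (b := m * L * ζ x ^ ((m - p) / p)) (by positivity)
        (mul_nonneg (mul_nonneg (by linarith) hL) (Real.rpow_nonneg hz0 _)) hpc'
      have c1 : (g ^ (p - 1) * ζ x ^ (m * (p - 1) / p)) ^ (p / (p - 1)) = g ^ p * ζ x ^ m := by
        have hp1' : p - 1 ≠ 0 := by linarith
        rw [Real.mul_rpow (by positivity) (by positivity), ← Real.rpow_mul hg0,
          ← Real.rpow_mul hz0]
        congr 2 <;> field_simp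
      have c2 : (m * L * ζ x ^ ((m - p) / p)) ^ p = (m * L) ^ p * ζ x ^ (m - p) := by
        rw [Real.mul_rpow (mul_nonneg (by linarith) hL) (by positivity), ← Real.rpow_mul hz0]
        congr 2; field_simp
      have c3 : ζ x ^ (m * (p - 1) / p) * ζ x ^ ((m - p) / p) = ζ x ^ (m - 1) := by
        have e1 : 0 ≤ m * (p - 1) / p := by
          have : 0 < p - 1 := by linarith
          positivity
        rw [← Real.rpow_add_of_nonneg hz0 e1 (by positivity)]
        congr 1; field_simp; ring
      rw [c1, c2] at y
      calc _ = g ^ (p - 1) * ζ x ^ (m * (p - 1) / p) * (m * L * ζ x ^ ((m - p) / p)) := by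
            rw [← c3]; ring
        _ ≤ _ := y
        _ = _ := by field_simp
    have hF0 : 0 ≤ F (u x) := mul_nonneg hvq (Real.rpow_nonneg hd.le _)
    rw [inner_add_right, real_inner_smul_right, real_inner_smul_right, inner_pflux_self hp1]
    have hzm := (hζ.rpow_mem (by linarith : 0 ≤ m) x).1
    calc F (u x) * inner ℝ (pflux p (G x)) (gradient (fun x => ζ x ^ m) x)
          + ζ x ^ m * F' (u x) * ‖G x‖ ^ p
        ≤ F (u x) * (‖G x‖ ^ (p - 1) * (m * L * ζ x ^ (m - 1)))
          + ζ x ^ m * (-((p - 1) * (v ^ q * g ^ p))) := by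
          rw [mul_assoc (ζ x ^ m)]
          gcongr
      _ = v ^ q * (g ^ (p - 1) * (m * L * ζ x ^ (m - 1)))
          - (p - 1) * (v ^ q * g ^ p * ζ x ^ m) := by
          rw [← mul_assoc, a2]; ring
      _ ≤ v ^ q * ((p - 1) / p * (g ^ p * ζ x ^ m) + (m * L) ^ p / p * ζ x ^ (m - p))
          - (p - 1) * (v ^ q * g ^ p * ζ x ^ m) := by gcongr
      _ = _ := by field_simp; ring
  have hle := h0.trans (integral_mono_ae hI ((J2.const_mul _).sub (J1.const_mul _)) key)
  simp only [Pi.sub_apply] at hle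
  rw [integral_sub (J2.const_mul _) (J1.const_mul _), integral_const_mul, integral_const_mul] at hle
  have hpp : 0 < (p - 1) ^ 2 := by
    have : 0 < p - 1 := by linarith
    positivity
  have alg : ∀ I J c : ℝ, 0 ≤ c / p * J - (p - 1) ^ 2 / p * I → I ≤ c / (p - 1) ^ 2 * J := by
    intro I J c h
    rw [div_mul_eq_mul_div, le_div_iff₀ hpp]
    have h4 := mul_le_mul_of_nonneg_left (sub_nonneg.1 h) hp0.le
    field_simp at h4
    linarith
  exact alg _ _ _ hle

end

/-! ### Moser iteration for the logarithm -/

theorem eLpNorm_ofReal_eq {F : Type*} [NormedAddCommGroup F] {q : ℝ} (hq : 0 < q) {f : Sp n → F}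
    (hf : MemLp f (ENNReal.ofReal q)) :
    eLpNorm f (ENNReal.ofReal q) = ENNReal.ofReal ((∫ x, ‖f x‖ ^ q) ^ q⁻¹) := by
  have := hf.eLpNorm_eq_integral_rpow_norm (by simpa using hq) ENNReal.ofReal_ne_top
  rwa [ENNReal.toReal_ofReal hq.le] at this

theorem integrable_norm_rpow_ofReal {F : Type*} [NormedAddCommGroup F] {q : ℝ} (hq : 0 < q)
    {f : Sp n → F} (hf : MemLp f (ENNReal.ofReal q)) : Integrable (fun x => ‖f x‖ ^ q) := by
  have := hf.integrable_norm_rpow (by simpa using hq) ENNReal.ofReal_ne_top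
  rwa [ENNReal.toReal_ofReal hq.le] at this

theorem SobolevPair.integral_le (hp1 : 1 < p) (hpn : p < (n : ℝ)) {w : Sp n → ℝ} {W : Sp n → Sp n}
    (h : SobolevPair p w W) :
    ∫ x, |w x| ^ critExp n p ≤ ((sobolevConst n p : ℝ) ^ p * ∫ x, ‖W x‖ ^ p) ^ (critExp n p / p) := by
  have hp0 : 0 < p := by linarith
  have hq0 : 0 < critExp n p := by linarith [one_lt_critExp hp1 hpn]
  have h1 := h.eLpNorm_le hp1 hpn
  have hI : 0 ≤ ∫ x, ‖W x‖ ^ p := integral_nonneg fun x => by positivity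
  have hJ : 0 ≤ ∫ x, |w x| ^ critExp n p := integral_nonneg fun x => by positivity
  rw [eLpNorm_ofReal_eq hp0 h.2.1, eLpNorm_ofReal_eq hq0 h.1, ← ENNReal.ofReal_coe_nnreal,
    ← ENNReal.ofReal_mul (NNReal.coe_nonneg _),
    ENNReal.ofReal_le_ofReal_iff (by positivity)] at h1
  simp only [Real.norm_eq_abs] at h1
  have h2 := Real.rpow_le_rpow (by positivity) h1 hq0.le
  rw [← Real.rpow_mul hJ, inv_mul_cancel₀ hq0.ne', Real.rpow_one] at h2
  refine h2.trans (le_of_eq ?_)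
  rw [Real.mul_rpow (by positivity) (by positivity), Real.mul_rpow (by positivity) hI,
    ← Real.rpow_mul hI, ← Real.rpow_mul (NNReal.coe_nonneg _)]
  congr 2 <;> field_simp

section
variable {C δ L : ℝ} {u : Sp n → ℝ} {G : Sp n → Sp n} {ζ : Sp n → ℝ}

/-- The constant in one step of the Moser iteration. -/
noncomputable def moserConst (n : ℕ) (p L : ℝ) : ℝ :=
  (sobolevConst n p : ℝ) ^ p * ((2 * L) ^ p * (1 + 1 / (p - 1) ^ 2))

theorem moserConst_nonneg {L : ℝ} (hL : 0 ≤ L) : 0 ≤ moserConst n p L := by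
  unfold moserConst; positivity

/-- Apply the Sobolev inequality to ζ^s v^(t/p), where v is the logarithmic transform. The part of
the gradient with G is controlled by the energy estimate with q = t - p, whence the condition p ≤ t;
since v ≥ 1, the resulting v^(t-p) is at most v^t. -/
theorem moser_step (hp1 : 1 < p) (hpn : p < (n : ℝ)) (hu : BoundedWeak p C u G)
    (hsup : IsSuper p G) (hζ : IsCutoff L ζ) (hδ0 : 0 < δ) (hδ1 : δ ≤ 1) {t s : ℝ} (ht : p ≤ t)
    (hs : 1 < s) :
    ∫ x, logTrans C δ (u x) ^ (t * (critExp n p / p)) * ζ x ^ (s * critExp n p)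
      ≤ (moserConst n p L * (s * t) ^ p *
        ∫ x, logTrans C δ (u x) ^ t * ζ x ^ ((s - 1) * p)) ^ (critExp n p / p) := by
  have hp0 : 0 < p := by linarith
  have hL := hζ.bound_nonneg
  have hq0 : 0 < critExp n p := by linarith [one_lt_critExp hp1 hpn]
  have hsp : 0 < (s - 1) * p := mul_pos (by linarith) hp0
  have hmem : ∀ᵐ x, u x ∈ Set.Icc 0 C := by
    filter_upwards [hu.nonneg, hu.le] with x h1 h2 using ⟨h1, h2⟩
  have hpair := hu.sobolevPair_mul hp1 hpn (hζ.contDiff_rpow hs.le) (hζ.compact_rpow (by linarith))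
    (fun t' ht' => hasDerivAt_logTrans_rpow hδ0 hδ1 (t / p) ht')
    (((continuousOn_const.mul (continuousOn_logTrans_rpow hδ0 hδ1 _)).mul
      (continuousOn_inv_add hδ0)).neg)
  have hsob := hpair.integral_le hp1 hpn
  set Φ := ∫ x, logTrans C δ (u x) ^ t * ζ x ^ ((s - 1) * p) with hΦ
  have J1 := integrable_logTrans_rpow_mul hu hζ hδ0 hδ1 t hsp
  have J2 := integrable_logTrans_rpow_mul_grad hp1 hu hζ hδ0 hδ1 (t - p) (mul_pos (by linarith) hp0 : 0 < s * p)
  have hΦ0 : 0 ≤ Φ := by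
    refine integral_nonneg_of_ae ?_
    filter_upwards [hmem] with x hx
    have := one_le_logTrans hδ0 hδ1 hx
    exact mul_nonneg (Real.rpow_nonneg (by linarith) _) (hζ.rpow_mem hsp.le x).1
  have hen := energy_estimate hp1 hpn hu hsup hζ hδ0 hδ1 (q := t - p) (m := s * p) (by linarith)
    (by nlinarith)
  have hlow : ∫ x, logTrans C δ (u x) ^ (t - p) * ζ x ^ (s * p - p) ≤ Φ := by
    refine integral_mono_ae (integrable_logTrans_rpow_mul hu hζ hδ0 hδ1 _ (by nlinarith)) J1 ?_
    filter_upwards [hmem] with x hx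
    have h1 := one_le_logTrans hδ0 hδ1 hx
    have e : s * p - p = (s - 1) * p := by ring
    have h2 := (hζ.rpow_mem hsp.le x).1
    simp only [e]
    gcongr
    linarith
  have hW : ∫ x, ‖logTrans C δ (u x) ^ (t / p) • gradient (fun x => ζ x ^ s) x +
      (ζ x ^ s * -(t / p * logTrans C δ (u x) ^ (t / p - 1) * (u x + δ)⁻¹)) • G x‖ ^ p
      ≤ (2 * L) ^ p * (1 + 1 / (p - 1) ^ 2) * (s * t) ^ p * Φ := by
    calc _ ≤ ∫ x, 2 ^ p * ((s * L) ^ p * (logTrans C δ (u x) ^ t * ζ x ^ ((s - 1) * p))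
            + (t / p) ^ p * (logTrans C δ (u x) ^ (t - p) * (‖G x‖ * (u x + δ)⁻¹) ^ p
              * ζ x ^ (s * p))) := by
          refine integral_mono_ae (integrable_norm_rpow_ofReal hp0 hpair.2.1)
            (((J1.const_mul _).add (J2.const_mul _)).const_mul _) ?_
          filter_upwards [hmem] with x hx
          have hv1 := one_le_logTrans hδ0 hδ1 hx
          have hd : 0 < u x + δ := by linarith [hx.1]
          set v := logTrans C δ (u x)
          have hv0 : 0 ≤ v := by linarith
          have hz0 := hζ.nonneg x
          have htp : 0 ≤ t / p := by
            have : 0 ≤ t := by linarith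
            positivity
          have b1 : ‖v ^ (t / p) • gradient (fun x => ζ x ^ s) x‖
              ≤ s * L * (v ^ (t / p) * ζ x ^ (s - 1)) := by
            rw [norm_smul, Real.norm_of_nonneg (by positivity)]
            calc _ ≤ v ^ (t / p) * (s * L * ζ x ^ (s - 1)) := by
                  gcongr; exact hζ.norm_gradient_rpow_le hs.le x
              _ = _ := by ring
          have b2 : ‖(ζ x ^ s * -(t / p * v ^ (t / p - 1) * (u x + δ)⁻¹)) • G x‖
              = (t / p) * (v ^ (t / p - 1) * (‖G x‖ * (u x + δ)⁻¹) * ζ x ^ s) := by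
            rw [norm_smul, mul_neg, norm_neg, Real.norm_of_nonneg (by positivity)]; ring
          have c1 : (s * L * (v ^ (t / p) * ζ x ^ (s - 1))) ^ p
              = (s * L) ^ p * (v ^ t * ζ x ^ ((s - 1) * p)) := by
            rw [Real.mul_rpow (mul_nonneg (by linarith) hL) (by positivity),
              Real.mul_rpow (x := v ^ (t / p)) (by positivity) (by positivity),
              ← Real.rpow_mul hv0, ← Real.rpow_mul hz0]
            congr 3; field_simp
          have c2 : ((t / p) * (v ^ (t / p - 1) * (‖G x‖ * (u x + δ)⁻¹) * ζ x ^ s)) ^ p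
              = (t / p) ^ p * (v ^ (t - p) * (‖G x‖ * (u x + δ)⁻¹) ^ p * ζ x ^ (s * p)) := by
            rw [Real.mul_rpow htp (by positivity), Real.mul_rpow (by positivity) (by positivity),
              Real.mul_rpow (by positivity) (by positivity), ← Real.rpow_mul hv0,
              ← Real.rpow_mul hz0]
            congr 4; field_simp
          calc _ ≤ (s * L * (v ^ (t / p) * ζ x ^ (s - 1)) +
                (t / p) * (v ^ (t / p - 1) * (‖G x‖ * (u x + δ)⁻¹) * ζ x ^ s)) ^ p := by
                refine Real.rpow_le_rpow (norm_nonneg _) ?_ hp0.le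
                exact (norm_add_le _ _).trans (add_le_add b1 b2.le)
            _ ≤ _ := by
                refine (add_rpow_le_two_rpow_mul (mul_nonneg (mul_nonneg (by linarith) hL)
                  (by positivity)) (by positivity) hp0.le).trans ?_
                rw [c1, c2]
      _ = 2 ^ p * ((s * L) ^ p * Φ + (t / p) ^ p * ∫ x, logTrans C δ (u x) ^ (t - p) *
            (‖G x‖ * (u x + δ)⁻¹) ^ p * ζ x ^ (s * p)) := by
          rw [integral_const_mul, integral_add (J1.const_mul _) (J2.const_mul _),
            integral_const_mul, integral_const_mul]
      _ ≤ 2 ^ p * ((s * L) ^ p * Φ + (t / p) ^ p * ((s * p * L) ^ p / (p - 1) ^ 2 * Φ)) := by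
          have : 0 ≤ t / p := div_nonneg (by linarith) hp0.le
          gcongr
          refine hen.trans ?_
          have : 0 ≤ (s * p * L) ^ p / (p - 1) ^ 2 := by
            have : 0 ≤ s * p * L := by positivity
            positivity
          gcongr
      _ ≤ _ := by
          have e1 : (t / p) ^ p * ((s * p * L) ^ p / (p - 1) ^ 2 * Φ)
              = (L ^ p * (s * t) ^ p) * (1 / (p - 1) ^ 2) * Φ := by
            rw [← Real.mul_rpow hL (mul_nonneg (by linarith) (by linarith))]
            have : L * (s * t) = (t / p) * (s * p * L) := by field_simp
            rw [this, Real.mul_rpow (div_nonneg (by linarith) hp0.le)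
              (mul_nonneg (mul_nonneg (by linarith) hp0.le) hL)]
            ring
          have e2 : (s * L) ^ p ≤ L ^ p * (s * t) ^ p := by
            rw [← Real.mul_rpow hL (mul_nonneg (by linarith) (by linarith))]
            refine Real.rpow_le_rpow (mul_nonneg (by linarith) hL) ?_ hp0.le
            have : s ≤ s * t := by nlinarith
            nlinarith
          rw [e1, Real.mul_rpow (x := 2) (by norm_num) hL]
          calc _ ≤ 2 ^ p * (L ^ p * (s * t) ^ p * Φ + L ^ p * (s * t) ^ p * (1 / (p - 1) ^ 2) * Φ) := by
                gcongr
            _ = _ := by ring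
  have hl : ∫ x, logTrans C δ (u x) ^ (t * (critExp n p / p)) * ζ x ^ (s * critExp n p)
      = ∫ x, |ζ x ^ s * logTrans C δ (u x) ^ (t / p)| ^ critExp n p := by
    refine integral_congr_ae ?_
    filter_upwards [hmem] with x hx
    have hv1 := one_le_logTrans hδ0 hδ1 hx
    have hz0 := hζ.nonneg x
    have hv0 : 0 ≤ logTrans C δ (u x) := by linarith
    rw [abs_of_nonneg (by positivity), Real.mul_rpow (by positivity) (by positivity),
      ← Real.rpow_mul hv0, ← Real.rpow_mul hz0, mul_comm]
    congr 2; field_simp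
  rw [hl]
  refine hsob.trans ?_
  refine Real.rpow_le_rpow (mul_nonneg (by positivity) (integral_nonneg fun x => by positivity)) ?_
    (by positivity)
  calc _ ≤ (sobolevConst n p : ℝ) ^ p * ((2 * L) ^ p * (1 + 1 / (p - 1) ^ 2) * (s * t) ^ p * Φ) := by
        gcongr
    _ = _ := by rw [moserConst]; ring

end

/-- The accumulated exponent of D solves a linear recursion. The induction carries the exact
correction αj + γ, where α(χ-1) = χ and γ(χ-1) = χ + α make it reproduce itself; being nonnegative,
it is dropped at the end. -/
theorem geometric_iteration {χ : ℝ} (hχ : 1 < χ) {D M : ℝ} (hD : 1 ≤ D) (hM : 0 < M)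
    {A : ℕ → ℝ} (hA : ∀ j, 0 ≤ A j) (h0 : A 0 ≤ M)
    (hstep : ∀ j : ℕ, A (j + 1) ≤ (D ^ ((j : ℝ) + 1) * A j) ^ χ) (j : ℕ) :
    A j ≤ (D ^ ((χ + χ / (χ - 1)) / (χ - 1)) * M) ^ (χ ^ j) := by
  have hχ1 : 0 < χ - 1 := by linarith
  have hD0 : 0 < D := by linarith
  set α := χ / (χ - 1) with hα
  set γ := (χ + α) / (χ - 1) with hγ
  have hα0 : 0 ≤ α := div_nonneg (by linarith) hχ1.le
  have hγ0 : 0 ≤ γ := div_nonneg (by linarith) hχ1.le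
  have hα' : α * (χ - 1) = χ := by rw [hα]; field_simp
  have hγ' : γ * (χ - 1) = χ + α := by rw [hγ]; field_simp
  have claim : ∀ j : ℕ, A j ≤ D ^ (γ * χ ^ j - (α * j + γ)) * M ^ (χ ^ j) := by
    intro j
    induction j with
    | zero => simpa using h0
    | succ k ih =>
      refine (hstep k).trans ?_
      calc _ ≤ (D ^ ((k : ℝ) + 1) * (D ^ (γ * χ ^ k - (α * k + γ)) * M ^ (χ ^ k))) ^ χ := by
            have := hA k
            gcongr
        _ = _ := by
            rw [← mul_assoc, ← Real.rpow_add hD0, Real.mul_rpow (by positivity) (by positivity),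
              ← Real.rpow_mul hD0.le, ← Real.rpow_mul hM.le, pow_succ]
            congr 2
            push_cast
            linear_combination (-(k : ℝ)) * hα' - hγ'
  refine (claim j).trans ?_
  rw [Real.mul_rpow (by positivity) hM.le, ← Real.rpow_mul hD0.le]
  have : 0 ≤ α * j + γ := by positivity
  gcongr
  · linarith

/-- Local boundedness of the logarithm of a supersolution. -/
theorem exists_logTrans_le (hp1 : 1 < p) (hpn : p < (n : ℝ)) {L : ℝ} (hL : 0 ≤ L) (M : ℝ) :
    ∃ B : ℝ, ∀ (C δ : ℝ) (u : Sp n → ℝ) (G : Sp n → Sp n) (ζ : Sp n → ℝ),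
      BoundedWeak p C u G → IsSuper p G → IsCutoff L ζ → 0 < δ → δ ≤ 1 →
      ∫ x, logTrans C δ (u x) ^ p * ζ x ^ p ≤ M →
      ∀ᵐ x, ζ x = 1 → logTrans C δ (u x) ≤ B := by
  have hp0 : 0 < p := by linarith
  have hnp : 0 < (n : ℝ) - p := by linarith
  have hn0 : 0 < (n : ℝ) := by linarith
  set χ : ℝ := critExp n p / p with hχd
  have hχe : χ = n / (n - p) := by rw [hχd, critExp]; field_simp
  have hχ : 1 < χ := by rw [hχe, one_lt_div hnp]; linarith
  have hχ0 : 0 < χ := by linarith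
  have hχn : χ * (n - p) = n := by rw [hχe]; field_simp
  -- One cutoff serves all steps, with growing powers in place of shrinking balls. At level t the
  -- power of ζ is βt - n. One step maps it to βχt - n because χ(n-p) = n, and β is chosen so that
  -- the initial power, at t = p, is p.
  set β : ℝ := (n + p) / p with hβd
  have hβp : β * p = n + p := by rw [hβd]; field_simp
  have hβ0 : 0 < β := by positivity
  set K := moserConst n p L with hKd
  have hK : 0 ≤ K := moserConst_nonneg hL
  -- The factor of step j is at most K(βp²)^p (χ^(2p))^j, hence at most D^(j+1).
  set D : ℝ := max (max 1 (K * (β * p ^ 2) ^ p)) (χ ^ (2 * p)) with hDd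
  have hD1 : 1 ≤ D := (le_max_left _ _).trans (le_max_left _ _)
  have hD2 : K * (β * p ^ 2) ^ p ≤ D := (le_max_right _ _).trans (le_max_left _ _)
  have hD3 : χ ^ (2 * p) ≤ D := le_max_right _ _
  set B0 : ℝ := D ^ ((χ + χ / (χ - 1)) / (χ - 1)) * max 1 M with hB0d
  have hB00 : 0 < B0 := by
    have : 0 < D := by linarith
    positivity
  refine ⟨2 * B0 ^ p⁻¹, fun C δ u G ζ hu hs hζ hδ0 hδ1 hM => ?_⟩
  have hmem : ∀ᵐ x, u x ∈ Set.Icc 0 C := by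
    filter_upwards [hu.nonneg, hu.le] with x h1 h2 using ⟨h1, h2⟩
  set t : ℕ → ℝ := fun j => p * χ ^ j with htd
  have htp : ∀ j, p ≤ t j := fun j => le_mul_of_one_le_right hp0.le (one_le_pow₀ hχ.le)
  have hexp : ∀ j, 0 < β * t j - n := fun j => by
    have := mul_le_mul_of_nonneg_left (htp j) hβ0.le
    linarith
  set f : ℕ → Sp n → ℝ := fun j x => logTrans C δ (u x) ^ t j * ζ x ^ (β * t j - n) with hfd
  have hfi : ∀ j, Integrable (f j) := fun j =>
    integrable_logTrans_rpow_mul hu hζ hδ0 hδ1 _ (hexp j)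
  have hf0 : ∀ j, 0 ≤ᵐ[volume] f j := fun j => by
    filter_upwards [hmem] with x hx
    have := one_le_logTrans hδ0 hδ1 hx
    exact mul_nonneg (Real.rpow_nonneg (by linarith) _) (hζ.rpow_mem (hexp j).le x).1
  have hA : ∀ j, ∫ x, f j x ≤ B0 ^ (χ ^ j) := by
    refine geometric_iteration hχ hD1 (by positivity) (fun j => integral_nonneg_of_ae (hf0 j)) ?_ ?_
    · refine le_trans (le_of_eq ?_) (hM.trans (le_max_right _ _))
      simp only [hfd, htd, pow_zero, mul_one, hβp, add_sub_cancel_left]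
    · intro j
      have hs1 : 1 < 1 + (β * t j - n) / p := by
        have := div_pos (hexp j) hp0
        linarith
      have st := moser_step hp1 hpn hu hs hζ hδ0 hδ1 (htp j) hs1
      have e1 : (1 + (β * t j - n) / p) * critExp n p = β * t (j + 1) - n := by
        have : critExp n p = χ * p := by rw [hχd]; field_simp
        rw [this]
        have e : t (j + 1) = χ * t j := by simp only [htd, pow_succ]; ring
        rw [e]
        field_simp
        linear_combination (-1 : ℝ) * hχn
      have e2 : t j * (critExp n p / p) = t (j + 1) := by
        simp only [htd, pow_succ]; rw [← hχd]; ring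
      have e3 : (1 + (β * t j - n) / p - 1) * p = β * t j - n := by field_simp; ring
      rw [e1, e2, e3] at st
      refine st.trans (Real.rpow_le_rpow (mul_nonneg (mul_nonneg hK (Real.rpow_nonneg
        (mul_nonneg (by linarith) (by linarith [htp j])) _)) (integral_nonneg_of_ae (hf0 j))) ?_ hχ0.le)
      refine mul_le_mul_of_nonneg_right ?_ (integral_nonneg_of_ae (hf0 j))
      have htj : 0 < t j := hp0.trans_le (htp j)
      have b1 : (1 + (β * t j - n) / p) * t j ≤ β * p ^ 2 * (χ ^ j) ^ 2 := by
        have b2 : 1 + (β * t j - n) / p ≤ β * t j := by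
          have h1 : β * t j / p ≤ β * t j := div_le_self (by positivity) hp1.le
          have h2 : 1 ≤ n / p := (one_le_div hp0).2 hpn.le
          rw [sub_div]; linarith
        calc _ ≤ β * t j * t j := by gcongr
          _ = _ := by simp only [htd]; ring
      calc K * ((1 + (β * t j - n) / p) * t j) ^ p ≤ K * (β * p ^ 2 * (χ ^ j) ^ 2) ^ p := by
            have : 0 ≤ (1 + (β * t j - n) / p) * t j := by nlinarith
            gcongr
        _ = K * (β * p ^ 2) ^ p * (χ ^ (2 * p)) ^ j := by
            rw [Real.mul_rpow (by positivity) (by positivity), mul_assoc]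
            congr 2
            rw [← pow_mul, ← Real.rpow_natCast, ← Real.rpow_mul hχ0.le, ← Real.rpow_natCast (χ ^ (2 * p)),
              ← Real.rpow_mul hχ0.le]
            congr 1; push_cast; ring
        _ ≤ D * D ^ j := by gcongr
        _ = D ^ ((j : ℝ) + 1) := by
            rw [Real.rpow_add_one (by linarith), Real.rpow_natCast]; ring
  set B : ℝ := 2 * B0 ^ p⁻¹ with hBd
  have hB : 0 < B := by positivity
  -- Because B is twice B0^(1/p), Chebyshev at level j bounds the measure of this set by (1/2)^(t
  -- j), which tends to zero.
  set T : Set (Sp n) := {x | ζ x = 1 ∧ B ≤ logTrans C δ (u x)} with hT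
  have hTle : ∀ j, volume.real T ≤ (1 / 2 : ℝ) ^ t j := by
    intro j
    have h1 := mul_meas_ge_le_integral_of_nonneg (hf0 j) (hfi j) (B ^ t j)
    have hBt : 0 < B ^ t j := Real.rpow_pos_of_pos hB _
    have hfin : volume {x | B ^ t j ≤ f j x} ≠ ∞ := by
      refine ((measure_mono ?_).trans_lt hζ.compact.measure_lt_top).ne
      intro x hx
      by_contra hx'
      have h0 : ζ x = 0 := image_eq_zero_of_notMem_tsupport hx'
      simp only [hfd, Set.mem_ofPred_eq, h0, Real.zero_rpow (hexp j).ne', mul_zero] at hx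
      linarith
    have h2 : volume.real T ≤ volume.real {x | B ^ t j ≤ f j x} := by
      refine measureReal_mono ?_ hfin
      intro x hx
      simp only [hfd, Set.mem_ofPred_eq, hx.1, Real.one_rpow, mul_one]
      exact Real.rpow_le_rpow hB.le hx.2 (hp0.le.trans (htp j))
    have h3 : B0 ^ (χ ^ j) = (1 / 2 : ℝ) ^ t j * B ^ t j := by
      rw [← Real.mul_rpow (by norm_num) hB.le, hBd]
      have : 1 / 2 * (2 * B0 ^ p⁻¹) = B0 ^ p⁻¹ := by ring
      rw [this, ← Real.rpow_mul hB00.le]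
      congr 1
      simp only [htd]; field_simp
    have h4 : B ^ t j * volume.real T ≤ B ^ t j * (1 / 2 : ℝ) ^ t j := by
      calc _ ≤ B ^ t j * volume.real {x | B ^ t j ≤ f j x} := by gcongr
        _ ≤ B0 ^ (χ ^ j) := h1.trans (hA j)
        _ = _ := by rw [h3, mul_comm]
    exact le_of_mul_le_mul_left h4 hBt
  have htend : Tendsto (fun j => (1 / 2 : ℝ) ^ t j) atTop (𝓝 0) := by
    have h1 : Tendsto t atTop atTop := (tendsto_pow_atTop_atTop_of_one_lt hχ).const_mul_atTop hp0
    exact (tendsto_rpow_atTop_of_base_lt_one _ (by norm_num) (by norm_num)).comp h1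
  have hT0 : volume.real T = 0 :=
    le_antisymm (ge_of_tendsto' htend hTle) measureReal_nonneg
  have hTfin : volume T ≠ ∞ := by
    refine ((measure_mono ?_).trans_lt hζ.compact.measure_lt_top).ne
    intro x hx
    by_contra hx'
    have h0 : ζ x = 0 := image_eq_zero_of_notMem_tsupport hx'
    rw [hx.1] at h0
    exact one_ne_zero h0
  have hTz : volume T = 0 := (measureReal_eq_zero_iff hTfin).1 hT0
  filter_upwards [measure_eq_zero_iff_ae_notMem.1 hTz] with x hx h1
  by_contra h2
  exact hx ⟨h1, (not_le.1 h2).le⟩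

/-! ### A two-point Poincaré inequality on balls -/

/-- Integrate the derivative along the segment from x to y and use Jensen's inequality on [0, 1]. -/
theorem enorm_sub_rpow_le_lintegral (hp1 : 1 < p) {φ : Sp n → ℝ} (hφ : ContDiff ℝ 1 φ) (x y : Sp n) :
    ‖φ x - φ y‖ₑ ^ p ≤ ‖y - x‖ₑ ^ p *
      ∫⁻ t in Set.Ioc (0 : ℝ) 1, ‖gradient φ (x + t • (y - x))‖ₑ ^ p := by
  have hp0 : 0 < p := by linarith
  set c : ℝ → Sp n := fun t => x + t • (y - x) with hc
  have hcc : Continuous c := by fun_prop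
  have hgc : Continuous fun t => gradient φ (c t) := (continuous_gradient hφ).comp hcc
  have hd : ∀ t, HasDerivAt (fun t => φ (c t)) (inner ℝ (gradient φ (c t)) (y - x)) t := by
    intro t
    have h1 : HasDerivAt c (y - x) t := by
      simpa [hc] using ((hasDerivAt_id t).smul_const (y - x)).const_add x
    rw [inner_gradient]
    exact (hasGradientAt_of_contDiff hφ (c t)).comp_hasDerivAt t h1
  have hint : Continuous fun t => inner ℝ (gradient φ (c t)) (y - x) :=
    hgc.inner continuous_const
  have ftc : φ y - φ x = ∫ t in (0 : ℝ)..1, inner ℝ (gradient φ (c t)) (y - x) := by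
    rw [intervalIntegral.integral_eq_sub_of_hasDerivAt (fun t _ => hd t)
      (hint.intervalIntegrable _ _)]
    simp [hc]
  set μ : Measure ℝ := volume.restrict (Set.Ioc (0 : ℝ) 1) with hμ
  have hprob : IsProbabilityMeasure μ := ⟨by simp [hμ]⟩
  have h1 : ‖φ x - φ y‖ₑ ≤ ‖y - x‖ₑ * ∫⁻ t, ‖gradient φ (c t)‖ₑ ∂μ := by
    rw [← enorm_neg, neg_sub, ftc, intervalIntegral.integral_of_le zero_le_one]
    refine (enorm_integral_le_lintegral_enorm _).trans ?_
    rw [← lintegral_const_mul _ hgc.enorm.measurable]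
    refine lintegral_mono fun t => ?_
    rw [mul_comm, ← enorm_norm (gradient φ _), ← enorm_norm (y - x), ← enorm_mul,
      enorm_le_iff_norm_le, norm_mul, norm_norm, norm_norm]
    exact norm_inner_le_norm _ _
  have h2 : ∫⁻ t, ‖gradient φ (c t)‖ₑ ∂μ ≤ (∫⁻ t, ‖gradient φ (c t)‖ₑ ^ p ∂μ) ^ p⁻¹ := by
    have := eLpNorm_le_eLpNorm_of_exponent_le (μ := μ) (one_le_ofReal_of_one_lt hp1)
      (hgc.aestronglyMeasurable (μ := μ))
    rwa [eLpNorm_one_eq_lintegral_enorm, eLpNorm_eq_lintegral_rpow_enorm_toReal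
      (by simpa using hp0) ENNReal.ofReal_ne_top, ENNReal.toReal_ofReal hp0.le, one_div] at this
  calc ‖φ x - φ y‖ₑ ^ p ≤ (‖y - x‖ₑ * (∫⁻ t, ‖gradient φ (c t)‖ₑ ^ p ∂μ) ^ p⁻¹) ^ p := by
        gcongr
        exact h1.trans (by gcongr)
    _ = _ := by
        rw [ENNReal.mul_rpow_of_nonneg _ _ hp0.le, ← ENNReal.rpow_mul, inv_mul_cancel₀ hp0.ne',
          ENNReal.rpow_one]

/-- Lebesgue measure on the ball of radius `ρ` centred at the origin. -/
noncomputable def ballMeasure (n : ℕ) (ρ : ℝ) : Measure (Sp n) := volume.restrict (ball 0 ρ)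

instance (n : ℕ) (ρ : ℝ) : IsFiniteMeasure (ballMeasure n ρ) :=
  ⟨by rw [ballMeasure, Measure.restrict_apply_univ]; exact measure_ball_lt_top⟩

/-- Integrate the segment estimate with h = y - x in place of y. By convexity the segments stay in
the ball, so the gradient can be extended by zero. Translation invariance then removes the shift x +
t h, and the h-integral contributes the volume of the ball of radius 2ρ. -/
theorem lintegral_sub_rpow_le (hp1 : 1 < p) {φ : Sp n → ℝ} (hφ : ContDiff ℝ 1 φ) (ρ : ℝ) :
    ∫⁻ x, ∫⁻ y, ‖φ x - φ y‖ₑ ^ p ∂(ballMeasure n ρ) ∂(ballMeasure n ρ) ≤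
      ENNReal.ofReal (2 * ρ) ^ p * volume (ball (0 : Sp n) (2 * ρ)) *
        ∫⁻ x, ‖gradient φ x‖ₑ ^ p ∂(ballMeasure n ρ) := by
  have hp0 : 0 < p := by linarith
  set B := ball (0 : Sp n) ρ with hB
  have mB : MeasurableSet B := measurableSet_ball
  set g : Sp n → ℝ≥0∞ := B.indicator fun x => ‖gradient φ x‖ₑ ^ p with hg
  have mg : Measurable g :=
    ((continuous_gradient hφ).enorm.measurable.pow_const p).indicator mB
  set k : Sp n → Sp n → ℝ≥0∞ := fun x h => ∫⁻ t in Set.Ioc (0 : ℝ) 1, g (x + t • h) with hk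
  have mk3 : Measurable fun z : (Sp n × Sp n) × ℝ => g (z.1.1 + z.2 • z.1.2) :=
    mg.comp (by fun_prop)
  have mk : Measurable (Function.uncurry k) := mk3.lintegral_prod_right'
  have h1 : ∀ x ∈ B, ∀ y ∈ B, ‖φ x - φ y‖ₑ ^ p ≤ ENNReal.ofReal (2 * ρ) ^ p *
      (ball (0 : Sp n) (2 * ρ)).indicator (k x) (y - x) := by
    intro x hx y hy
    refine (enorm_sub_rpow_le_lintegral hp1 hφ x y).trans ?_
    have hyx : ‖y - x‖ < 2 * ρ := by
      have h1 := mem_ball_zero_iff.1 hx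
      have h2 := mem_ball_zero_iff.1 hy
      have := norm_sub_le y x
      linarith
    rw [Set.indicator_of_mem (mem_ball_zero_iff.2 hyx)]
    gcongr
    · rw [← ofReal_norm]; exact ENNReal.ofReal_le_ofReal hyx.le
    · refine setLIntegral_mono_ae (mg.comp (by fun_prop)).aemeasurable ?_
      refine ae_of_all _ fun t ht => ?_
      have : x + t • (y - x) ∈ B :=
        (convex_ball (0 : Sp n) ρ).add_smul_sub_mem hx hy ⟨ht.1.le, ht.2⟩
      rw [hg, Set.indicator_of_mem this]
  have mind : Measurable fun z : Sp n × Sp n => (ball (0 : Sp n) (2 * ρ)).indicator (k z.1) z.2 := by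
    have : (fun z : Sp n × Sp n => (ball (0 : Sp n) (2 * ρ)).indicator (k z.1) z.2)
        = (Prod.snd ⁻¹' (ball (0 : Sp n) (2 * ρ))).indicator (Function.uncurry k) := by
      ext z; rfl
    rw [this]
    exact mk.indicator (measurable_snd measurableSet_ball)
  calc ∫⁻ x, ∫⁻ y, ‖φ x - φ y‖ₑ ^ p ∂(ballMeasure n ρ) ∂(ballMeasure n ρ)
      ≤ ∫⁻ x in B, ∫⁻ y in B, ENNReal.ofReal (2 * ρ) ^ p *
          (ball (0 : Sp n) (2 * ρ)).indicator (k x) (y - x) := by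
        refine setLIntegral_mono' mB fun x hx => setLIntegral_mono' mB fun y hy => h1 x hx y hy
    _ ≤ ∫⁻ x, ∫⁻ y, ENNReal.ofReal (2 * ρ) ^ p *
          (ball (0 : Sp n) (2 * ρ)).indicator (k x) (y - x) := by
        refine (setLIntegral_le_lintegral _ _).trans (lintegral_mono fun x => ?_)
        exact setLIntegral_le_lintegral _ _
    _ = ∫⁻ x, ∫⁻ h, ENNReal.ofReal (2 * ρ) ^ p *
          (ball (0 : Sp n) (2 * ρ)).indicator (k x) h := by
        refine lintegral_congr fun x => ?_
        exact lintegral_sub_right_eq_self (fun h => ENNReal.ofReal (2 * ρ) ^ p *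
          (ball (0 : Sp n) (2 * ρ)).indicator (k x) h) x
    _ = ∫⁻ h, ∫⁻ x, ENNReal.ofReal (2 * ρ) ^ p *
          (ball (0 : Sp n) (2 * ρ)).indicator (k x) h :=
        lintegral_lintegral_swap (mind.const_mul _).aemeasurable
    _ = ∫⁻ h, (ball (0 : Sp n) (2 * ρ)).indicator (fun _ => ENNReal.ofReal (2 * ρ) ^ p *
          ∫⁻ x, g x) h := by
        refine lintegral_congr fun h => ?_
        by_cases hh : h ∈ ball (0 : Sp n) (2 * ρ)
        · simp only [Set.indicator_of_mem hh]
          have mk' : Measurable fun x => k x h := mk.of_uncurry_right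
          rw [lintegral_const_mul _ mk']
          congr 1
          simp only [hk]
          rw [lintegral_lintegral_swap]
          · simp only [lintegral_add_right_eq_self g]
            simp
          · exact (mg.comp (by fun_prop)).aemeasurable
        · simp [Set.indicator_of_notMem hh]
    _ = _ := by
        rw [lintegral_indicator_const measurableSet_ball, hg, lintegral_indicator mB]
        rw [ballMeasure]
        ring

theorem lintegral_enorm_rpow_eq {α F : Type*} [MeasurableSpace α] {μ : Measure α}
    [NormedAddCommGroup F] (hp0 : 0 < p) (f : α → F) :
    ∫⁻ x, ‖f x‖ₑ ^ p ∂μ = eLpNorm f (ENNReal.ofReal p) μ ^ p := by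
  rw [eLpNorm_eq_lintegral_rpow_enorm_toReal (by simpa using hp0) ENNReal.ofReal_ne_top,
    ENNReal.toReal_ofReal hp0.le, ← ENNReal.rpow_mul, one_div, inv_mul_cancel₀ hp0.ne',
    ENNReal.rpow_one]

/-- The constant in the Poincaré inequality on the ball of radius `ρ`. -/
noncomputable def poincareConst (n : ℕ) (p ρ : ℝ) : ℝ≥0∞ :=
  ENNReal.ofReal (2 * ρ) ^ p * volume (ball (0 : Sp n) (2 * ρ))

theorem poincareConst_ne_top (hp0 : 0 < p) (ρ : ℝ) : poincareConst n p ρ ≠ ∞ :=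
  ENNReal.mul_ne_top (ENNReal.rpow_ne_top_of_nonneg hp0.le ENNReal.ofReal_ne_top)
    measure_ball_lt_top.ne

/-- Approximate by test functions: along a subsequence they converge almost everywhere, so Fatou
handles the left side, while the gradients converge in L^p on the right. -/
theorem SobolevPair.poincare (hp1 : 1 < p) (hpn : p < (n : ℝ)) {w : Sp n → ℝ} {W : Sp n → Sp n}
    (h : SobolevPair p w W) (ρ : ℝ) :
    ∫⁻ z, ‖w z.1 - w z.2‖ₑ ^ p ∂((ballMeasure n ρ).prod (ballMeasure n ρ)) ≤
      poincareConst n p ρ * ∫⁻ x, ‖W x‖ₑ ^ p ∂(ballMeasure n ρ) := by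
  have hp0 : 0 < p := by linarith
  obtain ⟨φ, hφ, h1, h2⟩ := h.exists_seq
  have hq0 : ENNReal.ofReal (critExp n p) ≠ 0 := by
    simpa using (by linarith [one_lt_critExp hp1 hpn] : 0 < critExp n p)
  obtain ⟨ns, hns, hae⟩ := (tendstoInMeasure_of_tendsto_eLpNorm hq0
    (fun j => (hφ j).contDiff_one.continuous.aestronglyMeasurable) h.1.1 h1).exists_seq_tendsto_ae
  have hac : ballMeasure n ρ ≪ volume := Measure.absolutelyContinuous_of_le Measure.restrict_le_self
  set ν := (ballMeasure n ρ).prod (ballMeasure n ρ) with hν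
  have hae' := hac.ae_le hae
  have hae2 : ∀ᵐ z ∂ν, Tendsto (fun i => φ (ns i) z.1 - φ (ns i) z.2) atTop (𝓝 (w z.1 - w z.2)) := by
    filter_upwards [Measure.quasiMeasurePreserving_fst.ae hae',
      Measure.quasiMeasurePreserving_snd.ae hae'] with z hz1 hz2 using hz1.sub hz2
  have hsm : ∀ j, eLpNorm (fun z : Sp n × Sp n => φ j z.1 - φ j z.2) (ENNReal.ofReal p) ν ≤
      poincareConst n p ρ ^ p⁻¹ * (eLpNorm W (ENNReal.ofReal p) (ballMeasure n ρ)
        + eLpNorm (gradient (φ j) - W) (ENNReal.ofReal p)) := by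
    intro j
    have hc := (hφ j).contDiff_one
    have h3 := lintegral_sub_rpow_le hp1 hc ρ
    have hm : Continuous fun z : Sp n × Sp n => φ j z.1 - φ j z.2 :=
      (hc.continuous.comp continuous_fst).sub (hc.continuous.comp continuous_snd)
    have h4 : ∫⁻ z, ‖φ j z.1 - φ j z.2‖ₑ ^ p ∂ν =
        ∫⁻ x, ∫⁻ y, ‖φ j x - φ j y‖ₑ ^ p ∂(ballMeasure n ρ) ∂(ballMeasure n ρ) :=
      lintegral_prod _ (hm.enorm.measurable.pow_const p).aemeasurable
    rw [← h4, lintegral_enorm_rpow_eq hp0, lintegral_enorm_rpow_eq hp0] at h3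
    have h5 := ENNReal.rpow_le_rpow h3 (inv_nonneg.2 hp0.le)
    rw [← ENNReal.rpow_mul, mul_inv_cancel₀ hp0.ne', ENNReal.rpow_one,
      ENNReal.mul_rpow_of_nonneg _ _ (inv_nonneg.2 hp0.le), ← ENNReal.rpow_mul,
      mul_inv_cancel₀ hp0.ne', ENNReal.rpow_one] at h5
    refine h5.trans ?_
    rw [poincareConst]
    gcongr
    have hg := memLp_gradient_of_contDiff hc (hφ j).2 (ENNReal.ofReal p)
    conv_lhs => rw [show gradient (φ j) = W + (gradient (φ j) - W) by abel]
    refine (eLpNorm_add_le (h.2.1.1.mono_ac hac) ((hg.sub h.2.1).1.mono_ac hac)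
      (one_le_ofReal_of_one_lt hp1)).trans (add_le_add le_rfl ?_)
    exact eLpNorm_mono_measure _ Measure.restrict_le_self
  have hlim := Lp.eLpNorm_lim_le_liminf_eLpNorm (p := ENNReal.ofReal p)
    (f := fun i (z : Sp n × Sp n) => φ (ns i) z.1 - φ (ns i) z.2)
    (fun i => (((hφ _).contDiff_one.continuous.comp continuous_fst).sub
      ((hφ _).contDiff_one.continuous.comp continuous_snd)).aestronglyMeasurable)
    (fun z => w z.1 - w z.2) hae2
  have hKtop : poincareConst n p ρ ^ p⁻¹ ≠ ∞ :=
    ENNReal.rpow_ne_top_of_nonneg (inv_nonneg.2 hp0.le) (poincareConst_ne_top hp0 ρ)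
  have htend : Tendsto (fun i => poincareConst n p ρ ^ p⁻¹ *
      (eLpNorm W (ENNReal.ofReal p) (ballMeasure n ρ)
        + eLpNorm (gradient (φ (ns i)) - W) (ENNReal.ofReal p))) atTop
      (𝓝 (poincareConst n p ρ ^ p⁻¹ * (eLpNorm W (ENNReal.ofReal p) (ballMeasure n ρ) + 0))) :=
    ENNReal.Tendsto.const_mul (tendsto_const_nhds.add (h2.comp hns.tendsto_atTop)) (Or.inr hKtop)
  have hfin := hlim.trans ((liminf_le_liminf (Eventually.of_forall fun i => hsm (ns i))).trans_eq
    htend.liminf_eq)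
  rw [add_zero] at hfin
  rw [lintegral_enorm_rpow_eq hp0, lintegral_enorm_rpow_eq hp0]
  calc _ ≤ (poincareConst n p ρ ^ p⁻¹ * eLpNorm W (ENNReal.ofReal p) (ballMeasure n ρ)) ^ p := by
        gcongr
    _ = _ := by
        rw [ENNReal.mul_rpow_of_nonneg _ _ hp0.le, ← ENNReal.rpow_mul, inv_mul_cancel₀ hp0.ne',
          ENNReal.rpow_one]

/-! ### From mass in a ball to a pointwise lower bound -/

theorem isCutoff_cutoff {L ρ : ℝ} (hL : ∀ R : ℝ, 0 < R → ∀ x : Sp n, ‖gradient (cutoff n R) x‖ ≤ L / R)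
    (hρ : 0 < ρ) : IsCutoff (L / ρ) (cutoff n ρ) :=
  ⟨cutoff_contDiff ρ, cutoff_hasCompactSupport hρ, cutoff_nonneg ρ, cutoff_le_one ρ, hL ρ hρ⟩

/-- A form of the boundedness of t log(1/t), uniform in δ, from log s ≤ s - 1. -/
theorem logTrans_mul_le {C δ t : ℝ} (hδ0 : 0 < δ) (ht : t ∈ Set.Icc 0 C) :
    logTrans C δ t * t ≤ 2 * C + 1 := by
  have h1 : 0 < t + δ := by linarith [ht.1]
  have h2 : 0 < C + 1 := by linarith [ht.1, ht.2]
  have h3 := Real.log_le_sub_one_of_pos (div_pos h2 h1)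
  have h4 : (C + 1) / (t + δ) * t ≤ C + 1 := by
    rw [div_mul_eq_mul_div, div_le_iff₀ h1]
    nlinarith
  unfold logTrans
  nlinarith [ht.1, ht.2]

/-- A supersolution whose mass in a ball is bounded from below has a logarithm which is bounded
in `L^p` of that ball. -/
theorem exists_integral_logTrans_le (hp1 : 1 < p) (hpn : p < (n : ℝ)) {ρ : ℝ} (hρ : 0 < ρ)
    {C : ℝ} (hC : 0 ≤ C) {c : ℝ} (hc : 0 < c) :
    ∃ M : ℝ, ∀ (δ : ℝ) (u : Sp n → ℝ) (G : Sp n → Sp n),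
      BoundedWeak p C u G → IsSuper p G → 0 < δ → δ ≤ 1 →
      c ≤ ∫ x, u x ^ critExp n p ∂(ballMeasure n ρ) →
      ∫ x, logTrans C δ (u x) ^ p ∂(ballMeasure n ρ) ≤ M := by
  obtain ⟨L, hL0, hL⟩ := exists_gradient_cutoff_le n
  have hp0 : 0 < p := by linarith
  have hq : p < critExp n p := (critExp_pos_facts hp1 hpn).1
  have hq0 : 0 < critExp n p := by linarith
  set q := critExp n p with hqd
  -- The bound of the energy estimate for q = 0 and m = 2p, which contains neither u nor δ.
  set E0 : ℝ := (2 * p * (L / ρ)) ^ p / (p - 1) ^ 2 * ∫ x, cutoff n ρ x ^ p with hE0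
  have hE00 : 0 ≤ E0 := by
    have : 0 ≤ ∫ x, cutoff n ρ x ^ p :=
      integral_nonneg fun x => Real.rpow_nonneg (cutoff_nonneg ρ x) _
    positivity
  set E1 : ℝ := (poincareConst n p ρ).toReal * E0 with hE1
  set N : ℝ := (2 * C + 1) ^ p * C ^ (q - p) with hN
  set V : ℝ := (ballMeasure n ρ).real Set.univ with hV
  refine ⟨c⁻¹ * (2 ^ p * (C ^ q * E1 + N * (V * V))), fun δ u G hu hs hδ0 hδ1 hmass => ?_⟩
  have hac : ballMeasure n ρ ≪ volume := Measure.absolutelyContinuous_of_le Measure.restrict_le_self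
  have hmem : ∀ᵐ x, u x ∈ Set.Icc 0 C := by
    filter_upwards [hu.nonneg, hu.le] with x h1 h2 using ⟨h1, h2⟩
  have hmemB := hac.ae_le hmem
  have hcut := isCutoff_cutoff hL hρ
  have hen := energy_estimate hp1 hpn hu hs hcut hδ0 hδ1 (q := 0) (m := 2 * p) le_rfl (by linarith)
  simp only [Real.rpow_zero, one_mul] at hen
  have e2p : 2 * p - p = p := by ring
  rw [e2p] at hen
  have hgi := integrable_logTrans_rpow_mul_grad hp1 hu hcut hδ0 hδ1 0 (m := 2 * p) (by linarith)
  simp only [Real.rpow_zero, one_mul] at hgi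
  have hpair := hu.sobolevPair_mul hp1 hpn hcut.contDiff hcut.compact
    (fun t ht => hasDerivAt_logTrans hδ0 ht) (continuousOn_inv_add hδ0).neg
  have hpo := hpair.poincare hp1 hpn ρ
  have hball : ∀ᵐ x ∂(ballMeasure n ρ), x ∈ ball (0 : Sp n) ρ :=
    ae_restrict_mem measurableSet_ball
  set v : Sp n → ℝ := fun x => logTrans C δ (u x) with hv
  set ν := (ballMeasure n ρ).prod (ballMeasure n ρ) with hν
  have hl : ∫⁻ z, ‖cutoff n ρ z.1 * v z.1 - cutoff n ρ z.2 * v z.2‖ₑ ^ p ∂ν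
      = ∫⁻ z, ‖v z.1 - v z.2‖ₑ ^ p ∂ν := by
    refine lintegral_congr_ae ?_
    filter_upwards [Measure.quasiMeasurePreserving_fst.ae hball,
      Measure.quasiMeasurePreserving_snd.ae hball] with z hz1 hz2
    rw [cutoff_eq_one hρ (mem_ball_zero_iff.1 hz1).le, cutoff_eq_one hρ (mem_ball_zero_iff.1 hz2).le,
      one_mul, one_mul]
  have hr : ∫⁻ x, ‖v x • gradient (cutoff n ρ) x + (cutoff n ρ x * -(u x + δ)⁻¹) • G x‖ₑ ^ p
      ∂(ballMeasure n ρ) ≤ ENNReal.ofReal E0 := by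
    calc _ ≤ ∫⁻ x, ENNReal.ofReal ((‖G x‖ * (u x + δ)⁻¹) ^ p * cutoff n ρ x ^ (2 * p))
            ∂(ballMeasure n ρ) := by
          refine lintegral_mono_ae ?_
          filter_upwards [hball, hmemB] with x hx hux
          have hx' := mem_ball_zero_iff.1 hx
          have hd : 0 < u x + δ := by linarith [hux.1]
          rw [cutoff_eq_one hρ hx'.le, gradient_cutoff_eq_zero hρ (Or.inl hx'), smul_zero, zero_add,
            one_mul, Real.one_rpow, mul_one, ← ofReal_norm,
            ENNReal.ofReal_rpow_of_nonneg (norm_nonneg _) hp0.le, norm_smul, norm_neg,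
            Real.norm_of_nonneg (by positivity), mul_comm]
      _ ≤ ∫⁻ x, ENNReal.ofReal ((‖G x‖ * (u x + δ)⁻¹) ^ p * cutoff n ρ x ^ (2 * p)) :=
          lintegral_mono' Measure.restrict_le_self le_rfl
      _ = ENNReal.ofReal (∫ x, (‖G x‖ * (u x + δ)⁻¹) ^ p * cutoff n ρ x ^ (2 * p)) := by
          rw [ofReal_integral_eq_lintegral_ofReal hgi]
          filter_upwards [hmem] with x hux
          have hd : 0 < u x + δ := by linarith [hux.1]
          have := cutoff_nonneg ρ x
          positivity
      _ ≤ _ := ENNReal.ofReal_le_ofReal hen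
  rw [hl] at hpo
  have hpo' : ∫⁻ z, ‖v z.1 - v z.2‖ₑ ^ p ∂ν ≤ ENNReal.ofReal E1 := by
    refine hpo.trans ?_
    rw [hE1, ENNReal.ofReal_mul ENNReal.toReal_nonneg, ENNReal.ofReal_toReal (poincareConst_ne_top hp0 ρ)]
    gcongr
  have hvc : ContinuousOn (logTrans C δ) (Set.Icc 0 C) := continuousOn_logTrans hδ0
  have hvm : AEStronglyMeasurable v (ballMeasure n ρ) := (hu.aestronglyMeasurable_comp hvc).mono_ac hac
  have hum : AEStronglyMeasurable u (ballMeasure n ρ) := hu.weak.1.aestronglyMeasurable.mono_ac hac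
  have hdm : AEStronglyMeasurable (fun z : Sp n × Sp n => v z.1 - v z.2) ν :=
    hvm.comp_fst.sub hvm.comp_snd
  have hdmem : MemLp (fun z : Sp n × Sp n => v z.1 - v z.2) (ENNReal.ofReal p) ν := by
    refine ⟨hdm, ?_⟩
    have := hpo'.trans_lt ENNReal.ofReal_lt_top
    rw [lintegral_enorm_rpow_eq hp0] at this
    rwa [ENNReal.rpow_lt_top_iff_of_pos hp0] at this
  have hdi : Integrable (fun z : Sp n × Sp n => ‖v z.1 - v z.2‖ ^ p) ν := by
    have := hdmem.integrable_norm_rpow (by simpa using hp0) ENNReal.ofReal_ne_top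
    rwa [ENNReal.toReal_ofReal hp0.le] at this
  have hdle : ∫ z, ‖v z.1 - v z.2‖ ^ p ∂ν ≤ E1 := by
    have h0 : 0 ≤ E1 := mul_nonneg ENNReal.toReal_nonneg hE00
    rw [← ENNReal.ofReal_le_ofReal_iff h0, ofReal_integral_eq_lintegral_ofReal hdi
      (ae_of_all _ fun z => by positivity)]
    refine le_trans (le_of_eq (lintegral_congr fun z => ?_)) hpo'
    rw [← ofReal_norm, ENNReal.ofReal_rpow_of_nonneg (norm_nonneg _) hp0.le]
  -- Compare v(x) with v(y) and weight by u(y)^q: the difference is controlled by Poincaré, and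
  -- v(y)^p u(y)^q is bounded because p < q and v u is bounded. Integrated over both variables, the
  -- left side is (∫v^p)(∫u^q), and the mass bound divides out the second factor.
  have hpt : ∀ᵐ z ∂ν, v z.1 ^ p * u z.2 ^ q ≤ 2 ^ p * (C ^ q * ‖v z.1 - v z.2‖ ^ p + N) := by
    filter_upwards [Measure.quasiMeasurePreserving_fst.ae hmemB,
      Measure.quasiMeasurePreserving_snd.ae hmemB] with z hz1 hz2
    have hv1 := one_le_logTrans hδ0 hδ1 hz1
    have hv2 := one_le_logTrans hδ0 hδ1 hz2
    have hu0 := hz2.1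
    have b1 : v z.1 ^ p ≤ 2 ^ p * (‖v z.1 - v z.2‖ ^ p + v z.2 ^ p) := by
      refine le_trans ?_ (add_rpow_le_two_rpow_mul (norm_nonneg _) (by linarith) hp0.le)
      refine Real.rpow_le_rpow (by linarith) ?_ hp0.le
      have := le_abs_self (v z.1 - v z.2)
      rw [Real.norm_eq_abs]; linarith
    have b2 : v z.2 ^ p * u z.2 ^ q ≤ N := by
      have e : u z.2 ^ q = u z.2 ^ p * u z.2 ^ (q - p) := by
        rw [← Real.rpow_add_of_nonneg hu0 hp0.le (by linarith)]; congr 1; ring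
      rw [e, ← mul_assoc, ← Real.mul_rpow (by linarith) hu0, hN]
      have b3 := logTrans_mul_le hδ0 hz2
      have b4 : 0 ≤ v z.2 * u z.2 := mul_nonneg (by linarith) hu0
      have b5 := hz2.2
      gcongr
    have b6 : u z.2 ^ q ≤ C ^ q := Real.rpow_le_rpow hu0 hz2.2 hq0.le
    have b7 : 0 ≤ u z.2 ^ q := Real.rpow_nonneg hu0 _
    calc _ ≤ 2 ^ p * (‖v z.1 - v z.2‖ ^ p + v z.2 ^ p) * u z.2 ^ q := by gcongr
      _ = 2 ^ p * (u z.2 ^ q * ‖v z.1 - v z.2‖ ^ p + v z.2 ^ p * u z.2 ^ q) := by ring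
      _ ≤ _ := by gcongr
  have hint : ∫ z, v z.1 ^ p * u z.2 ^ q ∂ν ≤ 2 ^ p * (C ^ q * E1 + N * (V * V)) := by
    calc _ ≤ ∫ z, 2 ^ p * (C ^ q * ‖v z.1 - v z.2‖ ^ p + N) ∂ν := by
          refine integral_mono_of_nonneg ?_ (((hdi.const_mul _).add (integrable_const _)).const_mul _) hpt
          filter_upwards [Measure.quasiMeasurePreserving_fst.ae hmemB,
            Measure.quasiMeasurePreserving_snd.ae hmemB] with z hz1 hz2
          have hv1 := one_le_logTrans hδ0 hδ1 hz1
          exact mul_nonneg (Real.rpow_nonneg (by linarith) _) (Real.rpow_nonneg hz2.1 _)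
      _ = 2 ^ p * (C ^ q * ∫ z, ‖v z.1 - v z.2‖ ^ p ∂ν + N * (V * V)) := by
          rw [integral_const_mul, integral_add (hdi.const_mul _) (integrable_const _),
            integral_const_mul, integral_const, hν, Measure.real, ← Set.univ_prod_univ,
            Measure.prod_prod, ENNReal.toReal_mul, smul_eq_mul, mul_comm N]
          rfl
      _ ≤ _ := by
          have : 0 ≤ C ^ q := Real.rpow_nonneg hC _
          gcongr
  rw [hν, integral_prod_mul (fun x => v x ^ p) (fun y => u y ^ q)] at hint
  have hvp : 0 ≤ ∫ x, v x ^ p ∂(ballMeasure n ρ) := by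
    refine integral_nonneg_of_ae ?_
    filter_upwards [hmemB] with x hx
    have := one_le_logTrans hδ0 hδ1 hx
    exact Real.rpow_nonneg (by linarith) _
  rw [le_inv_mul_iff₀ hc]
  calc _ ≤ (∫ y, u y ^ q ∂(ballMeasure n ρ)) * ∫ x, v x ^ p ∂(ballMeasure n ρ) := by gcongr
    _ ≤ _ := by rw [mul_comm]; exact hint

/-- Quantitative positivity of supersolutions: a lower bound on the mass in a ball yields a lower
bound in the concentric ball of half the radius. -/
theorem exists_interior_lower_bound (hp1 : 1 < p) (hpn : p < (n : ℝ)) {ρ : ℝ} (hρ : 0 < ρ)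
    {C : ℝ} (hC : 0 ≤ C) {c : ℝ} (hc : 0 < c) :
    ∃ ε : ℝ, 0 < ε ∧ ∀ (u : Sp n → ℝ) (G : Sp n → Sp n),
      BoundedWeak p C u G → IsSuper p G →
      c ≤ ∫ x, u x ^ critExp n p ∂(ballMeasure n (2 * ρ)) →
      ∀ᵐ x, ‖x‖ ≤ ρ → ε ≤ u x := by
  have hp0 : 0 < p := by linarith
  obtain ⟨L, hL0, hL⟩ := exists_gradient_cutoff_le n
  obtain ⟨M, hM⟩ := exists_integral_logTrans_le hp1 hpn (by positivity : 0 < 2 * ρ) hC hc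
  obtain ⟨B, hB⟩ := exists_logTrans_le hp1 hpn (by positivity : 0 ≤ L / ρ) M
  have hexp := Real.exp_pos (1 - B)
  refine ⟨Real.exp (1 - B) / 2, by positivity, fun u G hu hs hmass => ?_⟩
  -- B does not depend on δ. The bound v ≤ B yields u + δ ≥ exp(1 - B), and this δ costs at most
  -- half of it.
  set δ : ℝ := min 1 (Real.exp (1 - B) / 2) with hδ
  have hδ0 : 0 < δ := by positivity
  have hδ1 : δ ≤ 1 := min_le_left _ _
  have hcut := isCutoff_cutoff hL hρ
  have hmem : ∀ᵐ x, u x ∈ Set.Icc 0 C := by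
    filter_upwards [hu.nonneg, hu.le] with x h1 h2 using ⟨h1, h2⟩
  have hint : ∫ x, logTrans C δ (u x) ^ p * cutoff n ρ x ^ p ≤ M := by
    refine le_trans ?_ (hM δ u G hu hs hδ0 hδ1 hmass)
    have hfin : IntegrableOn (fun x => logTrans C δ (u x) ^ p) (ball 0 (2 * ρ)) := by
      have hc := continuousOn_logTrans_rpow (C := C) hδ0 hδ1 p
      obtain ⟨b, hb⟩ := isCompact_Icc.exists_bound_of_continuousOn hc
      refine IntegrableOn.of_bound measure_ball_lt_top (hu.aestronglyMeasurable_comp hc).restrict b ?_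
      exact ae_restrict_of_ae (hmem.mono fun x hx => hb _ hx)
    rw [ballMeasure, ← integral_indicator measurableSet_ball]
    refine integral_mono_ae (integrable_logTrans_rpow_mul hu hcut hδ0 hδ1 p hp0)
      (hfin.integrable_indicator measurableSet_ball) ?_
    filter_upwards [hmem] with x hx
    have h1 := one_le_logTrans hδ0 hδ1 hx
    have h2 : 0 ≤ logTrans C δ (u x) ^ p := Real.rpow_nonneg (by linarith) _
    by_cases hxb : x ∈ ball (0 : Sp n) (2 * ρ)
    · rw [Set.indicator_of_mem hxb]
      exact mul_le_of_le_one_right h2 (hcut.rpow_mem hp0.le x).2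
    · rw [Set.indicator_of_notMem hxb]
      rw [mem_ball_zero_iff, not_lt] at hxb
      simp only [cutoff_eq_zero hρ hxb, Real.zero_rpow hp0.ne', mul_zero, le_refl]
  filter_upwards [hB C δ u G (cutoff n ρ) hu hs hcut hδ0 hδ1 hint, hmem] with x hx1 hx2 hx
  have h1 := hx1 (cutoff_eq_one hρ hx)
  have hd : 0 < u x + δ := by linarith [hx2.1]
  have hq : 0 < (C + 1) / (u x + δ) := by positivity
  have h2 : Real.log ((C + 1) / (u x + δ)) ≤ B - 1 := by unfold logTrans at h1; linarith
  have h3 := (Real.log_le_iff_le_exp hq).1 h2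
  rw [div_le_iff₀ hd] at h3
  have h4 : Real.exp (1 - B) ≤ u x + δ := by
    have e : Real.exp (1 - B) * Real.exp (B - 1) = 1 := by rw [← Real.exp_add]; simp
    have := mul_le_mul_of_nonneg_left h3 hexp.le
    rw [← mul_assoc, e, one_mul] at this
    nlinarith
  have h5 : δ ≤ Real.exp (1 - B) / 2 := min_le_right _ _
  linarith

/-! ### Auxiliary facts for the global bound -/

/-- A set of full measure is dense, and a strict reverse inequality at a continuity point would
persist nearby. -/
theorem le_of_continuousAt_of_ae_le {f v : Sp n → ℝ} (hf : Continuous f) (h : ∀ᵐ x, f x ≤ v x)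
    {x : Sp n} (hv : ContinuousAt v x) : f x ≤ v x := by
  by_contra hlt
  push Not at hlt
  have h1 : ∀ᶠ y in 𝓝 x, v y < f y := hv.eventually_lt hf.continuousAt hlt
  have h2 : ∃ᶠ y in 𝓝 x, f y ≤ v y := mem_closure_iff_frequently.1 (Measure.dense_of_ae h x)
  obtain ⟨y, hy1, hy2⟩ := (h2.and_eventually h1).exists
  exact absurd hy1 (not_le.2 hy2)

/-- Needed because membership in D^{1,p} and the weak equation each provide their own weak gradient.
-/
theorem HasWeakGradient.ae_eq {u : Sp n → ℝ} {G₁ G₂ : Sp n → Sp n} (h₁ : HasWeakGradient u G₁)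
    (h₂ : HasWeakGradient u G₂) : ∀ᵐ x, G₁ x = G₂ x := by
  refine ae_eq_of_integral_contDiff_smul_eq h₁.2.1 h₂.2.1 fun φ hφ hφs => ?_
  have e1 := h₁.2.2 φ ⟨hφ, hφs⟩
  have e2 := h₂.2.2 φ ⟨hφ, hφs⟩
  rw [e1] at e2
  exact neg_injective e2

theorem memLp_mul_rpow {q : ℝ} (hq : 1 < q) {κ u : Sp n → ℝ} {K : ℝ}
    (hκm : AEStronglyMeasurable κ) (hκ : ∀ᵐ x, |κ x| ≤ K) (h0 : ∀ᵐ x, 0 ≤ u x)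
    (hu : MemLp u (ENNReal.ofReal q)) :
    MemLp (fun x => κ x * u x ^ (q - 1)) (ENNReal.ofReal q.conjExponent) := by
  have hqc := Real.HolderConjugate.conjExponent hq
  have hum : AEStronglyMeasurable (fun x => u x ^ (q - 1)) :=
    (Real.continuous_rpow_const (by linarith)).comp_aestronglyMeasurable hu.1
  have h1 : MemLp (fun x => u x ^ (q - 1)) (ENNReal.ofReal q.conjExponent) := by
    rw [← integrable_norm_rpow_iff hum (by simpa using hqc.symm.pos) ENNReal.ofReal_ne_top]
    refine (integrable_norm_rpow_ofReal (by linarith) hu).congr ?_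
    filter_upwards [h0] with x hx
    rw [ENNReal.toReal_ofReal hqc.symm.pos.le, Real.norm_of_nonneg (Real.rpow_nonneg hx _),
      ← Real.rpow_mul hx, hqc.sub_one_mul_conj, Real.norm_of_nonneg hx]
  refine (h1.norm.const_mul K).mono (hκm.mul hum) ?_
  filter_upwards [hκ] with x hx
  rw [norm_mul]
  refine (mul_le_mul_of_nonneg_right hx (norm_nonneg _)).trans ?_
  exact le_abs_self _

theorem exists_tail_le {F : Sp n → ℝ} (hF : Integrable F) {c : ℝ} (hc : 0 < c) :
    ∃ r : ℝ, 1 ≤ r ∧ ∫ x in (ball 0 (8 * r))ᶜ, F x ≤ c := by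
  have h := tendsto_setIntegral_of_antitone (μ := volume) (f := F)
    (s := fun j : ℕ => (ball (0 : Sp n) (j : ℝ))ᶜ)
    (fun j => measurableSet_ball.compl)
    (fun i j hij => Set.compl_subset_compl.2 (ball_subset_ball (by exact_mod_cast hij)))
    ⟨0, hF.integrableOn⟩
  have hempty : ⋂ j : ℕ, (ball (0 : Sp n) (j : ℝ))ᶜ = ∅ := by
    rw [← Set.compl_iUnion, iUnion_ball_nat, Set.compl_univ]
  rw [hempty, Measure.restrict_empty, integral_zero_measure] at h
  obtain ⟨j, hj1, hj2⟩ := ((h.eventually_le_const hc).and (eventually_ge_atTop 8)).exists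
  have hj : (8 : ℝ) ≤ j := by exact_mod_cast hj2
  refine ⟨j / 8, by linarith, ?_⟩
  rw [mul_div_cancel₀ _ (by norm_num : (8 : ℝ) ≠ 0)]
  exact hj1

/-- Dividing by N > 0 leaves 1 ≤ A^χ N^(χ-1), with a positive power of N since χ > 1. -/
theorem le_of_le_mul_rpow {N A χ : ℝ} (hN : 0 < N) (hA : 0 < A) (hχ : 1 < χ)
    (h : N ≤ (A * N) ^ χ) : A ^ (-(χ / (χ - 1))) ≤ N := by
  have h1 : 0 < χ - 1 := by linarith
  by_contra hlt
  push Not at hlt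
  have h2 : N ^ (χ - 1) < (A ^ (-(χ / (χ - 1)))) ^ (χ - 1) := Real.rpow_lt_rpow hN.le hlt h1
  rw [← Real.rpow_mul hA.le, neg_mul, div_mul_cancel₀ _ h1.ne'] at h2
  have h3 : (A * N) ^ χ = A ^ χ * N ^ (χ - 1) * N := by
    rw [Real.mul_rpow hA.le hN.le, mul_assoc, ← Real.rpow_add_one hN.ne']
    congr 2; ring
  have h4 : A ^ χ * A ^ (-χ) = 1 := by rw [← Real.rpow_add hA]; simp
  have h5 : 0 < A ^ χ := Real.rpow_pos_of_pos hA _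
  have h6 : A ^ χ * N ^ (χ - 1) < 1 := by
    have := mul_lt_mul_of_pos_left h2 h5
    rwa [h4] at this
  rw [h3] at h
  nlinarith

end CritPLaplace

/-! ### The global lower bound -/

open CritPLaplace Filter Topology Metric in
open scoped ENNReal NNReal in
theorem mainTheorem9 (n : ℕ) (p : ℝ) (hp1 : 1 < p) (hpn : p < (n : ℝ))
    (C₀ : ℝ) (hC₀ : 1 ≤ C₀) (K : ℝ) :
    ∃ c₀ : ℝ, 0 < c₀ ∧
      ∀ κ u : EuclideanSpace ℝ (Fin n) → ℝ,
        (∀ᵐ x, 0 < κ x) →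
        MemLp κ ⊤ →
        eLpNorm κ ⊤ volume ≤ ENNReal.ofReal K →
        CritPLaplace.MemD1p p u →
        (∀ᵐ x, 0 ≤ u x) →
        (¬ ∀ᵐ x, u x = 0) →
        CritPLaplace.IsWeakSolution p κ u →
        (∀ᵐ x, u x ≤ C₀ / (1 + ‖x‖ ^ (((n : ℝ) - p) / (p - 1)))) →
        (∀ᵐ x, c₀ / (1 + ‖x‖ ^ (((n : ℝ) - p) / (p - 1))) ≤ u x) ∧
        (∀ v : EuclideanSpace ℝ (Fin n) → ℝ, (∀ᵐ x, v x = u x) →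
          ∀ x, ContinuousAt v x →
            c₀ / (1 + ‖x‖ ^ (((n : ℝ) - p) / (p - 1))) ≤ v x) := by
  have hp0 : 0 < p := by linarith
  have hq := critExp_pos_facts hp1 hpn
  have hq1 := one_lt_critExp hp1 hpn
  have hq0 : 0 < critExp n p := by linarith
  set q := critExp n p with hqd
  have ha := decayExp_pos hp1 hpn
  change ∃ c₀ : ℝ, 0 < c₀ ∧ ∀ κ u : Sp n → ℝ, _ → _ → _ → _ → _ → _ → _ →
    (∀ᵐ x, u x ≤ C₀ / (1 + ‖x‖ ^ decayExp n p)) →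
    (∀ᵐ x, c₀ / (1 + ‖x‖ ^ decayExp n p) ≤ u x) ∧ (∀ v : Sp n → ℝ, _ → ∀ x, _ →
      c₀ / (1 + ‖x‖ ^ decayExp n p) ≤ v x)
  set a := decayExp n p with had
  set χ := q / p with hχd
  have hχ : 1 < χ := (one_lt_div hp0).2 hq.1
  set K' : ℝ := max K 0 with hK'
  -- The added 1 guarantees A > 0, so that a negative power of A is a positive constant.
  set A : ℝ := (sobolevConst n p : ℝ) ^ p * K' + 1 with hAd
  have hK0 : 0 ≤ K' := le_max_right _ _
  have hA : 0 < A := by positivity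
  set c₁ : ℝ := A ^ (-(χ / (χ - 1))) with hc₁
  have hc₁0 : 0 < c₁ := Real.rpow_pos_of_pos hA _
  -- The tail is controlled through a majorant depending on C₀, n and p only, so the radius r, and
  -- with it ε, is fixed before u and κ. The mass is found in the ball of radius 8r, positivity
  -- holds for |x| ≤ 4r, and comparison takes over beyond.
  have hhint : Integrable (fun x : Sp n => ‖C₀ * (2 ^ a * (1 + ‖x‖) ^ (-a))‖ ^ q) :=
    integrable_norm_rpow_ofReal hq0
      (((memLp_one_add_norm_rpow hq0 (lt_decayExp_mul_critExp hp1 hpn)).const_mul _).const_mul _)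
  obtain ⟨r, hr1, hr⟩ := exists_tail_le hhint (half_pos hc₁0)
  obtain ⟨ε, hε0, hε⟩ := exists_interior_lower_bound hp1 hpn (by linarith : 0 < 4 * r)
    (by linarith : 0 ≤ C₀) (half_pos hc₁0)
  refine ⟨ε, hε0, fun κ u hκ hκm hκK hD hu0 hune hsol hdec => ?_⟩
  obtain ⟨hum, G, hG, hGm⟩ := hD
  obtain ⟨G', hG', heq'⟩ := hsol
  have hGG := hG'.ae_eq hG
  have hnonneg : ∀ x : Sp n, 0 ≤ ‖x‖ ^ a := fun x => Real.rpow_nonneg (norm_nonneg _) _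
  have huC : ∀ᵐ x, u x ≤ C₀ := by
    filter_upwards [hdec] with x hx
    exact hx.trans (div_le_self (by linarith) (by linarith [hnonneg x]))
  have hu : BoundedWeak p C₀ u G := ⟨hG, hGm, hu0, huC⟩
  have hdec' : ∀ᵐ x, 1 ≤ ‖x‖ → |u x| ≤ C₀ * ‖x‖ ^ (-a) := by
    filter_upwards [hdec, hu0] with x hx h0 h1
    have hx0 : 0 < ‖x‖ := by linarith
    have : 0 < ‖x‖ ^ a := Real.rpow_pos_of_pos hx0 _
    rw [abs_of_nonneg h0, Real.rpow_neg hx0.le, ← div_eq_mul_inv]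
    exact hx.trans (div_le_div_of_nonneg_left (by linarith) this (by linarith))
  have hpair := hu.sobolevPair hp1 hpn hum (by linarith) hdec'
  have hκb : ∀ᵐ x, |κ x| ≤ K' := by
    filter_upwards [enorm_ae_le_eLpNormEssSup κ volume] with x hx
    rw [← eLpNorm_exponent_top] at hx
    have h1 := hx.trans hκK
    rw [← ofReal_norm, Real.norm_eq_abs] at h1
    have h2 := ENNReal.toReal_mono ENNReal.ofReal_ne_top h1
    rwa [ENNReal.toReal_ofReal (abs_nonneg _), ENNReal.toReal_ofReal'] at h2
  have hpc := Real.HolderConjugate.conjExponent hp1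
  have hqc := Real.HolderConjugate.conjExponent hq1
  have hfm := memLp_mul_rpow hq1 hκm.1 hκb hu0 hum
  have heq : ∀ φ : Sp n → ℝ, IsTestFunction φ →
      ∫ x, inner ℝ (pflux p (G x)) (gradient φ x) = ∫ x, (κ x * u x ^ (q - 1)) * φ x := by
    intro φ hφ
    rw [← heq' φ hφ]
    refine integral_congr_ae ?_
    filter_upwards [hGG] with x hx
    rw [hx, pflux, real_inner_smul_left]
  have hext : ∀ {w W}, SobolevPair p w W →
      ∫ x, inner ℝ (pflux p (G x)) (W x) = ∫ x, (κ x * u x ^ (q - 1)) * w x := fun h =>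
    h.integral_eq hpc hqc (memLp_pflux hp1 hpc hGm) hfm heq
  have hsuper : IsSuper p G := by
    intro w W h hw
    rw [hext h]
    refine integral_nonneg_of_ae ?_
    filter_upwards [hκ, hu0, hw] with x h1 h2 h3
    exact mul_nonneg (mul_nonneg h1.le (Real.rpow_nonneg h2 _)) h3
  have huI : Integrable (fun x => |u x| ^ q) := integrable_norm_rpow_ofReal hq0 hum
  set N := ∫ x, |u x| ^ q with hN
  have hN0 : 0 < N := by
    refine (integral_nonneg fun x => by positivity).lt_of_ne' fun h0 => hune ?_
    rw [integral_eq_zero_iff_of_nonneg (fun x => by positivity) huI] at h0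
    filter_upwards [h0] with x hx
    exact abs_eq_zero.1 ((Real.rpow_eq_zero (abs_nonneg _) hq0.ne').1 hx)
  -- The equation tested with u itself, admissible by its decay.
  have hen : ∫ x, ‖G x‖ ^ p ≤ K' * N := by
    have h1 := hext hpair
    simp only [inner_pflux_self hp1] at h1
    rw [h1, hN, ← integral_const_mul]
    refine integral_mono_of_nonneg ?_ (huI.const_mul _) ?_
    · filter_upwards [hκ, hu0] with x h1 h2
      exact mul_nonneg (mul_nonneg h1.le (Real.rpow_nonneg h2 _)) h2
    · filter_upwards [hκb, hu0] with x h1 h2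
      have e : u x ^ (q - 1) * u x = u x ^ q := by
        rw [← Real.rpow_add_one' h2 (by linarith)]; congr 1; ring
      rw [mul_assoc, e, abs_of_nonneg h2]
      exact mul_le_mul_of_nonneg_right ((le_abs_self _).trans h1) (Real.rpow_nonneg h2 _)
  have hNlow : c₁ ≤ N := by
    refine le_of_le_mul_rpow hN0 hA hχ ((hpair.integral_le hp1 hpn).trans ?_)
    refine Real.rpow_le_rpow (mul_nonneg (by positivity) (integral_nonneg fun x => by positivity)) ?_
      (by positivity)
    calc _ ≤ (sobolevConst n p : ℝ) ^ p * (K' * N) := by gcongr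
      _ ≤ A * N := by rw [hAd]; nlinarith
  have hmass : c₁ / 2 ≤ ∫ x, u x ^ q ∂(ballMeasure n (2 * (4 * r))) := by
    have e8 : 2 * (4 * r) = 8 * r := by ring
    have h1 : ∫ x in (ball (0 : Sp n) (8 * r))ᶜ, |u x| ^ q ≤ c₁ / 2 := by
      refine le_trans ?_ hr
      refine setIntegral_mono_on_ae huI.integrableOn hhint.integrableOn measurableSet_ball.compl ?_
      filter_upwards [hdec'] with x hx hxb
      rw [Set.mem_compl_iff, mem_ball_zero_iff, not_lt] at hxb
      have hx1 : 1 ≤ ‖x‖ := by linarith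
      refine Real.rpow_le_rpow (abs_nonneg _) ((hx hx1).trans (le_trans ?_ (le_abs_self _))) hq0.le
      gcongr
      exact norm_rpow_neg_le ha.le hx1
    have h2 : ∫ x in ball (0 : Sp n) (8 * r), |u x| ^ q = ∫ x, u x ^ q ∂(ballMeasure n (2 * (4 * r))) := by
      rw [ballMeasure, e8]
      refine integral_congr_ae (ae_restrict_of_ae ?_)
      filter_upwards [hu0] with x hx
      rw [abs_of_nonneg hx]
    have h3 := integral_add_compl (measurableSet_ball (x := (0 : Sp n)) (ε := 8 * r)) huI
    rw [← h2]
    linarith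
  have hin := hε u G hu hsuper hmass
  have hout := hu.exterior_lower_bound hp1 hpn hsuper hr1 hε0.le hin
  -- Since r ≥ 1, the exterior constant ε r^a is at least ε, so the interior constant works
  -- everywhere.
  have hae : ∀ᵐ x, ε / (1 + ‖x‖ ^ a) ≤ u x := by
    filter_upwards [hin, hout] with x h1 h2
    rcases le_or_gt ‖x‖ (4 * r) with h | h
    · exact (div_le_self hε0.le (by linarith [hnonneg x])).trans (h1 h)
    · refine le_trans ?_ (h2 h)
      have hx0 : 0 < ‖x‖ := by linarith
      have hxa : 0 < ‖x‖ ^ a := Real.rpow_pos_of_pos hx0 _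
      have hra : 1 ≤ r ^ a := Real.one_le_rpow hr1 ha.le
      rw [Real.rpow_neg hx0.le, ← div_eq_mul_inv]
      calc ε / (1 + ‖x‖ ^ a) ≤ ε / ‖x‖ ^ a :=
            div_le_div_of_nonneg_left hε0.le hxa (by linarith)
        _ ≤ ε * r ^ a / ‖x‖ ^ a := by
            gcongr
            exact le_mul_of_one_le_right hε0.le hra
  refine ⟨hae, fun v hv x hvx => ?_⟩
  have hcont : Continuous fun x : Sp n => ε / (1 + ‖x‖ ^ a) :=
    continuous_const.div (continuous_const.add (continuous_norm.rpow_const fun _ => Or.inr ha.le))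
      fun x => by linarith [hnonneg x]
  refine le_of_continuousAt_of_ae_le hcont ?_ hvx
  filter_upwards [hae, hv] with x h1 h2
  rw [h2]; exact h1
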